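/- Equip $\mathbb C^3$ with the Hermitian form $\langle z,w\rangle=\bar z_1w_3+\bar z_2w_2+\bar z_3w_1$. Let $\mathbb H^2_{\mathbb C}\subset\mathbb{CP}^2$ be the set of negative lines, $\partial_\infty\mathbb H^2_{\mathbb C}$ the set of null lines and $\overline{\mathbb H^2_{\mathbb C}}$ their union. For $p,q\in\mathbb C^3$ let $\mathfrak B(p,q)=\{[z]\in\overline{\mathbb H^2_{\mathbb C}} : |\langle z,p\rangle|=|\langle z,q\rangle|\}$. A \emph{Giraud disk} is an intersection $\mathfrak B(p,q)\cap\mathfrak B(p,r)$ with $p,q,r$ linearly independent and of equal norm, which is a closed topological disk whose interior is its part in $\mathbb H^2_{\mathbb C}$ and whose boundary circle is its part in $\partial_\infty\mathbb H^2_{\mathbb C}$. Let $\alpha\in\,]0,\frac\pi2[$ and $$S=\begin{pmatrix}1&\sqrt2e^{-i\alpha}&-1\\-\sqrt2e^{i\alpha}&-1&0\\-1&0&0\end{pmatrix},\quad T=\begin{pmatrix}0&0&-1\\0&-1&-\sqrt2e^{-i\alpha}\\-1&\sqrt2e^{i\alpha}&1\end{pmatrix},\quad U=S^{-1}T,$$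 $p_U=(1,-\tfrac{\sqrt2}2e^{i\alpha},e^{2i\alpha})$ (a fixed vector of $U$), $p_V=Sp_U$, $p_W=S^2p_U$, $p_A=(1,0,0)$, $p_B=(0,0,1)$. For $k\in\mathbb Z$ let $\mathcal J_k^+=\mathfrak B(p_U,U^kp_V)$, $\mathcal J_k^-=\mathfrak B(p_U,U^kp_W)$, $$\mathcal F_k^+=\{[z]\in\mathcal J_k^+ : |\langle z,p_U\rangle|\le\min(|\langle z,U^kp_W\rangle|,|\langle z,U^{k-1}p_W\rangle|)\},$$ $$\mathcal F_k^-=\{[z]\in\mathcal J_k^- : |\langle z,p_U\rangle|\le\min(|\langle z,U^kp_V\rangle|,|\langle z,U^{k+1}p_V\rangle|)\},$$ and write $\partial_\infty X=X\cap\partial_\infty\mathbb H^2_{\mathbb C}$. Let $Q_k^{+\circ}$ be the connected component of $[U^{k+1}p_A]$ in $\partial_\infty\mathcal F_k^+\setminus\{[U^kp_A],[U^kp_B]\}$, and put $Q_k^+=Q_k^{+\circ}\cup\{[U^kp_A],[U^kp_B]\}$ (the quadrilateral) and $B_k^+=\partial_\infty\mathcal F_k^+\setminus Q_k^{+\circ}$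 (the bigon). Likewise let $Q_k^{-\circ}$ be the connected component of $[U^kp_A]$ in $\partial_\infty\mathcal F_k^-\setminus\{[U^{k+1}p_A],[U^kp_B]\}$, $Q_k^-=Q_k^{-\circ}\cup\{[U^{k+1}p_A],[U^kp_B]\}$ and $B_k^-=\partial_\infty\mathcal F_k^-\setminus Q_k^{-\circ}$. Let $c_k=\partial_\infty(\mathcal J_k^+\cap\mathcal J_k^-)$ and $c'_k=\partial_\infty(\mathcal J_k^-\cap\mathcal J_{k+1}^+)$. The three points $[U^kp_A],[U^{k+1}p_A],[U^kp_B]$ lie on $c_k$, and the three points $[U^kp_B],[U^{k+1}p_A],[U^{k+1}p_B]$ lie on $c_k'$. If $x,y,w$ are the three points on $c\in\{c_k,c_k'\}$, then $c(x,y)$ denotes $c$ minus the connected component of $w$ in $c\setminus\{x,y\}$; brackets $[\,\cdot\,]$ of points are omitted in this notation. Then: \textbf{3-faces.} 1. $\mathcal F_0^+\cap\mathcal F_0^-=\mathcal J_0^+\cap\mathcal J_0^-$ and $\mathcal F_0^+\cap\mathcal F_{-1}^-=\mathcal J_0^+\cap\mathcal J_{-1}^-$, and these are Giraud disks. 2.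 $\mathcal F_0^-\cap\mathcal F_1^+=\mathcal J_0^-\cap\mathcal J_1^+$, and this is a Giraud disk (and so is $\mathcal F_0^-\cap\mathcal F_0^+$, by 1). 3. $\mathcal F_0^+\cap\mathcal F_1^+=\{[p_B],[Up_A]\}$. 4. $\mathcal F_0^-\cap\mathcal F_{-1}^-=\{[p_A],[p_B]\}$. \textbf{Arcs.} For each of the circles $c_0,c'_0,c'_{-1}$, the three sets $c(x,y)$ are topological arcs with endpoints $x$ and $y$. \textbf{Faces at infinity in $\mathcal J_0^+$.} 1. The boundary of $B_0^+$ in $\partial_\infty\mathcal J_0^+$ is $c_0(p_A,p_B)\cup c'_{-1}(p_A,p_B)$, and $B_0^+\cap Q_0^-=c_0(p_A,p_B)$, $B_0^+\cap Q_{-1}^-=c'_{-1}(p_A,p_B)$; moreover $B_0^+\cap B_0^-=\{[p_B]\}$, $B_0^+\cap B_{-1}^-=\{[p_A]\}$. 2. The boundary of $Q_0^+$ in $\partial_\infty\mathcal J_0^+$ is $c_0(p_A,Up_A)\cup c_0(Up_A,p_B)\cup c'_{-1}(U^{-1}p_B,p_B)\cup c'_{-1}(p_A,U^{-1}p_B)$,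 and $Q_0^+\cap Q_0^-=c_0(p_A,Up_A)\cup\{[p_B]\}$, $Q_0^+\cap B_0^-=c_0(Up_A,p_B)$, $Q_0^+\cap Q_{-1}^-=c'_{-1}(U^{-1}p_B,p_B)\cup\{[p_A]\}$, $Q_0^+\cap B_{-1}^-=c'_{-1}(p_A,U^{-1}p_B)$. 3. $(B_0^+\cup Q_0^+)\cap(B_{-1}^+\cup Q_{-1}^+)=\{[U^{-1}p_B],[p_A]\}$. 4. $(B_0^+\cup Q_0^+)\cap(B_1^+\cup Q_1^+)=\{[p_B],[Up_A]\}$. \textbf{Faces at infinity in $\mathcal J_0^-$.} 1. The boundary of $B_0^-$ in $\partial_\infty\mathcal J_0^-$ is $c_0(Up_A,p_B)\cup c'_0(Up_A,p_B)$, and $B_0^-\cap Q_0^+=c_0(Up_A,p_B)$, $B_0^-\cap Q_1^+=c'_0(Up_A,p_B)$; moreover $B_0^-\cap B_0^+=\{[p_B]\}$, $B_0^-\cap B_1^+=\{[Up_A]\}$. 2. The boundary of $Q_0^-$ in $\partial_\infty\mathcal J_0^-$ is $c_0(p_A,Up_A)\cup c_0(p_A,p_B)\cup c'_0(p_B,Up_B)\cup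 c'_0(Up_A,Up_B)$, and $Q_0^-\cap Q_0^+=c_0(p_A,Up_A)\cup\{[p_B]\}$, $Q_0^-\cap B_0^+=c_0(p_A,p_B)$, $Q_0^-\cap Q_1^+=c'_0(p_B,Up_B)\cup\{[Up_A]\}$, $Q_0^-\cap B_1^+=c'_0(Up_A,Up_B)$. 3. $(B_0^-\cup Q_0^-)\cap(B_{-1}^-\cup Q_{-1}^-)=\{[p_A],[p_B]\}$. 4. $(B_0^-\cup Q_0^-)\cap(B_1^-\cup Q_1^-)=\{[Up_A],[Up_B]\}$. -/

import Mathlib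

open scoped LinearAlgebra.Projectivization Matrix

noncomputable section

namespace Ford

/-! ### The complex hyperbolic plane in the projective plane -/

/-- Homogeneous coordinates. -/
abbrev V3 : Type := Fin 3 → ℂ

/-- The complex projective plane. -/
abbrev CP2 : Type := ℙ ℂ V3

/-- The usual (quotient) topology of the complex projective plane. -/
instance instTopologicalSpaceCP2 : TopologicalSpace CP2 :=
  TopologicalSpace.coinduced (Projectivization.mk' ℂ (V := V3)) inferInstance

/-- The Hermitian form of signature `(2,1)` whose matrix is antidiagonal with entries `1`,
conjugate linear in the first variable. -/
def herm (z w : V3) : ℂ :=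
  star (z 0) * w 2 + star (z 1) * w 1 + star (z 2) * w 0

/-- The complex hyperbolic plane: negative lines. -/
def H2 : Set CP2 := {P | (herm P.rep P.rep).re < 0}

/-- The boundary at infinity: null lines. -/
def bdH2 : Set CP2 := {P | (herm P.rep P.rep).re = 0}

/-- The closed ball: hyperbolic plane together with its boundary at infinity. -/
def clH2 : Set CP2 := {P | (herm P.rep P.rep).re ≤ 0}

theorem herm_smul_left (c : ℂ) (z w : V3) : herm (c • z) w = star c * herm z w := by
  simp only [herm, Pi.smul_apply, smul_eq_mul, star_mul']
  ring

/-- Inequalities between the moduli `|⟨z, p⟩|` and `|⟨z, q⟩|` do not depend on the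
representative `z` of a point of the projective plane. -/
theorem norm_herm_rep_le_iff (z : V3) (hz : z ≠ 0) (p q : V3) :
    ‖herm (Projectivization.mk ℂ z hz).rep p‖ ≤ ‖herm (Projectivization.mk ℂ z hz).rep q‖ ↔
      ‖herm z p‖ ≤ ‖herm z q‖ := by
  obtain ⟨a, ha⟩ := Projectivization.exists_smul_eq_mk_rep ℂ z hz
  have h0 : 0 < ‖star (a : ℂ)‖ := by
    rw [norm_star]
    exact norm_pos_iff.mpr a.ne_zero
  rw [← ha, Units.smul_def, herm_smul_left, herm_smul_left, norm_mul, norm_mul,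
    mul_le_mul_iff_right₀ h0]

/-! ### Extors, bisectors, Giraud disks -/

/-- The extor `𝔈(p,q)`. -/
def extor (p q : V3) : Set CP2 := {P | ‖herm P.rep p‖ = ‖herm P.rep q‖}

/-- The bisector `𝔅(p,q)`, taken in the closed ball. -/
def bisector (p q : V3) : Set CP2 := extor p q ∩ clH2

/-- A Giraud disk: the intersection of two coequidistant bisectors `𝔅(p,q)` and `𝔅(p,r)`, where
`p`, `q`, `r` have the same norm and are not in a common complex line, which is a closed
topological disk with interior in the hyperbolic plane and boundary circle at infinity. -/
def IsGiraudDisk (D : Set CP2) : Prop :=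
  (∃ p q r : V3, LinearIndependent ℂ ![p, q, r] ∧
      herm p p = herm q q ∧ herm p p = herm r r ∧
      D = bisector p q ∩ bisector p r) ∧
    ∃ φ : ℂ → CP2, ContinuousOn φ (Metric.closedBall 0 1) ∧
      Set.InjOn φ (Metric.closedBall 0 1) ∧
      φ '' Metric.ball 0 1 = D ∩ H2 ∧
      φ '' Metric.sphere 0 1 = D ∩ bdH2

/-! ### The group elements and the special points, for the parameter `α` -/

/-- The complex number `e^{iα}`. -/
def ex (α : ℝ) : ℂ := Complex.exp (α * Complex.I)

/-- The real number `√2` as a complex number. -/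
def r2 : ℂ := ((Real.sqrt 2 : ℝ) : ℂ)

theorem ex_mul_ex_neg (α : ℝ) : ex α * ex (-α) = 1 := by
  simp [ex, ← Complex.exp_add]

theorem r2_mul_r2 : r2 * r2 = 2 := by
  rw [r2, ← Complex.ofReal_mul, Real.mul_self_sqrt (by norm_num)]
  norm_num

/-- The generator `S`, of order three. -/
def S (α : ℝ) : Matrix.SpecialLinearGroup (Fin 3) ℂ :=
  ⟨!![1, r2 * ex (-α), -1;
      -(r2 * ex α), -1, 0;
      -1, 0, 0], by simp [Matrix.det_fin_three]⟩

/-- The generator `T`, of order three. -/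
def T (α : ℝ) : Matrix.SpecialLinearGroup (Fin 3) ℂ :=
  ⟨!![0, 0, -1;
      0, -1, -(r2 * ex (-α));
      -1, r2 * ex α, 1], by simp [Matrix.det_fin_three]⟩

/-- The element `U = S⁻¹ T`. -/
def U (α : ℝ) : Matrix.SpecialLinearGroup (Fin 3) ℂ := (S α)⁻¹ * T α

/-- The vector `p_U`, fixed by `U`. -/
def pU (α : ℝ) : V3 := ![1, -(r2 / 2 * ex α), ex α ^ 2]

/-- The vector `p_V = S p_U`. -/
def pV (α : ℝ) : V3 := (S α).1 *ᵥ pU α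

/-- The vector `p_W = S² p_U`. -/
def pW (α : ℝ) : V3 := (S α).1 *ᵥ pV α

/-- The point `[U^k p_A]`, where `p_A = (1,0,0)`. -/
def ptA (α : ℝ) (k : ℤ) : CP2 :=
  (U α ^ k) • Projectivization.mk ℂ (![1, 0, 0] : V3) (by simp)

/-- The point `[U^k p_B]`, where `p_B = (0,0,1)`. -/
def ptB (α : ℝ) (k : ℤ) : CP2 :=
  (U α ^ k) • Projectivization.mk ℂ (![0, 0, 1] : V3) (by simp)

/-- The vector `U^k p_V`. -/
def vV (α : ℝ) (k : ℤ) : V3 := (U α ^ k).1 *ᵥ pV α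

/-- The vector `U^k p_W`. -/
def vW (α : ℝ) (k : ℤ) : V3 := (U α ^ k).1 *ᵥ pW α

/-! ### Bisectors and 3-faces -/

/-- The bisector `𝒥_k^+`. -/
def Jp (α : ℝ) (k : ℤ) : Set CP2 := bisector (pU α) (vV α k)

/-- The bisector `𝒥_k^-`. -/
def Jm (α : ℝ) (k : ℤ) : Set CP2 := bisector (pU α) (vW α k)

/-- The 3-face `ℱ_k^+`. -/
def Fp (α : ℝ) (k : ℤ) : Set CP2 :=
  {P | P ∈ Jp α k ∧
    ‖herm P.rep (pU α)‖ ≤ min ‖herm P.rep (vW α k)‖ ‖herm P.rep (vW α (k - 1))‖}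

/-- The 3-face `ℱ_k^-`. -/
def Fm (α : ℝ) (k : ℤ) : Set CP2 :=
  {P | P ∈ Jm α k ∧
    ‖herm P.rep (pU α)‖ ≤ min ‖herm P.rep (vV α k)‖ ‖herm P.rep (vV α (k + 1))‖}

/-! ### Pieces at infinity -/

/-- For a closed set `X` with two marked points `a`, `b`: the piece of `X` cut off by `a` and `b`
which contains `c`, together with `a` and `b`. -/
def pieceThrough (X : Set CP2) (a b c : CP2) : Set CP2 :=
  connectedComponentIn (X \ {a, b}) c ∪ {a, b}

/-- For a closed set `X` with two marked points `a`, `b`: what remains of `X` when the piece cut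
off by `a` and `b` which contains `c` is taken away. When `X` is a topological circle through
`a`, `b`, `c`, this is the closed arc of `X` from `a` to `b` which avoids `c`. -/
def pieceAvoiding (X : Set CP2) (a b c : CP2) : Set CP2 :=
  X \ connectedComponentIn (X \ {a, b}) c

/-- The quadrilateral `Q_k^+`: the boundary at infinity of `ℱ_k^+` is cut by the two points
`[U^k p_A]` and `[U^k p_B]`, where the two Giraud circles bordering it touch; the quadrilateral is
the piece with the further vertices `[U^{k+1} p_A]` and `[U^{k-1} p_B]`. -/
def Qp (α : ℝ) (k : ℤ) : Set CP2 :=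
  pieceThrough (Fp α k ∩ bdH2) (ptA α k) (ptB α k) (ptA α (k + 1))

/-- The bigon `B_k^+`, with vertices `[U^k p_A]` and `[U^k p_B]`: the other piece. -/
def Bp (α : ℝ) (k : ℤ) : Set CP2 :=
  pieceAvoiding (Fp α k ∩ bdH2) (ptA α k) (ptB α k) (ptA α (k + 1))

/-- The quadrilateral `Q_k^-`: the boundary at infinity of `ℱ_k^-` is cut by the two points
`[U^{k+1} p_A]` and `[U^k p_B]`, where the two Giraud circles bordering it touch; the
quadrilateral is the piece with the further vertices `[U^k p_A]` and `[U^{k+1} p_B]`. -/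
def Qm (α : ℝ) (k : ℤ) : Set CP2 :=
  pieceThrough (Fm α k ∩ bdH2) (ptA α (k + 1)) (ptB α k) (ptA α k)

/-- The bigon `B_k^-`, with vertices `[U^{k+1} p_A]` and `[U^k p_B]`: the other piece. -/
def Bm (α : ℝ) (k : ℤ) : Set CP2 :=
  pieceAvoiding (Fm α k ∩ bdH2) (ptA α (k + 1)) (ptB α k) (ptA α k)

/-- The Giraud circle `∂∞𝒥_k^+ ∩ ∂∞𝒥_k^-`; it contains `[U^k p_A]`, `[U^k p_B]` and
`[U^{k+1} p_A]`. -/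
def circ (α : ℝ) (k : ℤ) : Set CP2 := Jp α k ∩ Jm α k ∩ bdH2

/-- The Giraud circle `∂∞𝒥_k^- ∩ ∂∞𝒥_{k+1}^+`; it contains `[U^k p_B]`, `[U^{k+1} p_A]` and
`[U^{k+1} p_B]`. -/
def circ' (α : ℝ) (k : ℤ) : Set CP2 := Jm α k ∩ Jp α (k + 1) ∩ bdH2

/-- `X` is a topological arc with endpoints `a` and `b`. -/
def IsArc (X : Set CP2) (a b : CP2) : Prop :=
  ∃ γ : ℝ → CP2, ContinuousOn γ (Set.Icc 0 1) ∧ Set.InjOn γ (Set.Icc 0 1) ∧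
    γ '' Set.Icc 0 1 = X ∧ γ 0 = a ∧ γ 1 = b

/-- The topological boundary of `X` inside the closed set `Y`. -/
def boundaryIn (Y X : Set CP2) : Set CP2 := closure X ∩ closure (Y \ X)

/-! ### The arcs bordering the bigons and quadrilaterals

The points `[U^k p_A]`, `[U^{k+1} p_A]`, `[U^k p_B]` cut the circle `circ α k` into three arcs, and
the points `[U^k p_B]`, `[U^{k+1} p_A]`, `[U^{k+1} p_B]` cut the circle `circ' α k` into three
arcs. -/

/-- The arc of `circ α k` from `[U^k p_A]` to `[U^{k+1} p_A]`. -/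
def arcAA (α : ℝ) (k : ℤ) : Set CP2 :=
  pieceAvoiding (circ α k) (ptA α k) (ptA α (k + 1)) (ptB α k)

/-- The arc of `circ α k` from `[U^k p_A]` to `[U^k p_B]`. -/
def arcAB (α : ℝ) (k : ℤ) : Set CP2 :=
  pieceAvoiding (circ α k) (ptA α k) (ptB α k) (ptA α (k + 1))

/-- The arc of `circ α k` from `[U^{k+1} p_A]` to `[U^k p_B]`. -/
def arcUAB (α : ℝ) (k : ℤ) : Set CP2 :=
  pieceAvoiding (circ α k) (ptA α (k + 1)) (ptB α k) (ptA α k)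

/-- The arc of `circ' α k` from `[U^k p_B]` to `[U^{k+1} p_B]`. -/
def arcBB' (α : ℝ) (k : ℤ) : Set CP2 :=
  pieceAvoiding (circ' α k) (ptB α k) (ptB α (k + 1)) (ptA α (k + 1))

/-- The arc of `circ' α k` from `[U^{k+1} p_A]` to `[U^k p_B]`. -/
def arcUAB' (α : ℝ) (k : ℤ) : Set CP2 :=
  pieceAvoiding (circ' α k) (ptA α (k + 1)) (ptB α k) (ptB α (k + 1))

/-- The arc of `circ' α k` from `[U^{k+1} p_A]` to `[U^{k+1} p_B]`. -/
def arcUAUB' (α : ℝ) (k : ℤ) : Set CP2 :=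
  pieceAvoiding (circ' α k) (ptA α (k + 1)) (ptB α (k + 1)) (ptB α k)

end Ford

end

noncomputable section

namespace Ford

/-! ### Isometries and their action -/

/-! Symmetry reduces everything to one 3-face. `U` fixes `p_U` and shifts all indices. `S⁻¹`
permutes `p_U`, `p_V`, `p_W` cyclically and sends `U⁻¹ p_W` to `U p_V`. Hence it carries `ℱ_0^+` to
`ℱ_0^-`, preserves `c_0` while rotating its three vertices, and carries `c'_{-1}` to `c'_0`. All
statements about `ℱ_0^-` and its neighbours are images of statements about `ℱ_0^+`.

For `ℱ_0^+`, take affine coordinates `(N, E)` in which the hyperbolic plane is the unit ball. The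
moduli against `p_U` and `p_V` are `|i sin α - N/2 ± cos α E|`, and those against `p_W` and `U⁻¹
p_W` depend on `N` alone. On `𝒥_0^+` the two inequalities of the face say that `3 cos α (cos α |N|²
∓ Re N) + cos² α (1 - |N|² - |E|²)` is nonnegative for both signs. The sum of the two expressions is
nonnegative on the ball. So where one vanishes the other is nonnegative, and each Giraud disk lies
wholly in the face (`Jp_inter_Jm_subset`, `Jp_inter_Jm'_subset`). Both vanish only when `N = 0` on
the sphere, which gives the tangency points `p_A`, `p_B` (`eq_of_sum_eq_zero`).

At infinity the face is `|Re N| ≤ cos α |N|²` on the spinal sphere, and the Giraud circles are the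
equality cases, one for each sign of `Re N`. Since `cos α < 1`, the line `Im N = 0` meets the face
only in `p_A` and `p_B`, so the face splits there into a part with `Im N ≤ 0` (the bigon) and a part
with `Im N ≥ 0` (the quadrilateral). As the pieces are defined by connected components, the point to
prove is that the part `Im N > 0` is connected (`isPreconnected_openUpperFace`). It is retracted
radially onto an arc of `E = 0` where `Re N ≠ 0`, and the remaining points are limits of such
points. The Giraud circles have an explicit parametrization `arcPt` which exhibits their arcs. An
intersection of two pieces lies on one of these circles, where it becomes an intersection of arcs.

For Giraud disks, the triples `(p_U, p_V, p_W)` and `(p_U, p_V, U⁻¹ p_W)` are orbits of `S` and `T`,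
both of order three, and have the same Gram matrix. The equidistant points form a torus of angles,
on which the ball is a superlevel set of a product of three cosines. This set is convex because `log
cos` is concave, so it is a closed disk (`HasGram.isGiraudDisk`). -/

theorem star_ex (α : ℝ) : star (ex α) = ex (-α) := by
  simp [ex, ← Complex.exp_conj]

theorem star_r2 : star r2 = r2 := by
  simp [r2]

/-- The matrix `g` preserves the Hermitian form. -/
def IsIsom (g : Matrix.SpecialLinearGroup (Fin 3) ℂ) : Prop :=
  ∀ z w : V3, herm (g • z) (g • w) = herm z w

theorem IsIsom.inv {g : Matrix.SpecialLinearGroup (Fin 3) ℂ} (h : IsIsom g) : IsIsom g⁻¹ := by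
  intro z w
  have := h (g⁻¹ • z) (g⁻¹ • w)
  rw [smul_inv_smul, smul_inv_smul] at this
  exact this.symm

theorem IsIsom.mul {g g' : Matrix.SpecialLinearGroup (Fin 3) ℂ} (h : IsIsom g) (h' : IsIsom g') :
    IsIsom (g * g') := by
  intro z w
  rw [mul_smul, mul_smul, h, h']

theorem smul_S (α : ℝ) (z : V3) : S α • z =
    ![z 0 + r2 * ex (-α) * z 1 - z 2, -(r2 * ex α) * z 0 - z 1, -z 0] := by
  rw [Matrix.SpecialLinearGroup.smul_def]
  ext i
  fin_cases i
  all_goals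
    simp [S, Matrix.mulVec, dotProduct, Fin.sum_univ_three]
    try ring

theorem smul_T (α : ℝ) (z : V3) : T α • z =
    ![-z 2, -z 1 - r2 * ex (-α) * z 2, -z 0 + r2 * ex α * z 1 + z 2] := by
  rw [Matrix.SpecialLinearGroup.smul_def]
  ext i
  fin_cases i
  all_goals
    simp [T, Matrix.mulVec, dotProduct, Fin.sum_univ_three]
    try ring

theorem isIsom_S (α : ℝ) : IsIsom (S α) := by
  intro z w
  have h := ex_mul_ex_neg α
  have hr := r2_mul_r2
  have e1 := star_ex α
  have e2 : star (ex (-α)) = ex α := by simpa using star_ex (-α)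
  simp only [herm, smul_S, Matrix.cons_val_zero, Matrix.cons_val_one, Matrix.cons_val, star_sub,
    star_add, star_mul', star_neg, e1, e2, star_r2]
  linear_combination (star (z 0) * w 0 * r2 * r2) * h + star (z 0) * w 0 * hr

theorem isIsom_T (α : ℝ) : IsIsom (T α) := by
  intro z w
  have h := ex_mul_ex_neg α
  have hr := r2_mul_r2
  have e1 := star_ex α
  have e2 : star (ex (-α)) = ex α := by simpa using star_ex (-α)
  simp only [herm, smul_T, Matrix.cons_val_zero, Matrix.cons_val_one, Matrix.cons_val, star_sub,
    star_add, star_mul', star_neg, e1, e2, star_r2]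
  linear_combination (star (z 2) * w 2 * r2 * r2) * h + star (z 2) * w 2 * hr

theorem isIsom_U (α : ℝ) : IsIsom (U α) := (isIsom_S α).inv.mul (isIsom_T α)

theorem S_pU (α : ℝ) : S α • pU α = pV α := rfl

theorem S_pV (α : ℝ) : S α • pV α = pW α := rfl

theorem r2_ex_sq (α : ℝ) : r2 * ex α * (r2 * ex (-α)) = 2 := by
  linear_combination (r2 * r2) * ex_mul_ex_neg α + r2_mul_r2

theorem S_S_S (α : ℝ) (z : V3) : S α • S α • S α • z = z := by
  have h := r2_ex_sq α
  simp only [smul_S]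
  ext i
  fin_cases i <;> simp
  · linear_combination (z 2 - z 0 - z 1 * r2 * ex (-α)) * h
  · linear_combination (z 1 + r2 * ex α * z 0) * h
  · linear_combination z 0 * h

theorem T_T_T (α : ℝ) (z : V3) : T α • T α • T α • z = z := by
  have h := r2_ex_sq α
  simp only [smul_T]
  ext i
  fin_cases i <;> simp
  · linear_combination z 2 * h
  · linear_combination (z 1 + r2 * ex (-α) * z 2) * h
  · linear_combination (z 0 - z 2 - r2 * ex α * z 1) * h

theorem T_pU (α : ℝ) : T α • pU α = pV α := by
  have h := r2_ex_sq α
  rw [← S_pU, smul_T, smul_S]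
  ext i
  fin_cases i <;> simp [pU]
  · linear_combination h / 2
  · linear_combination (-r2 * ex α) * ex_mul_ex_neg α
  · linear_combination (-(ex α ^ 2 / 2)) * r2_mul_r2

theorem U_pU (α : ℝ) : U α • pU α = pU α := by
  rw [U, mul_smul, T_pU, ← S_pU, inv_smul_smul]

theorem Sinv_pU (α : ℝ) : (S α)⁻¹ • pU α = pW α := by
  rw [inv_smul_eq_iff, ← S_pV, ← S_pU, S_S_S]

theorem Sinv_pV (α : ℝ) : (S α)⁻¹ • pV α = pU α := by
  rw [inv_smul_eq_iff, S_pU]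

theorem Sinv_pW (α : ℝ) : (S α)⁻¹ • pW α = pV α := by
  rw [inv_smul_eq_iff, S_pV]

theorem vV_zero (α : ℝ) : vV α 0 = pV α := by simp [vV]

theorem vW_zero (α : ℝ) : vW α 0 = pW α := by simp [vW]

theorem U_zpow_vV (α : ℝ) (j k : ℤ) : (U α ^ j) • vV α k = vV α (k + j) := by
  change (U α ^ j) • (U α ^ k) • pV α = (U α ^ (k + j)) • pV α
  rw [smul_smul, ← zpow_add, add_comm]

theorem U_zpow_vW (α : ℝ) (j k : ℤ) : (U α ^ j) • vW α k = vW α (k + j) := by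
  change (U α ^ j) • (U α ^ k) • pW α = (U α ^ (k + j)) • pW α
  rw [smul_smul, ← zpow_add, add_comm]

theorem U_zpow_ptA (α : ℝ) (j k : ℤ) : (U α ^ j) • ptA α k = ptA α (k + j) := by
  rw [ptA, ptA, smul_smul, ← zpow_add, add_comm]

theorem U_zpow_ptB (α : ℝ) (j k : ℤ) : (U α ^ j) • ptB α k = ptB α (k + j) := by
  rw [ptB, ptB, smul_smul, ← zpow_add, add_comm]

theorem U_zpow_pU (α : ℝ) (j : ℤ) : (U α ^ j) • pU α = pU α := by
  have h : U α ∈ MulAction.stabilizer (Matrix.SpecialLinearGroup (Fin 3) ℂ) (pU α) := U_pU α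
  exact Subgroup.zpow_mem _ h j

theorem Uinv_eq (α : ℝ) : (U α)⁻¹ = (T α)⁻¹ * S α := by
  rw [U, mul_inv_rev, inv_inv]

theorem T_inv_smul (α : ℝ) (z : V3) : (T α)⁻¹ • z = T α • T α • z := by
  rw [inv_smul_eq_iff, T_T_T]

/-- Since `U⁻¹ = T⁻¹ S` and `S p_W = p_U`, this vector is `T⁻¹ p_U = T² p_U`. Thus `p_U`, `p_V`,
`U⁻¹ p_W` form an orbit of `T`, as `p_U`, `p_V`, `p_W` form one of `S`. -/
theorem vW_neg_one (α : ℝ) : vW α (-1) = T α • pV α := by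
  change (U α ^ (-1 : ℤ)) • pW α = _
  rw [zpow_neg_one, Uinv_eq, mul_smul, ← S_pV, ← S_pU, S_S_S, T_inv_smul, T_pU, S_pU]

theorem Sinv_vW (α : ℝ) : (S α)⁻¹ • vW α (-1) = vV α 1 := by
  change _ = (U α ^ (1 : ℤ)) • pV α
  rw [vW_neg_one, zpow_one, U, mul_smul]

theorem S_ptA (α : ℝ) : (S α) • ptA α 0 = ptA α 1 := by
  rw [ptA, ptA, zpow_zero, one_smul, zpow_one, U, mul_smul, eq_inv_smul_iff]
  simp only [Projectivization.smul_mk, smul_S, smul_T]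
  rw [Projectivization.mk_eq_mk_iff']
  refine ⟨1, ?_⟩
  have h := r2_ex_sq α
  ext i
  fin_cases i <;> simp
  linear_combination h

theorem S_ptB (α : ℝ) : (S α) • ptB α 0 = ptA α 0 := by
  rw [ptA, ptB, zpow_zero, one_smul, one_smul]
  simp only [Projectivization.smul_mk, smul_S]
  rw [Projectivization.mk_eq_mk_iff']
  refine ⟨-1, ?_⟩
  ext i
  fin_cases i <;> simp

theorem S_S_S_pt (α : ℝ) (P : CP2) : S α • S α • S α • P = P := by
  induction P using Projectivization.ind with
  | h v hv => simp only [Projectivization.smul_mk, S_S_S]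

theorem T_T_T_pt (α : ℝ) (P : CP2) : T α • T α • T α • P = P := by
  induction P using Projectivization.ind with
  | h v hv => simp only [Projectivization.smul_mk, T_T_T]

theorem T_ptA (α : ℝ) : (T α) • ptA α 0 = ptB α 0 := by
  rw [ptA, ptB, zpow_zero, one_smul, one_smul]
  simp only [Projectivization.smul_mk, smul_T]
  rw [Projectivization.mk_eq_mk_iff']
  refine ⟨-1, ?_⟩
  ext i
  fin_cases i <;> simp

theorem T_ptB (α : ℝ) : (T α) • ptB α 0 = ptB α (-1) := by
  have h : ptB α (-1) = (U α)⁻¹ • ptB α 0 := by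
    rw [ptB, ptB, zpow_neg_one, zpow_zero, one_smul]
  rw [h, Uinv_eq, mul_smul, S_ptB, eq_inv_smul_iff]
  conv_rhs => rw [← T_T_T_pt α (ptA α 0), T_ptA]

/-- With the next two lemmas: `S⁻¹` rotates the vertices of `c_0` by `p_A ↦ p_B ↦ U p_A ↦ p_A`. This
decides which arc goes to which under the symmetry. -/
theorem Sinv_ptA_zero (α : ℝ) : (S α)⁻¹ • ptA α 0 = ptB α 0 := by
  rw [inv_smul_eq_iff, S_ptB]

theorem Sinv_ptA_one (α : ℝ) : (S α)⁻¹ • ptA α 1 = ptA α 0 := by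
  rw [inv_smul_eq_iff, S_ptA]

theorem Sinv_ptB_zero (α : ℝ) : (S α)⁻¹ • ptB α 0 = ptA α 1 := by
  rw [inv_smul_eq_iff, ← S_ptA, ← S_ptB, S_S_S_pt]

theorem Sinv_ptB_neg_one (α : ℝ) : (S α)⁻¹ • ptB α (-1) = ptB α 1 := by
  have h : ptB α 1 = U α • ptB α 0 := by
    rw [ptB, ptB, zpow_one, zpow_zero, one_smul]
  rw [h, U, mul_smul, T_ptB]

theorem ptA_one_eq (α : ℝ) :
    ptA α 1 = Projectivization.mk ℂ (![1, -(r2 * ex α), -1] : V3) (by simp) := by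
  rw [← S_ptA, ptA, zpow_zero, one_smul]
  simp only [Projectivization.smul_mk, smul_S]
  simp

theorem ptB_neg_one_eq (α : ℝ) :
    ptB α (-1) = Projectivization.mk ℂ (![-1, -(r2 * ex (-α)), 1] : V3) (by simp) := by
  rw [← T_ptB, ptB, zpow_zero, one_smul]
  simp only [Projectivization.smul_mk, smul_T]
  simp

/-! ### Equivariance -/

theorem continuous_mk : Continuous (Projectivization.mk' ℂ (V := V3)) :=
  continuous_coinduced_rng

theorem isQuotientMap_mk : Topology.IsQuotientMap (Projectivization.mk' ℂ (V := V3)) := by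
  refine ⟨⟨rfl⟩, fun P => ?_⟩
  induction P using Projectivization.ind with
  | h v hv => exact ⟨⟨v, hv⟩, rfl⟩

theorem continuous_smul_CP2 (g : Matrix.SpecialLinearGroup (Fin 3) ℂ) :
    Continuous (fun P : CP2 => g • P) := by
  rw [isQuotientMap_mk.continuous_iff]
  have h : ((fun P : CP2 => g • P) ∘ Projectivization.mk' ℂ (V := V3)) =
      Projectivization.mk' ℂ (V := V3) ∘
        (fun z => ⟨g • z.1, (smul_ne_zero_iff_ne g).mpr z.2⟩) := by
    ext1 z
    simp [Projectivization.smul_mk, Function.comp, Projectivization.mk'_eq_mk]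
  rw [h]
  refine continuous_mk.comp (Continuous.subtype_mk ?_ _)
  exact Continuous.matrix_mulVec continuous_const continuous_subtype_val

/-- The homeomorphism of the projective plane defined by a matrix. -/
def smulHomeo (g : Matrix.SpecialLinearGroup (Fin 3) ℂ) : CP2 ≃ₜ CP2 where
  toFun P := g • P
  invFun P := g⁻¹ • P
  left_inv P := inv_smul_smul g P
  right_inv P := smul_inv_smul g P
  continuous_toFun := continuous_smul_CP2 g
  continuous_invFun := continuous_smul_CP2 g⁻¹

theorem smulHomeo_apply (g : Matrix.SpecialLinearGroup (Fin 3) ℂ) (P : CP2) :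
    smulHomeo g P = g • P := rfl

theorem smulHomeo_image_eq {g : Matrix.SpecialLinearGroup (Fin 3) ℂ} {A B : Set CP2}
    (h : ∀ P, g • P ∈ B ↔ P ∈ A) : smulHomeo g '' A = B := by
  ext P
  constructor
  · rintro ⟨Q, hQ, rfl⟩
    exact (h Q).mpr hQ
  · intro hP
    refine ⟨g⁻¹ • P, (h _).mp (by rwa [smul_inv_smul]), ?_⟩
    rw [smulHomeo_apply, smul_inv_smul]

theorem norm_herm_rep_eq_iff (z : V3) (hz : z ≠ 0) (p q : V3) :
    ‖herm (Projectivization.mk ℂ z hz).rep p‖ = ‖herm (Projectivization.mk ℂ z hz).rep q‖ ↔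
      ‖herm z p‖ = ‖herm z q‖ := by
  simp only [le_antisymm_iff, norm_herm_rep_le_iff]

/-- The representative is a nonzero multiple `a z`, so the form is multiplied by `|a|²` and keeps
its sign. Membership in the ball and its boundary can then be tested on any vector. -/
theorem exists_herm_rep (z : V3) (hz : z ≠ 0) : ∃ r : ℝ, 0 < r ∧
    (herm (Projectivization.mk ℂ z hz).rep (Projectivization.mk ℂ z hz).rep).re =
      r * (herm z z).re := by
  obtain ⟨a, ha⟩ := Projectivization.exists_smul_eq_mk_rep ℂ z hz
  refine ⟨Complex.normSq a, Complex.normSq_pos.mpr a.ne_zero, ?_⟩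
  have h : herm ((a : ℂ) • z) ((a : ℂ) • z) = (Complex.normSq a : ℂ) * herm z z := by
    rw [Complex.normSq_eq_conj_mul_self]
    simp only [herm, Pi.smul_apply, smul_eq_mul, ← starRingEnd_apply, map_mul]
    ring
  rw [← ha, Units.smul_def, h, Complex.re_ofReal_mul]

theorem mk_mem_clH2 (z : V3) (hz : z ≠ 0) :
    Projectivization.mk ℂ z hz ∈ clH2 ↔ (herm z z).re ≤ 0 := by
  obtain ⟨r, hr, h⟩ := exists_herm_rep z hz
  rw [clH2, Set.mem_ofPred_eq, h, mul_nonpos_iff_pos_imp_nonpos]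
  constructor
  · exact fun h => h.1 hr
  · exact fun h => ⟨fun _ => h, fun _ => hr.le⟩

theorem mk_mem_bdH2 (z : V3) (hz : z ≠ 0) :
    Projectivization.mk ℂ z hz ∈ bdH2 ↔ (herm z z).re = 0 := by
  obtain ⟨r, hr, h⟩ := exists_herm_rep z hz
  rw [bdH2, Set.mem_ofPred_eq, h, mul_eq_zero_iff_left hr.ne']

theorem mk_mem_H2 (z : V3) (hz : z ≠ 0) :
    Projectivization.mk ℂ z hz ∈ H2 ↔ (herm z z).re < 0 := by
  obtain ⟨r, hr, h⟩ := exists_herm_rep z hz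
  rw [H2, Set.mem_ofPred_eq, h, ← not_le, ← not_le,
    mul_nonneg_iff_of_pos_left hr]

section

variable {g : Matrix.SpecialLinearGroup (Fin 3) ℂ}

theorem IsIsom.norm_le_iff (hg : IsIsom g) (P : CP2) (p q : V3) :
    ‖herm (g • P).rep p‖ ≤ ‖herm (g • P).rep q‖ ↔
      ‖herm P.rep (g⁻¹ • p)‖ ≤ ‖herm P.rep (g⁻¹ • q)‖ := by
  induction P using Projectivization.ind with
  | h v hv =>
    rw [Projectivization.smul_mk, norm_herm_rep_le_iff, norm_herm_rep_le_iff]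
    rw [← hg v (g⁻¹ • p), ← hg v (g⁻¹ • q), smul_inv_smul, smul_inv_smul]

theorem IsIsom.norm_eq_iff (hg : IsIsom g) (P : CP2) (p q : V3) :
    ‖herm (g • P).rep p‖ = ‖herm (g • P).rep q‖ ↔
      ‖herm P.rep (g⁻¹ • p)‖ = ‖herm P.rep (g⁻¹ • q)‖ := by
  simp only [le_antisymm_iff, hg.norm_le_iff]

theorem IsIsom.mem_clH2 (hg : IsIsom g) (P : CP2) : g • P ∈ clH2 ↔ P ∈ clH2 := by
  induction P using Projectivization.ind with
  | h v hv => rw [Projectivization.smul_mk, mk_mem_clH2, mk_mem_clH2, hg]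

theorem IsIsom.mem_bdH2 (hg : IsIsom g) (P : CP2) : g • P ∈ bdH2 ↔ P ∈ bdH2 := by
  induction P using Projectivization.ind with
  | h v hv => rw [Projectivization.smul_mk, mk_mem_bdH2, mk_mem_bdH2, hg]

theorem IsIsom.mem_bisector (hg : IsIsom g) (P : CP2) (p q : V3) :
    g • P ∈ bisector p q ↔ P ∈ bisector (g⁻¹ • p) (g⁻¹ • q) :=
  and_congr (hg.norm_eq_iff P p q) (hg.mem_clH2 P)

end

theorem mem_Jp {α : ℝ} {k : ℤ} {P : CP2} :
    P ∈ Jp α k ↔ ‖herm P.rep (pU α)‖ = ‖herm P.rep (vV α k)‖ ∧ P ∈ clH2 := Iff.rfl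

theorem mem_Jm {α : ℝ} {k : ℤ} {P : CP2} :
    P ∈ Jm α k ↔ ‖herm P.rep (pU α)‖ = ‖herm P.rep (vW α k)‖ ∧ P ∈ clH2 := Iff.rfl

theorem mem_Fp {α : ℝ} {k : ℤ} {P : CP2} :
    P ∈ Fp α k ↔ P ∈ Jp α k ∧ ‖herm P.rep (pU α)‖ ≤ ‖herm P.rep (vW α k)‖ ∧
      ‖herm P.rep (pU α)‖ ≤ ‖herm P.rep (vW α (k - 1))‖ := by
  rw [← le_min_iff]
  rfl

theorem mem_Fm {α : ℝ} {k : ℤ} {P : CP2} :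
    P ∈ Fm α k ↔ P ∈ Jm α k ∧ ‖herm P.rep (pU α)‖ ≤ ‖herm P.rep (vV α k)‖ ∧
      ‖herm P.rep (pU α)‖ ≤ ‖herm P.rep (vV α (k + 1))‖ := by
  rw [← le_min_iff]
  rfl

theorem isIsom_U_zpow (α : ℝ) (j : ℤ) : IsIsom (U α ^ j) := by
  induction j using Int.induction_on with
  | zero => exact fun z w => by rw [zpow_zero, one_smul, one_smul]
  | succ i h => rw [zpow_add_one]; exact h.mul (isIsom_U α)
  | pred i h => rw [zpow_sub_one]; exact h.mul (isIsom_U α).inv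

/-! ### Translation by powers of `U` -/

section

variable (α : ℝ) (j k : ℤ)

theorem U_image_bdH2 {A B : Set CP2} (h : smulHomeo (U α ^ j) '' A = B) :
    smulHomeo (U α ^ j) '' (A ∩ bdH2) = B ∩ bdH2 := by
  subst h
  rw [Set.image_inter (smulHomeo _).injective]
  congr 1
  exact smulHomeo_image_eq (isIsom_U_zpow α j).mem_bdH2

theorem U_image_Jp : smulHomeo (U α ^ j) '' Jp α k = Jp α (k + j) := by
  refine smulHomeo_image_eq fun P => ?_
  rw [Jp, (isIsom_U_zpow α j).mem_bisector, ← zpow_neg, U_zpow_pU, U_zpow_vV,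
    add_neg_cancel_right, Jp]

theorem U_image_Jm : smulHomeo (U α ^ j) '' Jm α k = Jm α (k + j) := by
  refine smulHomeo_image_eq fun P => ?_
  rw [Jm, (isIsom_U_zpow α j).mem_bisector, ← zpow_neg, U_zpow_pU, U_zpow_vW,
    add_neg_cancel_right, Jm]

theorem U_image_Fp : smulHomeo (U α ^ j) '' Fp α k = Fp α (k + j) := by
  refine smulHomeo_image_eq fun P => ?_
  have h := isIsom_U_zpow α j
  rw [mem_Fp, mem_Fp, mem_Jp, mem_Jp, h.norm_le_iff, h.norm_le_iff, h.norm_eq_iff, h.mem_clH2,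
    ← zpow_neg, U_zpow_pU, U_zpow_vV, U_zpow_vW, U_zpow_vW, add_neg_cancel_right,
    show k + j - 1 + -j = k - 1 by ring]

theorem U_image_Fm : smulHomeo (U α ^ j) '' Fm α k = Fm α (k + j) := by
  refine smulHomeo_image_eq fun P => ?_
  have h := isIsom_U_zpow α j
  rw [mem_Fm, mem_Fm, mem_Jm, mem_Jm, h.norm_le_iff, h.norm_le_iff, h.norm_eq_iff, h.mem_clH2,
    ← zpow_neg, U_zpow_pU, U_zpow_vW, U_zpow_vV, U_zpow_vV, add_neg_cancel_right,
    show k + j + 1 + -j = k + 1 by ring]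

theorem U_image_circ' : smulHomeo (U α ^ j) '' circ' α k = circ' α (k + j) := by
  rw [circ', U_image_bdH2 α j rfl, Set.image_inter (smulHomeo _).injective, U_image_Jm,
    U_image_Jp, circ', show k + 1 + j = k + j + 1 by ring]

end

/-! ### The symmetry `S⁻¹` from the first 3-face to the second -/

section

variable (α : ℝ)

theorem Sinv_image_bdH2 {A B : Set CP2} (h : smulHomeo (S α)⁻¹ '' A = B) :
    smulHomeo (S α)⁻¹ '' (A ∩ bdH2) = B ∩ bdH2 := by
  subst h
  rw [Set.image_inter (smulHomeo _).injective]
  congr 1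
  exact smulHomeo_image_eq (isIsom_S α).inv.mem_bdH2

theorem S_pW (α : ℝ) : S α • pW α = pU α := by
  rw [← S_pV, ← S_pU, S_S_S]

theorem S_vV_one (α : ℝ) : S α • vV α 1 = vW α (-1) := by
  rw [← Sinv_vW, smul_inv_smul]

theorem Sinv_image_Jp : smulHomeo (S α)⁻¹ '' Jp α 0 = Jm α 0 := by
  refine smulHomeo_image_eq fun P => ?_
  rw [mem_Jm, mem_Jp, (isIsom_S α).inv.norm_eq_iff, (isIsom_S α).inv.mem_clH2, inv_inv, vW_zero,
    S_pU, S_pW, vV_zero, eq_comm]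

/-- Pulled back by `S`, the vectors `p_U`, `p_W`, `p_V`, `U p_V` defining the minus face become
`p_V`, `p_U`, `p_W`, `U⁻¹ p_W`. The bound by the modulus against `p_V` is the same as that against
`p_U`, because the two agree on the bisector. -/
theorem Sinv_image_Fp : smulHomeo (S α)⁻¹ '' Fp α 0 = Fm α 0 := by
  refine smulHomeo_image_eq fun P => ?_
  have h := (isIsom_S α).inv
  rw [mem_Fm, mem_Jm, mem_Fp, mem_Jp, h.norm_eq_iff, h.norm_le_iff, h.norm_le_iff, h.mem_clH2,
    inv_inv, vW_zero, vV_zero, zero_add, zero_sub, S_vV_one, S_pU, S_pW, S_pV]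
  constructor
  · rintro ⟨⟨h1, h2⟩, h3, h4⟩
    exact ⟨⟨h1.symm, h2⟩, h1 ▸ h3, h1 ▸ h4⟩
  · rintro ⟨⟨h1, h2⟩, h3, h4⟩
    exact ⟨⟨h1.symm, h2⟩, h1 ▸ h3, h1 ▸ h4⟩

theorem Sinv_image_circ : smulHomeo (S α)⁻¹ '' circ α 0 = circ α 0 := by
  refine Sinv_image_bdH2 α (smulHomeo_image_eq fun P => ?_)
  have h := (isIsom_S α).inv
  simp only [Set.mem_inter_iff, mem_Jm, mem_Jp, h.norm_eq_iff, h.mem_clH2, inv_inv, vW_zero,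
    vV_zero, S_pU, S_pW, S_pV]
  constructor
  · rintro ⟨⟨h1, h2⟩, h3, h4⟩
    exact ⟨⟨h3.symm, h2⟩, h3.symm.trans h1, h2⟩
  · rintro ⟨⟨h1, h2⟩, h3, h4⟩
    exact ⟨⟨h1.symm.trans h3, h2⟩, h1.symm, h2⟩

theorem Sinv_image_circ' : smulHomeo (S α)⁻¹ '' circ' α (-1) = circ' α 0 := by
  refine Sinv_image_bdH2 α (smulHomeo_image_eq fun P => ?_)
  have h := (isIsom_S α).inv
  simp only [Set.mem_inter_iff, mem_Jm, mem_Jp, h.norm_eq_iff, h.mem_clH2, inv_inv, vW_zero,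
    vV_zero, S_pU, S_pW, neg_add_cancel, zero_add, S_vV_one]
  constructor
  · rintro ⟨⟨h1, h2⟩, h3, h4⟩
    exact ⟨⟨h1.symm.trans h3, h2⟩, h1.symm, h2⟩
  · rintro ⟨⟨h1, h2⟩, h3, h4⟩
    exact ⟨⟨h3.symm, h2⟩, h3.symm.trans h1, h2⟩

end

/-! ### Pieces, arcs and boundaries under a homeomorphism -/

section

variable (h : CP2 ≃ₜ CP2)

theorem image_diff_pair (X : Set CP2) (a b : CP2) : h '' (X \ {a, b}) = h '' X \ {h a, h b} := by
  rw [Set.image_sdiff h.injective, Set.image_pair]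

/-- The base point is required in the set because `connectedComponentIn` is empty by convention
otherwise. Each use therefore needs the vertices to be distinct. -/
theorem image_pieceAvoiding {X : Set CP2} {a b c : CP2} (hc : c ∈ X \ {a, b}) :
    h '' pieceAvoiding X a b c = pieceAvoiding (h '' X) (h a) (h b) (h c) := by
  rw [pieceAvoiding, Set.image_sdiff h.injective, h.image_connectedComponentIn hc,
    image_diff_pair, pieceAvoiding]

theorem image_pieceThrough {X : Set CP2} {a b c : CP2} (hc : c ∈ X \ {a, b}) :
    h '' pieceThrough X a b c = pieceThrough (h '' X) (h a) (h b) (h c) := by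
  rw [pieceThrough, Set.image_union, h.image_connectedComponentIn hc,
    image_diff_pair, pieceThrough, Set.image_pair]

theorem image_boundaryIn (Y X : Set CP2) :
    h '' boundaryIn Y X = boundaryIn (h '' Y) (h '' X) := by
  rw [boundaryIn, boundaryIn, Set.image_inter h.injective, h.image_closure, h.image_closure,
    Set.image_sdiff h.injective]

theorem IsArc.image {X : Set CP2} {a b : CP2} (hX : IsArc X a b) : IsArc (h '' X) (h a) (h b) := by
  obtain ⟨γ, h1, h2, h3, h4, h5⟩ := hX
  refine ⟨h ∘ γ, h.continuous.comp_continuousOn h1, h.injective.comp_injOn h2, ?_, ?_, ?_⟩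
  · rw [Set.image_comp, h3]
  · rw [Function.comp, h4]
  · rw [Function.comp, h5]

theorem pieceAvoiding_comm (X : Set CP2) (a b c : CP2) :
    pieceAvoiding X a b c = pieceAvoiding X b a c := by
  rw [pieceAvoiding, pieceAvoiding, Set.pair_comm]

theorem pieceThrough_comm (X : Set CP2) (a b c : CP2) :
    pieceThrough X a b c = pieceThrough X b a c := by
  rw [pieceThrough, pieceThrough, Set.pair_comm]

end

/-! ### An affine chart containing the closed ball -/

theorem r2_ne_zero : r2 ≠ 0 := by
  intro h
  have := r2_mul_r2
  rw [h] at this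
  norm_num at this

/-- The vector with affine coordinates `p`. -/
def chartVec (p : ℂ × ℂ) : V3 := ![(p.2 - 1) / 2, p.1 / r2, (p.2 + 1) / 2]

theorem chartVec_ne_zero (p : ℂ × ℂ) : chartVec p ≠ 0 := by
  intro h
  have h0 : (p.2 - 1) / 2 = 0 := congrFun h 0
  have h2 : (p.2 + 1) / 2 = 0 := congrFun h 2
  have : (1 : ℂ) = 0 := by linear_combination h2 - h0
  exact one_ne_zero this

/-- The affine chart in which the hyperbolic plane is the unit ball. -/
def chart (p : ℂ × ℂ) : CP2 := Projectivization.mk ℂ (chartVec p) (chartVec_ne_zero p)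

theorem continuous_chart : Continuous chart := by
  have h : chart = Projectivization.mk' ℂ (V := V3) ∘ fun p => ⟨chartVec p, chartVec_ne_zero p⟩ :=
    rfl
  rw [h]
  refine continuous_mk.comp (Continuous.subtype_mk ?_ _)
  refine continuous_pi fun i => ?_
  fin_cases i
  · change Continuous fun p : ℂ × ℂ => (p.2 - 1) / 2
    fun_prop
  · change Continuous fun p : ℂ × ℂ => p.1 / r2
    fun_prop
  · change Continuous fun p : ℂ × ℂ => (p.2 + 1) / 2
    fun_prop

/-- The affine coordinates of a vector. -/
def affineCoord (z : V3) : ℂ × ℂ := (r2 * z 1 / (z 2 - z 0), (z 0 + z 2) / (z 2 - z 0))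

theorem mk_eq_chart (z : V3) (hz : z ≠ 0) (h : z 2 - z 0 ≠ 0) :
    Projectivization.mk ℂ z hz = chart (affineCoord z) := by
  rw [chart, Projectivization.mk_eq_mk_iff']
  refine ⟨z 2 - z 0, ?_⟩
  have hr := r2_ne_zero
  ext i
  fin_cases i
  all_goals
    simp [chartVec, affineCoord]
    field_simp
    try ring

theorem mk_eq_chart_iff (z : V3) (hz : z ≠ 0) (p : ℂ × ℂ) :
    Projectivization.mk ℂ z hz = chart p ↔ z 2 - z 0 ≠ 0 ∧ affineCoord z = p := by
  constructor
  · intro h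
    rw [chart, Projectivization.mk_eq_mk_iff'] at h
    obtain ⟨a, rfl⟩ := h
    have ha : a ≠ 0 := by
      rintro rfl
      simp at hz
    have h2 : a * ((p.2 + 1) / 2) - a * ((p.2 - 1) / 2) = a := by ring
    refine ⟨?_, ?_⟩
    · simpa [chartVec, h2] using ha
    · have hr := r2_ne_zero
      ext1
      · simp [chartVec, affineCoord, h2]
        field_simp
      · simp [chartVec, affineCoord, h2]
        field_simp
        ring
  · rintro ⟨h, rfl⟩
    exact mk_eq_chart z hz h

theorem chart_injective : Function.Injective chart := by
  intro p q h
  have h1 := ((mk_eq_chart_iff _ (chartVec_ne_zero p) q).mp h).2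
  have h2 := ((mk_eq_chart_iff _ (chartVec_ne_zero p) p).mp rfl).2
  rw [← h1, h2]

/-- Upstairs, the cone over the image of an open set is given by `z 2 ≠ z 0` and an open condition
on the continuous affine coordinates. By the quotient topology the chart is then an open map. -/
theorem isOpenEmbedding_chart : Topology.IsOpenEmbedding chart := by
  refine Topology.IsOpenEmbedding.of_continuous_injective_isOpenMap continuous_chart
    chart_injective fun O hO => ?_
  rw [← isQuotientMap_mk.isOpen_preimage]
  have h : Projectivization.mk' ℂ (V := V3) ⁻¹' (chart '' O) =
      {z : {v : V3 // v ≠ 0} | z.1 2 - z.1 0 ≠ 0} ∩ (fun z => affineCoord z.1) ⁻¹' O := by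
    ext ⟨z, hz⟩
    rw [Set.mem_preimage, Projectivization.mk'_eq_mk]
    constructor
    · rintro ⟨p, hp, h⟩
      obtain ⟨h1, h2⟩ := (mk_eq_chart_iff z hz p).mp h.symm
      exact ⟨h1, by rw [Set.mem_preimage, h2]; exact hp⟩
    · rintro ⟨h1, h2⟩
      exact ⟨_, h2, (mk_eq_chart z hz h1).symm⟩
  rw [h]
  have hc : ∀ i : Fin 3, Continuous fun z : {v : V3 // v ≠ 0} => z.1 i := fun i =>
    (continuous_apply i).comp continuous_subtype_val
  refine ContinuousOn.isOpen_inter_preimage ?_ ?_ hO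
  · refine ContinuousOn.prodMk ?_ ?_
    · exact ContinuousOn.div (continuous_const.mul (hc 1)).continuousOn
        ((hc 2).sub (hc 0)).continuousOn fun z hz => hz
    · exact ContinuousOn.div ((hc 0).add (hc 2)).continuousOn
        ((hc 2).sub (hc 0)).continuousOn fun z hz => hz
  · exact isOpen_ne_fun ((hc 2).sub (hc 0)) continuous_const

theorem herm_chartVec (p : ℂ × ℂ) :
    (herm (chartVec p) (chartVec p)).re = (Complex.normSq p.1 + Complex.normSq p.2 - 1) / 2 := by
  have h : herm (chartVec p) (chartVec p) =
      (Complex.normSq p.1 + Complex.normSq p.2 - 1) / 2 := by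
    have hr := r2_mul_r2
    have hs := star_r2
    have h0 := r2_ne_zero
    rw [← starRingEnd_apply] at hs
    simp only [herm, chartVec, Matrix.cons_val_zero, Matrix.cons_val_one, Matrix.cons_val,
      ← starRingEnd_apply, map_div₀, map_sub, map_add, map_one, map_ofNat, hs,
      Complex.normSq_eq_conj_mul_self]
    field_simp
    linear_combination (-2 * (starRingEnd ℂ) p.1 * p.1) * hr
  rw [h]
  norm_cast

/-- On the line `z 2 = z 0` that the chart omits, the form equals `2|z 0|² + |z 1|²`, which is
positive off zero. -/
theorem clH2_subset_range_chart : clH2 ⊆ Set.range chart := by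
  intro P
  induction P using Projectivization.ind with
  | h z hz =>
    intro h
    rw [mk_mem_clH2] at h
    refine ⟨affineCoord z, (mk_eq_chart z hz fun h0 => hz ?_).symm⟩
    have h2 : z 2 = z 0 := sub_eq_zero.mp h0
    have h3 : (herm z z).re = 2 * Complex.normSq (z 0) + Complex.normSq (z 1) := by
      simp only [herm, h2, Complex.add_re, Complex.mul_re, Complex.star_def, Complex.conj_re,
        Complex.conj_im, Complex.normSq_apply]
      ring
    rw [h3] at h
    have hn0 := Complex.normSq_nonneg (z 0)
    have hn1 := Complex.normSq_nonneg (z 1)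
    have e0 : z 0 = 0 := Complex.normSq_eq_zero.mp (by linarith)
    have e1 : z 1 = 0 := Complex.normSq_eq_zero.mp (by linarith)
    ext i
    fin_cases i
    exacts [e0, e1, h2.trans e0]

theorem chart_mem_clH2 (p : ℂ × ℂ) :
    chart p ∈ clH2 ↔ Complex.normSq p.1 + Complex.normSq p.2 ≤ 1 := by
  rw [chart, mk_mem_clH2, herm_chartVec]
  constructor <;> intro h <;> linarith

theorem chart_mem_bdH2 (p : ℂ × ℂ) :
    chart p ∈ bdH2 ↔ Complex.normSq p.1 + Complex.normSq p.2 = 1 := by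
  rw [chart, mk_mem_bdH2, herm_chartVec]
  constructor <;> intro h <;> linarith

/-! ### Moduli of Hermitian products in the chart -/

theorem ex_eq (α : ℝ) : ex α = (Real.cos α : ℂ) + (Real.sin α : ℂ) * Complex.I := by
  rw [ex, Complex.exp_mul_I, Complex.ofReal_cos, Complex.ofReal_sin]

theorem ex_neg_eq (α : ℝ) : ex (-α) = (Real.cos α : ℂ) - (Real.sin α : ℂ) * Complex.I := by
  rw [ex_eq, Real.cos_neg, Real.sin_neg]
  push_cast
  ring

theorem norm_ex (α : ℝ) : ‖ex α‖ = 1 := Complex.norm_exp_ofReal_mul_I α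

theorem cos_eq_ex (α : ℝ) : ((Real.cos α : ℝ) : ℂ) = (ex α + ex (-α)) / 2 := by
  rw [ex_eq, ex_neg_eq]
  ring

theorem sin_eq_ex (α : ℝ) : ((Real.sin α : ℝ) : ℂ) * Complex.I = (ex α - ex (-α)) / 2 := by
  rw [ex_eq, ex_neg_eq]
  ring

section

variable (α : ℝ) (p : ℂ × ℂ)

/-- Conjugation undoes the antilinearity in the point, and a power of `e^{-iα}` has modulus one.
This gives holomorphic expressions in the affine coordinates. -/
theorem norm_herm_eq_of_star {x y : ℂ} (n : ℕ) (h : star x = ex (-α) ^ n * y) : ‖x‖ = ‖y‖ := by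
  rw [← norm_star, h, norm_mul, norm_pow, norm_ex, one_pow, one_mul]

theorem norm_herm_pU : ‖herm (chartVec p) (pU α)‖ =
    ‖(Real.sin α : ℂ) * Complex.I - p.1 / 2 + Real.cos α * p.2‖ := by
  refine norm_herm_eq_of_star α 1 ?_
  have h := ex_mul_ex_neg α
  have hr := r2_mul_r2
  have h0 := r2_ne_zero
  rw [cos_eq_ex, sin_eq_ex]
  simp only [herm, chartVec, pU, Matrix.cons_val_zero, Matrix.cons_val_one, Matrix.cons_val,
    star_add, star_mul', star_star, star_neg, star_div₀, star_pow, star_ex, star_r2, star_one,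
    star_ofNat]
  field_simp
  linear_combination (-1 - p.2) * h

theorem norm_herm_pV : ‖herm (chartVec p) (pV α)‖ =
    ‖(Real.sin α : ℂ) * Complex.I - p.1 / 2 - Real.cos α * p.2‖ := by
  refine norm_herm_eq_of_star α 1 ?_
  have h := ex_mul_ex_neg α
  have hr := r2_mul_r2
  have h0 := r2_ne_zero
  rw [cos_eq_ex, sin_eq_ex, ← S_pU, smul_S]
  simp only [herm, chartVec, pU, Matrix.cons_val_zero, Matrix.cons_val_one, Matrix.cons_val,
    star_add, star_mul', star_star, star_neg, star_div₀, star_pow, star_ex, star_r2,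
    star_one, star_ofNat, star_sub]
  field_simp
  linear_combination (2 * p.2 - 2) * h - (1 + p.2) * r2_ex_sq α

/-- The second affine coordinate drops out, here and for `U⁻¹ p_W`. This is what makes the
inequalities of the face into conditions on `N` alone at infinity. -/
theorem norm_herm_pW : ‖herm (chartVec p) (pW α)‖ =
    ‖1 - (3 * Real.cos α - Real.sin α * Complex.I) / 2 * p.1‖ := by
  refine (norm_herm_eq_of_star α 2 (y := -(1 - (3 * Real.cos α - Real.sin α * Complex.I) / 2 * p.1))
    ?_).trans (norm_neg _)
  have h := ex_mul_ex_neg α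
  have hr := r2_mul_r2
  have h0 := r2_ne_zero
  rw [cos_eq_ex, sin_eq_ex, ← S_pV, ← S_pU, smul_S, smul_S]
  simp only [herm, chartVec, pU, Matrix.cons_val_zero, Matrix.cons_val_one, Matrix.cons_val,
    star_add, star_mul', star_star, star_neg, star_div₀, star_pow, star_ex, star_r2,
    star_one, star_ofNat, star_sub]
  field_simp
  linear_combination (-2 * ex (-α) * p.1) * h + (2 * ex (-α) * p.1 - p.2 - 3) * r2_ex_sq α

theorem norm_herm_vW : ‖herm (chartVec p) (vW α (-1))‖ =
    ‖1 + (3 * Real.cos α + Real.sin α * Complex.I) / 2 * p.1‖ := by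
  refine norm_herm_eq_of_star α 0 ?_
  have h := ex_mul_ex_neg α
  have hr := r2_mul_r2
  have h0 := r2_ne_zero
  rw [cos_eq_ex, sin_eq_ex, vW_neg_one, ← S_pU, smul_T, smul_S]
  simp only [herm, chartVec, pU, Matrix.cons_val_zero, Matrix.cons_val_one, Matrix.cons_val,
    star_add, star_mul', star_star, star_neg, star_div₀, star_pow, star_ex, star_r2,
    star_one, star_ofNat, star_sub]
  field_simp
  linear_combination (p.2 - 1) * r2_ex_sq α + ((1 - p.2) * ex (-α) ^ 2) * hr

end

/-- The real equation, in affine coordinates, of the bisector of `p_U` and `p_V`. -/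
def bisEq (α : ℝ) (p : ℂ × ℂ) : ℝ :=
  -(p.1.re / 2) * p.2.re + (Real.sin α - p.1.im / 2) * p.2.im

section

variable (α : ℝ) (p : ℂ × ℂ)

theorem norm_sq_pU_sub_pV :
    ‖herm (chartVec p) (pU α)‖ ^ 2 - ‖herm (chartVec p) (pV α)‖ ^ 2 =
      4 * Real.cos α * bisEq α p := by
  rw [norm_herm_pU, norm_herm_pV, ← Complex.normSq_eq_norm_sq, ← Complex.normSq_eq_norm_sq,
    Complex.normSq_apply, Complex.normSq_apply, bisEq]
  simp [-Complex.ofReal_cos, -Complex.ofReal_sin]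
  ring

/-- The right side separates a term in `N` alone, the defect from the unit sphere, and the equation
of the bisector. The last vanishes on `𝒥_0^+`, and the middle one at infinity. For `U⁻¹ p_W` only
the sign of `Re N` changes. -/
theorem norm_sq_pW_sub_pU :
    ‖herm (chartVec p) (pW α)‖ ^ 2 - ‖herm (chartVec p) (pU α)‖ ^ 2 =
      3 * Real.cos α * (Real.cos α * Complex.normSq p.1 - p.1.re) +
        Real.cos α ^ 2 * (1 - Complex.normSq p.1 - Complex.normSq p.2) -
        2 * Real.cos α * bisEq α p := by
  have h := Real.sin_sq_add_cos_sq α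
  rw [norm_herm_pU, norm_herm_pW, ← Complex.normSq_eq_norm_sq, ← Complex.normSq_eq_norm_sq,
    Complex.normSq_apply, Complex.normSq_apply, Complex.normSq_apply, Complex.normSq_apply, bisEq]
  simp [-Complex.ofReal_cos, -Complex.ofReal_sin]
  linear_combination (p.1.re ^ 2 / 4 + p.1.im ^ 2 / 4 - 1) * h

theorem norm_sq_vW_sub_pU :
    ‖herm (chartVec p) (vW α (-1))‖ ^ 2 - ‖herm (chartVec p) (pU α)‖ ^ 2 =
      3 * Real.cos α * (Real.cos α * Complex.normSq p.1 + p.1.re) +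
        Real.cos α ^ 2 * (1 - Complex.normSq p.1 - Complex.normSq p.2) -
        2 * Real.cos α * bisEq α p := by
  have h := Real.sin_sq_add_cos_sq α
  rw [norm_herm_pU, norm_herm_vW, ← Complex.normSq_eq_norm_sq, ← Complex.normSq_eq_norm_sq,
    Complex.normSq_apply, Complex.normSq_apply, Complex.normSq_apply, Complex.normSq_apply, bisEq]
  simp [-Complex.ofReal_cos, -Complex.ofReal_sin]
  linear_combination (p.1.re ^ 2 / 4 + p.1.im ^ 2 / 4 - 1) * h

theorem ptA_zero_eq : ptA α 0 = chart (0, -1) := by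
  rw [ptA, zpow_zero, one_smul, mk_eq_chart_iff]
  simp [affineCoord]

theorem ptB_zero_eq : ptB α 0 = chart (0, 1) := by
  rw [ptB, zpow_zero, one_smul, mk_eq_chart_iff]
  simp [affineCoord]

theorem ptA_one_eq_chart : ptA α 1 = chart (ex α, 0) := by
  rw [ptA_one_eq, mk_eq_chart_iff]
  simp [affineCoord]
  constructor
  · norm_num
  · linear_combination (ex α / 2) * r2_mul_r2

theorem ptB_neg_one_eq_chart : ptB α (-1) = chart (-ex (-α), 0) := by
  rw [ptB_neg_one_eq, mk_eq_chart_iff]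
  simp [affineCoord]
  linear_combination (-ex (-α) / 2) * r2_mul_r2

end

/-! ### The first 3-face and its neighbours in the chart -/

section

variable {α : ℝ}

theorem norm_eq_iff_sq {x y : ℝ} (hx : 0 ≤ x) (hy : 0 ≤ y) : x = y ↔ x ^ 2 - y ^ 2 = 0 := by
  rw [sub_eq_zero, sq_eq_sq₀ hx hy]

theorem norm_le_iff_sq {x y : ℝ} (hx : 0 ≤ x) (hy : 0 ≤ y) : x ≤ y ↔ 0 ≤ y ^ 2 - x ^ 2 := by
  rw [sub_nonneg, sq_le_sq₀ hx hy]

theorem chart_mem_Jp (hc : 0 < Real.cos α) (p : ℂ × ℂ) :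
    chart p ∈ Jp α 0 ↔ bisEq α p = 0 ∧ Complex.normSq p.1 + Complex.normSq p.2 ≤ 1 := by
  rw [mem_Jp, chart_mem_clH2]
  refine and_congr_left fun _ => ?_
  rw [chart, norm_herm_rep_eq_iff, vV_zero, norm_eq_iff_sq (norm_nonneg _) (norm_nonneg _),
    norm_sq_pU_sub_pV, mul_eq_zero_iff_left (by positivity)]

theorem chart_mem_Jm (p : ℂ × ℂ) :
    chart p ∈ Jm α 0 ↔ 3 * Real.cos α * (Real.cos α * Complex.normSq p.1 - p.1.re) +
        Real.cos α ^ 2 * (1 - Complex.normSq p.1 - Complex.normSq p.2) -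
        2 * Real.cos α * bisEq α p = 0 ∧ Complex.normSq p.1 + Complex.normSq p.2 ≤ 1 := by
  rw [mem_Jm, chart_mem_clH2]
  refine and_congr_left fun _ => ?_
  rw [chart, norm_herm_rep_eq_iff, vW_zero, eq_comm,
    norm_eq_iff_sq (norm_nonneg _) (norm_nonneg _), norm_sq_pW_sub_pU]

theorem chart_mem_Jm' (p : ℂ × ℂ) :
    chart p ∈ Jm α (-1) ↔ 3 * Real.cos α * (Real.cos α * Complex.normSq p.1 + p.1.re) +
        Real.cos α ^ 2 * (1 - Complex.normSq p.1 - Complex.normSq p.2) -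
        2 * Real.cos α * bisEq α p = 0 ∧ Complex.normSq p.1 + Complex.normSq p.2 ≤ 1 := by
  rw [mem_Jm, chart_mem_clH2]
  refine and_congr_left fun _ => ?_
  rw [chart, norm_herm_rep_eq_iff, eq_comm,
    norm_eq_iff_sq (norm_nonneg _) (norm_nonneg _), norm_sq_vW_sub_pU]

theorem chart_mem_Fp (p : ℂ × ℂ) :
    chart p ∈ Fp α 0 ↔ chart p ∈ Jp α 0 ∧
      0 ≤ 3 * Real.cos α * (Real.cos α * Complex.normSq p.1 - p.1.re) +
        Real.cos α ^ 2 * (1 - Complex.normSq p.1 - Complex.normSq p.2) -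
        2 * Real.cos α * bisEq α p ∧
      0 ≤ 3 * Real.cos α * (Real.cos α * Complex.normSq p.1 + p.1.re) +
        Real.cos α ^ 2 * (1 - Complex.normSq p.1 - Complex.normSq p.2) -
        2 * Real.cos α * bisEq α p := by
  rw [mem_Fp, zero_sub, chart, norm_herm_rep_le_iff, norm_herm_rep_le_iff, vW_zero,
    norm_le_iff_sq (norm_nonneg _) (norm_nonneg _), norm_sq_pW_sub_pU,
    norm_le_iff_sq (norm_nonneg _) (norm_nonneg _), norm_sq_vW_sub_pU]

theorem exists_chart_eq {P : CP2} (hP : P ∈ clH2) : ∃ p, P = chart p := by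
  obtain ⟨p, rfl⟩ := clH2_subset_range_chart hP
  exact ⟨p, rfl⟩

/-- On `𝒥_0^+` the two quantities defining the face add up to `6 cos² α |N|² + 2 cos² α (1 - |N|² -
|E|²) ≥ 0`, so when one is zero the other is nonnegative. -/
theorem Jp_inter_Jm_subset (hc : 0 < Real.cos α) : Jp α 0 ∩ Jm α 0 ⊆ Fp α 0 := by
  rintro P ⟨h1, h2⟩
  obtain ⟨p, rfl⟩ := exists_chart_eq h1.2
  rw [chart_mem_Fp]
  rw [chart_mem_Jm] at h2
  refine ⟨h1, h2.1.ge, ?_⟩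
  rw [chart_mem_Jp hc] at h1
  have h3 := Complex.normSq_nonneg p.1
  have h4 : 0 ≤ Real.cos α ^ 2 * (1 - Complex.normSq p.1 - Complex.normSq p.2) :=
    mul_nonneg (sq_nonneg _) (by linarith)
  have h5 : 0 ≤ Real.cos α ^ 2 * Complex.normSq p.1 := by positivity
  rw [h1.1] at h2 ⊢
  nlinarith [h2.1]

theorem Jp_inter_Jm'_subset (hc : 0 < Real.cos α) : Jp α 0 ∩ Jm α (-1) ⊆ Fp α 0 := by
  rintro P ⟨h1, h2⟩
  obtain ⟨p, rfl⟩ := exists_chart_eq h1.2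
  rw [chart_mem_Fp]
  rw [chart_mem_Jm'] at h2
  refine ⟨h1, ?_, h2.1.ge⟩
  rw [chart_mem_Jp hc] at h1
  have h3 := Complex.normSq_nonneg p.1
  have h4 : 0 ≤ Real.cos α ^ 2 * (1 - Complex.normSq p.1 - Complex.normSq p.2) :=
    mul_nonneg (sq_nonneg _) (by linarith)
  have h5 : 0 ≤ Real.cos α ^ 2 * Complex.normSq p.1 := by positivity
  rw [h1.1] at h2 ⊢
  nlinarith [h2.1]

/-- The points `[0 : ±1]` are the only solutions on the unit sphere with vanishing first
coordinate. -/
theorem eq_of_fst_eq_zero (hs : 0 < Real.sin α) {p : ℂ × ℂ} (h1 : p.1 = 0)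
    (h2 : Complex.normSq p.1 + Complex.normSq p.2 = 1) (h3 : bisEq α p = 0) :
    p = (0, -1) ∨ p = (0, 1) := by
  obtain ⟨N, E⟩ := p
  simp only at h1 h2
  subst h1
  simp [bisEq, hs.ne'] at h3
  simp [Complex.normSq_apply, h3] at h2
  have : (E.re - 1) * (E.re + 1) = 0 := by linarith
  rcases mul_eq_zero.mp this with h | h
  · right
    ext1
    · rfl
    · exact Complex.ext (by simpa using by linarith) (by simpa using h3)
  · left
    ext1
    · rfl
    · exact Complex.ext (by simpa using by linarith) (by simpa using h3)

theorem ptA_zero_mem (hc : 0 < Real.cos α) :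
    ptA α 0 ∈ Jp α 0 ∩ Jm α 0 ∩ Jm α (-1) ∩ bdH2 := by
  rw [ptA_zero_eq]
  refine ⟨⟨⟨(chart_mem_Jp hc _).mpr ?_, (chart_mem_Jm _).mpr ?_⟩, (chart_mem_Jm' _).mpr ?_⟩,
    (chart_mem_bdH2 _).mpr ?_⟩ <;> simp [bisEq]

theorem ptB_zero_mem (hc : 0 < Real.cos α) :
    ptB α 0 ∈ Jp α 0 ∩ Jm α 0 ∩ Jm α (-1) ∩ bdH2 := by
  rw [ptB_zero_eq]
  refine ⟨⟨⟨(chart_mem_Jp hc _).mpr ?_, (chart_mem_Jm _).mpr ?_⟩, (chart_mem_Jm' _).mpr ?_⟩,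
    (chart_mem_bdH2 _).mpr ?_⟩ <;> simp [bisEq]

/-- Adding the equations cancels `Re N` and leaves a sum of three nonnegative terms equal to zero,
so each vanishes: `N = 0`, the point is on the sphere, and `j = 0`. The parameter `j` allows moduli
to be compared with either `p_U` or `p_V`. -/
theorem eq_of_sum_eq_zero (hs : 0 < Real.sin α) (hc : 0 < Real.cos α) {p : ℂ × ℂ}
    (hp : Complex.normSq p.1 + Complex.normSq p.2 ≤ 1) {j : ℝ} (hj : j ≤ 0)
    (hj0 : j = 0 → bisEq α p = 0)
    (h1 : 3 * Real.cos α * (Real.cos α * Complex.normSq p.1 - p.1.re) +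
        Real.cos α ^ 2 * (1 - Complex.normSq p.1 - Complex.normSq p.2) - j = 0)
    (h2 : 3 * Real.cos α * (Real.cos α * Complex.normSq p.1 + p.1.re) +
        Real.cos α ^ 2 * (1 - Complex.normSq p.1 - Complex.normSq p.2) - j = 0) :
    chart p = ptA α 0 ∨ chart p = ptB α 0 := by
  have h4 : 0 ≤ Real.cos α ^ 2 * (1 - Complex.normSq p.1 - Complex.normSq p.2) :=
    mul_nonneg (sq_nonneg _) (by linarith)
  have h5 : 0 ≤ Real.cos α ^ 2 * Complex.normSq p.1 :=
    mul_nonneg (sq_nonneg _) (Complex.normSq_nonneg _)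
  have e1 : Real.cos α ^ 2 * Complex.normSq p.1 = 0 := by linarith
  have e2 : Real.cos α ^ 2 * (1 - Complex.normSq p.1 - Complex.normSq p.2) = 0 := by linarith
  have e3 : j = 0 := by linarith
  rw [mul_eq_zero_iff_left (by positivity)] at e1 e2
  rw [ptA_zero_eq, ptB_zero_eq]
  rcases eq_of_fst_eq_zero hs (Complex.normSq_eq_zero.mp e1) (by linarith) (hj0 e3) with rfl | rfl
  · exact Or.inl rfl
  · exact Or.inr rfl

theorem eq_of_norm_pU_eq (hs : 0 < Real.sin α) (hc : 0 < Real.cos α) {P : CP2} (hP : P ∈ clH2)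
    (h1 : ‖herm P.rep (pU α)‖ = ‖herm P.rep (pW α)‖)
    (h2 : ‖herm P.rep (pU α)‖ = ‖herm P.rep (vW α (-1))‖)
    (h3 : ‖herm P.rep (pU α)‖ ≤ ‖herm P.rep (pV α)‖) :
    P = ptA α 0 ∨ P = ptB α 0 := by
  obtain ⟨p, rfl⟩ := exists_chart_eq hP
  rw [chart_mem_clH2] at hP
  rw [chart, norm_herm_rep_eq_iff, eq_comm, norm_eq_iff_sq (norm_nonneg _) (norm_nonneg _),
    norm_sq_pW_sub_pU] at h1
  rw [chart, norm_herm_rep_eq_iff, eq_comm, norm_eq_iff_sq (norm_nonneg _) (norm_nonneg _),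
    norm_sq_vW_sub_pU] at h2
  rw [chart, norm_herm_rep_le_iff, norm_le_iff_sq (norm_nonneg _) (norm_nonneg _), ← neg_sub,
    norm_sq_pU_sub_pV] at h3
  exact eq_of_sum_eq_zero hs hc hP (by linarith)
    (fun h => by rwa [mul_eq_zero_iff_left (by positivity)] at h) h1 h2

theorem eq_of_norm_pV_eq (hs : 0 < Real.sin α) (hc : 0 < Real.cos α) {P : CP2} (hP : P ∈ clH2)
    (h1 : ‖herm P.rep (pV α)‖ = ‖herm P.rep (pW α)‖)
    (h2 : ‖herm P.rep (pV α)‖ = ‖herm P.rep (vW α (-1))‖)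
    (h3 : ‖herm P.rep (pV α)‖ ≤ ‖herm P.rep (pU α)‖) :
    P = ptA α 0 ∨ P = ptB α 0 := by
  obtain ⟨p, rfl⟩ := exists_chart_eq hP
  have e0 := norm_sq_pU_sub_pV α p
  have e1 := norm_sq_pW_sub_pU α p
  have e2 := norm_sq_vW_sub_pU α p
  rw [chart_mem_clH2] at hP
  rw [chart, norm_herm_rep_eq_iff, eq_comm, norm_eq_iff_sq (norm_nonneg _) (norm_nonneg _)] at h1
  rw [chart, norm_herm_rep_eq_iff, eq_comm, norm_eq_iff_sq (norm_nonneg _) (norm_nonneg _)] at h2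
  rw [chart, norm_herm_rep_le_iff, norm_le_iff_sq (norm_nonneg _) (norm_nonneg _)] at h3
  -- Measuring from `p_V` instead of `p_U` adds `4 cos α` times `bisEq`, which reverses the sign of
  -- the bisector term.
  refine eq_of_sum_eq_zero hs hc hP (j := -(2 * Real.cos α * bisEq α p)) (by linarith)
    (fun h => ?_) (by linarith) (by linarith)
  rwa [neg_eq_zero, mul_eq_zero_iff_left (by positivity)] at h

/-! ### Intersections of 3-faces -/

theorem Sinv_image_Jp_inter_Jm :
    smulHomeo (S α)⁻¹ '' (Jp α 0 ∩ Jm α 0) = Jp α 0 ∩ Jm α 0 := by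
  refine smulHomeo_image_eq fun P => ?_
  have h := (isIsom_S α).inv
  simp only [Set.mem_inter_iff, mem_Jm, mem_Jp, h.norm_eq_iff, h.mem_clH2, inv_inv, vW_zero,
    vV_zero, S_pU, S_pW, S_pV]
  constructor
  · rintro ⟨⟨h1, h2⟩, h3, h4⟩
    exact ⟨⟨h3.symm, h2⟩, h3.symm.trans h1, h2⟩
  · rintro ⟨⟨h1, h2⟩, h3, h4⟩
    exact ⟨⟨h1.symm.trans h3, h2⟩, h1.symm, h2⟩

theorem Sinv_image_Jp_inter_Jm' :
    smulHomeo (S α)⁻¹ '' (Jp α 0 ∩ Jm α (-1)) = Jm α 0 ∩ Jp α 1 := by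
  refine smulHomeo_image_eq fun P => ?_
  have h := (isIsom_S α).inv
  simp only [Set.mem_inter_iff, mem_Jm, mem_Jp, h.norm_eq_iff, h.mem_clH2, inv_inv, vW_zero,
    vV_zero, S_pU, S_pW, S_vV_one]
  constructor
  · rintro ⟨⟨h1, h2⟩, h3, h4⟩
    exact ⟨⟨h1.symm, h2⟩, h1.symm.trans h3, h2⟩
  · rintro ⟨⟨h1, h2⟩, h3, h4⟩
    exact ⟨⟨h1.symm, h2⟩, h1.symm.trans h3, h2⟩

theorem Jp_inter_Jm_subset_Fm (hc : 0 < Real.cos α) : Jp α 0 ∩ Jm α 0 ⊆ Fm α 0 := by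
  rw [← Sinv_image_Jp_inter_Jm, ← Sinv_image_Fp]
  exact Set.image_mono (Jp_inter_Jm_subset hc)

theorem Jm_inter_Jp_subset_Fm (hc : 0 < Real.cos α) : Jm α 0 ∩ Jp α 1 ⊆ Fm α 0 := by
  rw [← Sinv_image_Jp_inter_Jm', ← Sinv_image_Fp]
  exact Set.image_mono (Jp_inter_Jm'_subset hc)

theorem U_image_Jp_inter_Jm' :
    smulHomeo (U α ^ (1 : ℤ)) '' (Jp α 0 ∩ Jm α (-1)) = Jm α 0 ∩ Jp α 1 := by
  rw [Set.image_inter (smulHomeo _).injective, U_image_Jm, U_image_Jp, Set.inter_comm]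
  simp

theorem Jp_inter_Jm'_subset_Fm (hc : 0 < Real.cos α) : Jp α 0 ∩ Jm α (-1) ⊆ Fm α (-1) := by
  rw [← Set.image_subset_image_iff (smulHomeo (U α ^ (1 : ℤ))).injective, U_image_Jp_inter_Jm',
    U_image_Fm, neg_add_cancel]
  exact Jm_inter_Jp_subset_Fm hc

theorem Jm_inter_Jp_subset_Fp (hc : 0 < Real.cos α) : Jm α 0 ∩ Jp α 1 ⊆ Fp α 1 := by
  have h := Set.image_mono (f := smulHomeo (U α ^ (1 : ℤ))) (Jp_inter_Jm'_subset hc)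
  rwa [U_image_Jp_inter_Jm', U_image_Fp, zero_add] at h

theorem Fp_subset_Jp (k : ℤ) : Fp α k ⊆ Jp α k := fun _ h => h.1

theorem Fm_subset_Jm (k : ℤ) : Fm α k ⊆ Jm α k := fun _ h => h.1

theorem Fp_inter_Fm (hc : 0 < Real.cos α) : Fp α 0 ∩ Fm α 0 = Jp α 0 ∩ Jm α 0 :=
  Set.Subset.antisymm (Set.inter_subset_inter (Fp_subset_Jp 0) (Fm_subset_Jm 0))
    (Set.subset_inter (Jp_inter_Jm_subset hc) (Jp_inter_Jm_subset_Fm hc))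

theorem Fp_inter_Fm' (hc : 0 < Real.cos α) : Fp α 0 ∩ Fm α (-1) = Jp α 0 ∩ Jm α (-1) :=
  Set.Subset.antisymm (Set.inter_subset_inter (Fp_subset_Jp 0) (Fm_subset_Jm (-1)))
    (Set.subset_inter (Jp_inter_Jm'_subset hc) (Jp_inter_Jm'_subset_Fm hc))

theorem Fm_inter_Fp (hc : 0 < Real.cos α) : Fm α 0 ∩ Fp α 1 = Jm α 0 ∩ Jp α 1 :=
  Set.Subset.antisymm (Set.inter_subset_inter (Fm_subset_Jm 0) (Fp_subset_Jp 1))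
    (Set.subset_inter (Jm_inter_Jp_subset_Fm hc) (Jm_inter_Jp_subset_Fp hc))

theorem ptA_zero_mem_Fm (hc : 0 < Real.cos α) : ptA α 0 ∈ Fm α 0 ∩ Fm α (-1) :=
  have h := ptA_zero_mem (α := α) hc
  ⟨Jp_inter_Jm_subset_Fm hc h.1.1, Jp_inter_Jm'_subset_Fm hc ⟨h.1.1.1, h.1.2⟩⟩

theorem ptB_zero_mem_Fm (hc : 0 < Real.cos α) : ptB α 0 ∈ Fm α 0 ∩ Fm α (-1) :=
  have h := ptB_zero_mem (α := α) hc
  ⟨Jp_inter_Jm_subset_Fm hc h.1.1, Jp_inter_Jm'_subset_Fm hc ⟨h.1.1.1, h.1.2⟩⟩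

/-- Only the two bisector equations and one inequality, against `p_V`, are needed: they place the
point in the situation of `eq_of_norm_pU_eq`. -/
theorem Fm_inter_Fm (hs : 0 < Real.sin α) (hc : 0 < Real.cos α) :
    Fm α 0 ∩ Fm α (-1) = {ptB α 0, ptA α 0} := by
  refine Set.Subset.antisymm ?_ (Set.pair_subset (ptB_zero_mem_Fm hc) (ptA_zero_mem_Fm hc))
  rintro P ⟨h1, h2⟩
  simp only [mem_Fm, mem_Jm, vW_zero, vV_zero] at h1 h2
  exact (eq_of_norm_pU_eq hs hc h1.1.2 h1.1.1 h2.1.1 h1.2.1).symm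

theorem ptB_zero_mem_Fp (hc : 0 < Real.cos α) : ptB α 0 ∈ Fp α 0 ∩ Fp α 1 := by
  have h := ptA_zero_mem (α := α) hc
  refine ⟨Jp_inter_Jm_subset hc (ptB_zero_mem hc).1.1, Jm_inter_Jp_subset_Fp hc ?_⟩
  rw [← Sinv_image_Jp_inter_Jm', ← Sinv_ptA_zero]
  exact ⟨_, ⟨h.1.1.1, h.1.2⟩, rfl⟩

theorem ptA_one_mem_Fp (hc : 0 < Real.cos α) : ptA α 1 ∈ Fp α 0 ∩ Fp α 1 := by
  have h := ptB_zero_mem (α := α) hc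
  rw [← Sinv_ptB_zero]
  refine ⟨Jp_inter_Jm_subset hc ?_, Jm_inter_Jp_subset_Fp hc ?_⟩
  · rw [← Sinv_image_Jp_inter_Jm]
    exact Set.mem_image_of_mem _ h.1.1
  · rw [← Sinv_image_Jp_inter_Jm']
    exact ⟨_, ⟨h.1.1.1, h.1.2⟩, rfl⟩

theorem Fp_inter_Fp (hs : 0 < Real.sin α) (hc : 0 < Real.cos α) :
    Fp α 0 ∩ Fp α 1 = {ptB α 0, ptA α 1} := by
  refine Set.Subset.antisymm ?_ (Set.pair_subset (ptB_zero_mem_Fp hc) (ptA_one_mem_Fp hc))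
  rintro P ⟨h1, h2⟩
  simp only [mem_Fp, mem_Jp, vW_zero, vV_zero] at h1 h2
  have h := isIsom_S α
  -- `S` turns `p_U`, `p_V`, `U p_V` and the comparison vector `p_W` into `p_V`, `p_W`, `U⁻¹ p_W`
  -- and `p_U`, so the equidistance is now measured from `p_V`.
  have key : S α • P = ptA α 0 ∨ S α • P = ptB α 0 := by
    refine eq_of_norm_pV_eq hs hc ((h.mem_clH2 P).mpr h1.1.2) ?_ ?_ ?_
    · rw [h.norm_eq_iff, Sinv_pV, Sinv_pW, h1.1.1]
    · rw [h.norm_eq_iff, Sinv_pV, Sinv_vW, h2.1.1]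
    · rw [h.norm_le_iff, Sinv_pV, Sinv_pU]
      exact h1.2.1
  rcases key with key | key
  · left
    rw [← Sinv_ptA_zero, ← key, inv_smul_smul]
  · right
    rw [Set.mem_singleton_iff, ← Sinv_ptB_zero, ← key, inv_smul_smul]

end

/-! ### Components of a union of two closed sets meeting in two points -/

/-- Once the two common points are removed, the traces of the closed sets are disjoint and
relatively open, so a connected set cannot pass from one to the other. Only the piece containing `d`
has to be connected. -/
theorem connectedComponentIn_union_diff {X : Type*} [TopologicalSpace X] {A A' : Set X}
    (hA : IsClosed A) (hA' : IsClosed A') {x y d : X} (hi : A ∩ A' = {x, y})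
    (hd : d ∈ A' \ {x, y}) (hp : IsPreconnected (A' \ {x, y})) :
    connectedComponentIn ((A ∪ A') \ {x, y}) d = A' \ {x, y} := by
  have hsub : A' \ {x, y} ⊆ (A ∪ A') \ {x, y} := fun z hz => ⟨Or.inr hz.1, hz.2⟩
  refine Set.Subset.antisymm ?_ (hp.subset_connectedComponentIn hd hsub)
  intro z hz
  have hz' := connectedComponentIn_subset _ _ hz
  refine ⟨?_, hz'.2⟩
  by_contra hzA'
  have hdA : d ∉ A := fun h => hd.2 (hi ▸ ⟨h, hd.1⟩)
  obtain ⟨t, ht, ht1, ht2⟩ := (isPreconnected_connectedComponentIn (x := d)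
    (F := (A ∪ A') \ {x, y})) Aᶜ A'ᶜ hA.isOpen_compl hA'.isOpen_compl
    (fun t ht => by
      have ht' := connectedComponentIn_subset _ _ ht
      by_cases h : t ∈ A
      · right
        exact fun h' => ht'.2 (hi ▸ ⟨h, h'⟩)
      · left
        exact h)
    ⟨d, mem_connectedComponentIn (hsub hd), hdA⟩ ⟨z, hz, hzA'⟩
  exact (connectedComponentIn_subset _ _ ht).1.elim ht1 ht2

theorem image_connectedComponentIn_of_isEmbedding {X Y : Type*} [TopologicalSpace X]
    [TopologicalSpace Y] {f : X → Y} (hf : Topology.IsEmbedding f) {s : Set X} {x : X}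
    (hx : x ∈ s) : f '' connectedComponentIn s x = connectedComponentIn (f '' s) (f x) := by
  refine Set.Subset.antisymm (hf.continuous.continuousOn.image_connectedComponentIn_subset hx) ?_
  have h1 := connectedComponentIn_subset (f '' s) (f x)
  have h2 : f '' (f ⁻¹' connectedComponentIn (f '' s) (f x)) =
      connectedComponentIn (f '' s) (f x) :=
    Set.image_preimage_eq_of_subset (h1.trans (Set.image_subset_range f s))
  rw [← h2]
  refine Set.image_mono (IsPreconnected.subset_connectedComponentIn ?_ ?_ ?_)
  · rw [← hf.isInducing.isPreconnected_image, h2]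
    exact isPreconnected_connectedComponentIn
  · exact mem_connectedComponentIn (Set.mem_image_of_mem f hx)
  · intro z hz
    obtain ⟨w, hw, hwz⟩ := h1 hz
    rwa [← hf.injective hwz]

theorem connectedComponentIn_chart_image {A A' : Set (ℂ × ℂ)} (hA : IsClosed A) (hA' : IsClosed A')
    {x y d : ℂ × ℂ} (hi : A ∩ A' = {x, y}) (hd : d ∈ A' \ {x, y})
    (hp : IsPreconnected (A' \ {x, y})) :
    connectedComponentIn (chart '' (A ∪ A') \ {chart x, chart y}) (chart d) =
      chart '' (A' \ {x, y}) := by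
  rw [← connectedComponentIn_union_diff hA hA' hi hd hp,
    image_connectedComponentIn_of_isEmbedding isOpenEmbedding_chart.isEmbedding
      (s := (A ∪ A') \ {x, y}) ⟨Or.inr hd.1, hd.2⟩,
    Set.image_sdiff chart_injective, Set.image_pair]

theorem pieceAvoiding_chart {A A' : Set (ℂ × ℂ)} (hA : IsClosed A) (hA' : IsClosed A')
    {x y d : ℂ × ℂ} (hi : A ∩ A' = {x, y}) (hd : d ∈ A' \ {x, y})
    (hp : IsPreconnected (A' \ {x, y})) :
    pieceAvoiding (chart '' (A ∪ A')) (chart x) (chart y) (chart d) = chart '' A := by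
  rw [pieceAvoiding, connectedComponentIn_chart_image hA hA' hi hd hp,
    ← Set.image_sdiff chart_injective]
  congr 1
  ext z
  have hz : z ∈ ({x, y} : Set (ℂ × ℂ)) ↔ z ∈ A ∧ z ∈ A' := by rw [← hi]; rfl
  simp only [Set.mem_sdiff, Set.mem_union, hz]
  tauto

theorem pieceThrough_chart {A A' : Set (ℂ × ℂ)} (hA : IsClosed A) (hA' : IsClosed A')
    {x y d : ℂ × ℂ} (hi : A ∩ A' = {x, y}) (hd : d ∈ A' \ {x, y})
    (hp : IsPreconnected (A' \ {x, y})) :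
    pieceThrough (chart '' (A ∪ A')) (chart x) (chart y) (chart d) = chart '' A' := by
  rw [pieceThrough, connectedComponentIn_chart_image hA hA' hi hd hp, ← Set.image_pair,
    ← Set.image_union, Set.sdiff_union_of_subset]
  rw [← hi]
  exact Set.inter_subset_right

theorem isClosed_clH2 : IsClosed clH2 := by
  rw [← isQuotientMap_mk.isClosed_preimage]
  have h : Projectivization.mk' ℂ (V := V3) ⁻¹' clH2 =
      {z : {v : V3 // v ≠ 0} | (herm z.1 z.1).re ≤ 0} := by
    ext ⟨z, hz⟩
    rw [Set.mem_preimage, Projectivization.mk'_eq_mk, mk_mem_clH2]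
    rfl
  rw [h]
  have hc : ∀ i : Fin 3, Continuous fun z : {v : V3 // v ≠ 0} => z.1 i := fun i =>
    (continuous_apply i).comp continuous_subtype_val
  have h0 := hc 0
  have h1 := hc 1
  have h2 := hc 2
  refine isClosed_le (Complex.continuous_re.comp ?_) continuous_const
  simp only [herm]
  exact (((h0.star).mul h2).add (h1.star.mul h1)).add (h2.star.mul h0)

/-- The closed ball is closed in the projective plane and covered by the chart, so limits do not
escape from the chart and closures can be computed in affine coordinates. -/
theorem closure_chart_image {A : Set (ℂ × ℂ)} (hA : chart '' A ⊆ clH2) :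
    closure (chart '' A) = chart '' closure A := by
  rw [isOpenEmbedding_chart.isInducing.closure_eq_preimage_closure_image,
    Set.image_preimage_eq_of_subset]
  exact (closure_minimal hA isClosed_clH2).trans clH2_subset_range_chart

/-! ### The spinal sphere in the chart -/

/-- The equidistant points on the unit sphere, in affine coordinates. -/
def spinal (α : ℝ) : Set (ℂ × ℂ) :=
  {p | Complex.normSq p.1 + Complex.normSq p.2 = 1 ∧ bisEq α p = 0}

/-- The boundary at infinity of the 3-face, in affine coordinates. -/
def face (α : ℝ) : Set (ℂ × ℂ) :=
  {p | p ∈ spinal α ∧ |p.1.re| ≤ Real.cos α * Complex.normSq p.1}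

/-- The two Giraud circles, in affine coordinates. -/
def giraud (α ε : ℝ) : Set (ℂ × ℂ) :=
  {p | p ∈ spinal α ∧ Real.cos α * Complex.normSq p.1 = ε * p.1.re}

/-- The vector which is orthogonal to the second coordinate on the bisector. -/
def axis (α : ℝ) (N : ℂ) : ℂ := Real.sin α * Complex.I - N / 2

/-- The point of the bisector with first coordinate `N` and second coordinate of modulus `|e|`. -/
def spt (α : ℝ) (N : ℂ) (e : ℝ) : ℂ × ℂ :=
  (N, e * (Complex.I * axis α N / ‖axis α N‖))

theorem bisEq_eq (α : ℝ) (p : ℂ × ℂ) :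
    bisEq α p = (axis α p.1 * starRingEnd ℂ p.2).re := by
  simp [bisEq, axis, -Complex.ofReal_sin]

theorem bisEq_spt (α : ℝ) (N : ℂ) (e : ℝ) : bisEq α (spt α N e) = 0 := by
  rw [bisEq_eq, spt]
  simp only [map_mul, map_div₀, Complex.conj_ofReal, Complex.conj_I]
  have : axis α N * (e * (-Complex.I * starRingEnd ℂ (axis α N) / ‖axis α N‖)) =
      ((e * Complex.normSq (axis α N) / ‖axis α N‖ : ℝ) : ℂ) * (-Complex.I) := by
    push_cast
    rw [← Complex.mul_conj]
    ring
  rw [this, Complex.re_ofReal_mul]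
  simp

theorem normSq_spt {α : ℝ} {N : ℂ} (h : axis α N ≠ 0) (e : ℝ) :
    Complex.normSq (spt α N e).2 = e ^ 2 := by
  have h' : ‖axis α N‖ ≠ 0 := norm_ne_zero_iff.mpr h
  simp only [spt, map_mul, map_div₀, Complex.normSq_I, Complex.normSq_ofReal,
    Complex.normSq_eq_norm_sq (axis α N)]
  field_simp

theorem spt_mem_spinal {α : ℝ} {N : ℂ} (h : axis α N ≠ 0) {e : ℝ}
    (he : Complex.normSq N + e ^ 2 = 1) : spt α N e ∈ spinal α :=
  ⟨by rw [normSq_spt h]; exact he, bisEq_spt α N e⟩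

/-- The bisector equation says that `axis α N * conj E` is purely imaginary. When the axis is
nonzero, this puts `E` on the real line spanned by `i * axis α N`, and `e` is the coordinate on this
line. -/
theorem exists_eq_spt {α : ℝ} {p : ℂ × ℂ} (hp : p ∈ spinal α) (h : axis α p.1 ≠ 0) :
    ∃ e : ℝ, p = spt α p.1 e ∧ Complex.normSq p.1 + e ^ 2 = 1 := by
  have h' : (‖axis α p.1‖ : ℂ) ≠ 0 := by exact_mod_cast norm_ne_zero_iff.mpr h
  have key : ∃ e : ℝ, p = spt α p.1 e := by
    refine ⟨-(axis α p.1 * starRingEnd ℂ p.2).im / ‖axis α p.1‖, ?_⟩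
    have h1 := hp.2
    rw [bisEq_eq] at h1
    have h2 : axis α p.1 * starRingEnd ℂ p.2 =
        ((axis α p.1 * starRingEnd ℂ p.2).im : ℂ) * Complex.I := by
      conv_lhs => rw [← Complex.re_add_im (axis α p.1 * starRingEnd ℂ p.2), h1]
      simp
    have h3 := congrArg (starRingEnd ℂ) h2
    simp only [map_mul, Complex.conj_conj, Complex.conj_ofReal, Complex.conj_I] at h3
    ext1
    · rfl
    · have h4 : axis α p.1 * starRingEnd ℂ (axis α p.1) = (‖axis α p.1‖ : ℂ) ^ 2 :=
        Complex.mul_conj' _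
      simp only [spt]
      push_cast
      field_simp
      rw [← h4]
      linear_combination axis α p.1 * h3
  obtain ⟨e, he⟩ := key
  refine ⟨e, he, ?_⟩
  rw [← normSq_spt h e, ← he]
  exact hp.1

theorem continuous_axis (α : ℝ) : Continuous (axis α) := by
  unfold axis
  fun_prop

theorem continuousOn_spt (α : ℝ) {X : Type*} [TopologicalSpace X] {s : Set X} {N : X → ℂ}
    {e : X → ℝ} (hN : ContinuousOn N s) (he : ContinuousOn e s) (h : ∀ x ∈ s, axis α (N x) ≠ 0) :
    ContinuousOn (fun x => spt α (N x) (e x)) s := by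
  have h1 : ContinuousOn (fun x => axis α (N x)) s := (continuous_axis α).comp_continuousOn hN
  refine hN.prodMk (ContinuousOn.mul (Complex.continuous_ofReal.comp_continuousOn he) ?_)
  refine ContinuousOn.div (continuousOn_const.mul h1)
    (Complex.continuous_ofReal.comp_continuousOn h1.norm) fun x hx => ?_
  exact_mod_cast norm_ne_zero_iff.mpr (h x hx)

theorem continuous_bisEq (α : ℝ) : Continuous (bisEq α) := by
  unfold bisEq
  fun_prop

theorem isClosed_spinal (α : ℝ) : IsClosed (spinal α) := by
  refine (isClosed_eq ?_ continuous_const).inter (isClosed_eq (continuous_bisEq α) continuous_const)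
  exact (Complex.continuous_normSq.comp continuous_fst).add
    (Complex.continuous_normSq.comp continuous_snd)

theorem isClosed_face (α : ℝ) : IsClosed (face α) := by
  have h : face α = spinal α ∩ {p | |p.1.re| ≤ Real.cos α * Complex.normSq p.1} := rfl
  rw [h]
  refine (isClosed_spinal α).inter (isClosed_le ?_ ?_)
  · exact (Complex.continuous_re.comp continuous_fst).abs
  · exact continuous_const.mul (Complex.continuous_normSq.comp continuous_fst)

theorem axis_ne_zero_of_re {α : ℝ} {N : ℂ} (h : N.re ≠ 0) : axis α N ≠ 0 := by
  intro h'
  have := congrArg Complex.re h'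
  simp [axis, -Complex.ofReal_sin] at this
  exact h this

theorem axis_zero_ne_zero {α : ℝ} (hs : 0 < Real.sin α) : axis α 0 ≠ 0 := by
  intro h'
  have := congrArg Complex.im h'
  simp [axis, -Complex.ofReal_sin] at this
  exact hs.ne' this

/-! ### Arcs of Giraud circles -/

/-- The first coordinate of the point of parameter `e` on an arc of a Giraud circle. -/
def arcFst (α ε δ e : ℝ) : ℂ :=
  ⟨ε * Real.cos α * (1 - e ^ 2),
    δ * (Real.sqrt (1 - e ^ 2) * Real.sqrt (Real.sin α ^ 2 + Real.cos α ^ 2 * e ^ 2))⟩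

/-- The point of parameter `e` on an arc of a Giraud circle. -/
def arcPt (α ε δ e : ℝ) : ℂ × ℂ := spt α (arcFst α ε δ e) e

theorem arcFst_of_sq_eq_one {α ε δ e : ℝ} (he : e ^ 2 = 1) : arcFst α ε δ e = 0 := by
  apply Complex.ext <;> simp [arcFst, he]

theorem one_sub_sq_nonneg {e : ℝ} (he : e ∈ Set.Icc (-1 : ℝ) 1) : 0 ≤ 1 - e ^ 2 := by
  nlinarith [he.1, he.2]

theorem one_sub_sq_pos {e : ℝ} (he : e ∈ Set.Ioo (-1 : ℝ) 1) : 0 < 1 - e ^ 2 := by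
  nlinarith [he.1, he.2]

section

variable {α ε δ e : ℝ}

/-- Vanishing would force `Re N = 0`, hence `e² = 1` and `N = 0`, where the axis is `i sin α`. So
the parametrization by `e` has no singular point on a Giraud circle. -/
theorem axis_arcFst_ne_zero (hs : 0 < Real.sin α) (hc : 0 < Real.cos α) (hε : ε ^ 2 = 1) :
    axis α (arcFst α ε δ e) ≠ 0 := by
  by_cases h : e ^ 2 = 1
  · rw [arcFst_of_sq_eq_one h]
    exact axis_zero_ne_zero hs
  · refine axis_ne_zero_of_re ?_
    have hε' : ε ≠ 0 := by
      rintro rfl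
      norm_num at hε
    exact mul_ne_zero (mul_ne_zero hε' hc.ne') (sub_ne_zero.mpr (Ne.symm h))

/-- The imaginary part of `arcFst` was chosen for this: `cos² α (1 - e²) + sin² α + cos² α e² = 1`.
-/
theorem normSq_arcFst (hε : ε ^ 2 = 1) (hδ : δ ^ 2 = 1) (he : e ∈ Set.Icc (-1 : ℝ) 1) :
    Complex.normSq (arcFst α ε δ e) = 1 - e ^ 2 := by
  have h1 := Real.sq_sqrt (one_sub_sq_nonneg he)
  have h2 := Real.sq_sqrt (show 0 ≤ Real.sin α ^ 2 + Real.cos α ^ 2 * e ^ 2 by positivity)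
  have h3 := Real.sin_sq_add_cos_sq α
  rw [Complex.normSq_apply]
  simp only [arcFst]
  generalize Real.sqrt (1 - e ^ 2) = x at *
  generalize Real.sqrt (Real.sin α ^ 2 + Real.cos α ^ 2 * e ^ 2) = y at *
  linear_combination (Real.cos α ^ 2 * (1 - e ^ 2) ^ 2) * hε + x ^ 2 * y ^ 2 * hδ + x ^ 2 * h2 +
    (Real.sin α ^ 2 + Real.cos α ^ 2 * e ^ 2) * h1 + (1 - e ^ 2) * h3

theorem arcPt_mem_giraud (hs : 0 < Real.sin α) (hc : 0 < Real.cos α) (hε : ε ^ 2 = 1)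
    (hδ : δ ^ 2 = 1) (he : e ∈ Set.Icc (-1 : ℝ) 1) : arcPt α ε δ e ∈ giraud α ε := by
  have h := normSq_arcFst (α := α) hε hδ he
  refine ⟨spt_mem_spinal (axis_arcFst_ne_zero hs hc hε) (by rw [h]; ring), ?_⟩
  simp only [arcPt, spt]
  rw [h]
  simp only [arcFst]
  linear_combination (-Real.cos α * (1 - e ^ 2)) * hε

theorem arcPt_one (hs : 0 < Real.sin α) : arcPt α ε δ 1 = (0, -1) := by
  have h : (Real.sin α : ℂ) ≠ 0 := by exact_mod_cast hs.ne'
  rw [arcPt, arcFst_of_sq_eq_one (by norm_num), spt, axis]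
  ext1
  · rfl
  · simp [-Complex.ofReal_sin, abs_of_pos hs]
    field_simp
    exact Complex.I_sq

theorem arcPt_neg_one (hs : 0 < Real.sin α) : arcPt α ε δ (-1) = (0, 1) := by
  have h : (Real.sin α : ℂ) ≠ 0 := by exact_mod_cast hs.ne'
  rw [arcPt, arcFst_of_sq_eq_one (by norm_num), spt, axis]
  ext1
  · rfl
  · simp [-Complex.ofReal_sin, abs_of_pos hs]
    field_simp
    exact (congrArg Neg.neg Complex.I_sq).trans (neg_neg _)

theorem arcPt_zero (hs : 0 < Real.sin α) :
    arcPt α ε 1 0 = (⟨ε * Real.cos α, Real.sin α⟩, 0) := by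
  simp [arcPt, spt, arcFst, Real.sqrt_sq hs.le]

theorem continuousOn_arcPt (hs : 0 < Real.sin α) (hc : 0 < Real.cos α) (hε : ε ^ 2 = 1)
    (s : Set ℝ) : ContinuousOn (arcPt α ε δ) s := by
  refine continuousOn_spt α (Continuous.continuousOn ?_) continuousOn_id
    fun e _ => axis_arcFst_ne_zero hs hc hε
  have h : arcFst α ε δ = fun e => ((ε * Real.cos α * (1 - e ^ 2) : ℝ) : ℂ) +
      ((δ * (Real.sqrt (1 - e ^ 2) * Real.sqrt (Real.sin α ^ 2 + Real.cos α ^ 2 * e ^ 2)) : ℝ) : ℂ)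
        * Complex.I := by
    ext1 e
    exact Complex.mk_eq_add_mul_I _ _
  rw [h]
  fun_prop

theorem arcPt_injective (hs : 0 < Real.sin α) (hc : 0 < Real.cos α) (hε : ε ^ 2 = 1) :
    Function.Injective (arcPt α ε δ) := by
  intro e e' h
  have h0 := axis_arcFst_ne_zero (δ := δ) (e := e) hs hc hε
  have h1 : arcFst α ε δ e = arcFst α ε δ e' := congrArg Prod.fst h
  have h2 := congrArg Prod.snd h
  simp only [arcPt, spt] at h2
  rw [← h1] at h2
  have h3 : (‖axis α (arcFst α ε δ e)‖ : ℂ) ≠ 0 := by exact_mod_cast norm_ne_zero_iff.mpr h0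
  have h4 := mul_right_cancel₀ (div_ne_zero (mul_ne_zero Complex.I_ne_zero h0) h3) h2
  exact_mod_cast h4

/-- One of the two arcs cut out on a Giraud circle by the two common points. -/
def halfArc (α ε δ : ℝ) : Set (ℂ × ℂ) := arcPt α ε δ '' Set.Icc (-1) 1

theorem isClosed_arcPt_image (hs : 0 < Real.sin α) (hc : 0 < Real.cos α) (hε : ε ^ 2 = 1)
    (x y : ℝ) : IsClosed (arcPt α ε δ '' Set.Icc x y) :=
  (isCompact_Icc.image_of_continuousOn (continuousOn_arcPt hs hc hε _)).isClosed

/-- On a Giraud circle `e` determines `|N|² = 1 - e²`, then `Re N` by the equation of the circle,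
then `Im N` up to sign. The sign `δ` selects the arc. -/
theorem mem_halfArc (hs : 0 < Real.sin α) (hc : 0 < Real.cos α) (hε : ε ^ 2 = 1)
    (hδ : δ ^ 2 = 1) {p : ℂ × ℂ} :
    p ∈ halfArc α ε δ ↔ p ∈ giraud α ε ∧ 0 ≤ δ * p.1.im := by
  constructor
  · rintro ⟨e, he, rfl⟩
    refine ⟨arcPt_mem_giraud hs hc hε hδ he, ?_⟩
    simp only [arcPt, spt, arcFst]
    rw [← mul_assoc, ← sq, hδ, one_mul]
    positivity
  · rintro ⟨⟨h1, h2⟩, h3⟩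
    have hre : p.1.re = ε * Real.cos α * Complex.normSq p.1 := by
      linear_combination (-ε) * h2 - p.1.re * hε
    have hax : axis α p.1 ≠ 0 := by
      by_cases h : p.1.re = 0
      · rw [h, mul_zero, mul_eq_zero_iff_left hc.ne', Complex.normSq_eq_zero] at h2
        rw [h2]
        exact axis_zero_ne_zero hs
      · exact axis_ne_zero_of_re h
    obtain ⟨e, he, he'⟩ := exists_eq_spt h1 hax
    have hn := Complex.normSq_nonneg p.1
    have heI : e ∈ Set.Icc (-1 : ℝ) 1 := abs_le.mp ((sq_le_one_iff_abs_le_one e).mp (by linarith))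
    refine ⟨e, heI, ?_⟩
    have hn' : Complex.normSq p.1 = 1 - e ^ 2 := by linarith
    have hfst : arcFst α ε δ e = p.1 := by
      apply Complex.ext
      · simp only [arcFst]
        rw [hre, hn']
      · have e1 : δ * (δ * p.1.im) = p.1.im := by linear_combination p.1.im * hδ
        simp only [arcFst]
        rw [← e1]
        congr 1
        rw [← Real.sqrt_mul (one_sub_sq_nonneg heI)]
        rw [Real.sqrt_eq_iff_mul_self_eq (mul_nonneg (one_sub_sq_nonneg heI) (by positivity)) h3]
        have h5 := Complex.normSq_apply p.1
        have h6 := Real.sin_sq_add_cos_sq α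
        rw [hn', hre, hn'] at h5
        linear_combination h5 - p.1.im ^ 2 * hδ + (1 - e ^ 2) * h6 +
          (Real.cos α ^ 2 * (1 - e ^ 2) ^ 2) * hε
    rw [arcPt, hfst, ← he]

theorem giraud_eq_union (hs : 0 < Real.sin α) (hc : 0 < Real.cos α) (hε : ε ^ 2 = 1) :
    giraud α ε = halfArc α ε (-1) ∪ halfArc α ε 1 := by
  ext p
  rw [Set.mem_union, mem_halfArc hs hc hε (by norm_num), mem_halfArc hs hc hε (by norm_num),
    ← and_or_left]
  refine (and_iff_left ?_).symm
  rcases le_total 0 p.1.im with h | h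
  · right; linarith
  · left; linarith

/-- For real `N` the cone condition reads `|N| (1 - cos α |N|) ≤ 0`. Here `|N| ≤ 1` and `cos α < 1`,
so `N = 0`: the face is pinched at the two tangency points. -/
theorem eq_of_mem_face_of_im_eq_zero (hs : 0 < Real.sin α) (hc : 0 < Real.cos α) {p : ℂ × ℂ}
    (hp : p ∈ face α) (him : p.1.im = 0) : p = (0, -1) ∨ p = (0, 1) := by
  obtain ⟨⟨h1, h2⟩, h3⟩ := hp
  refine eq_of_fst_eq_zero hs ?_ h1 h2
  have h4 := Complex.normSq_apply p.1
  rw [him, mul_zero, add_zero] at h4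
  rw [h4] at h3
  have h5 := Complex.normSq_nonneg p.2
  have h6 := Real.sin_sq_add_cos_sq α
  have h7 : Real.cos α < 1 := by nlinarith
  have h8 : |p.1.re| * (1 - Real.cos α * |p.1.re|) ≤ 0 := by
    rw [← abs_mul_abs_self] at h3
    linarith
  have h9 : |p.1.re| ≤ 1 := by
    rw [← sq_le_one_iff_abs_le_one]
    linarith
  have h10 : 0 < 1 - Real.cos α * |p.1.re| := by nlinarith [abs_nonneg p.1.re]
  have h11 : |p.1.re| ≤ 0 := nonpos_of_mul_nonpos_left h8 h10
  exact Complex.ext (abs_eq_zero.mp (le_antisymm h11 (abs_nonneg _))) him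

theorem giraud_subset_face (hε : ε ^ 2 = 1) (hc : 0 < Real.cos α) : giraud α ε ⊆ face α := by
  rintro p ⟨h1, h2⟩
  refine ⟨h1, ?_⟩
  have h3 : |ε| = 1 := (sq_eq_sq₀ (abs_nonneg ε) zero_le_one).mp (by rw [sq_abs, hε, one_pow])
  rw [h2, ← one_mul |p.1.re|, ← h3, ← abs_mul, ← h2,
    abs_of_nonneg (mul_nonneg hc.le (Complex.normSq_nonneg _))]

end

/-! ### The quadrilateral at infinity is connected -/

section

variable {α : ℝ}

/-- The part of the boundary of the 3-face with first coordinate in the lower half plane. -/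
def lowerFace (α : ℝ) : Set (ℂ × ℂ) := {p | p ∈ face α ∧ p.1.im ≤ 0}

/-- The part of the boundary of the 3-face with first coordinate in the upper half plane. -/
def upperFace (α : ℝ) : Set (ℂ × ℂ) := {p | p ∈ face α ∧ 0 ≤ p.1.im}

/-- The interior side of the upper part. -/
def openUpperFace (α : ℝ) : Set (ℂ × ℂ) := {p | p ∈ face α ∧ 0 < p.1.im}

/-- The arc of the real circle `E = 0` in the upper part of the face. -/
def coreArc (α : ℝ) : Set (ℂ × ℂ) := {p | p ∈ openUpperFace α ∧ p.2 = 0}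

/-- With `E = 0` the coordinate `N` lies on the unit circle and is a function of `x = Re N`, over an
interval. Intersecting with the open interval `(-1, 1)` keeps `Im N > 0` without an assumption on
`cos α`. -/
theorem isPreconnected_coreArc : IsPreconnected (coreArc α) := by
  have h : coreArc α = (fun x : ℝ => (((x : ℂ) + (Real.sqrt (1 - x ^ 2) : ℝ) * Complex.I, 0) : ℂ × ℂ))
      '' (Set.Icc (-Real.cos α) (Real.cos α) ∩ Set.Ioo (-1) 1) := by
    ext p
    constructor
    · rintro ⟨⟨⟨⟨h1, h2⟩, h3⟩, h4⟩, h5⟩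
      rw [h5, map_zero, add_zero] at h1
      rw [h1, mul_one] at h3
      rw [Complex.normSq_apply] at h1
      refine ⟨p.1.re, ⟨abs_le.mp h3, abs_lt.mp ?_⟩, ?_⟩
      · rw [← sq_lt_one_iff_abs_lt_one]
        nlinarith
      · ext1
        · apply Complex.ext
          · simp
          · simp
            rw [Real.sqrt_eq_iff_mul_self_eq (by nlinarith) h4.le]
            linarith
        · exact h5.symm
    · rintro ⟨x, ⟨h1, h2⟩, rfl⟩
      have h3 : 0 < 1 - x ^ 2 := one_sub_sq_pos h2
      have h4 : Complex.normSq ((x : ℂ) + (Real.sqrt (1 - x ^ 2) : ℝ) * Complex.I) = 1 := by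
        rw [Complex.normSq_apply]
        simp
        rw [Real.mul_self_sqrt h3.le]
        ring
      refine ⟨⟨⟨⟨?_, ?_⟩, ?_⟩, ?_⟩, rfl⟩
      · simp only [h4, map_zero, add_zero]
      · simp [bisEq]
      · simp only [h4, mul_one]
        simpa using abs_le.mpr h1
      · simpa using h3
  rw [h]
  refine IsPreconnected.image ?_ _ (by fun_prop)
  exact (Set.ordConnected_Icc.inter Set.ordConnected_Ioo).isPreconnected

/-- Scale `N` up by real factors `r ≥ 1` until it reaches the unit circle. `Re N` grows like `r` and
`|N|²` like `r²`, so the cone condition persists. The axis stays nonzero because `Re N` does, so `E`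
can follow continuously and ends at zero on `coreArc`. -/
theorem isPreconnected_union_path {p : ℂ × ℂ} (hp : p ∈ openUpperFace α) (hre : p.1.re ≠ 0) :
    ∃ s ⊆ openUpperFace α, IsPreconnected s ∧ p ∈ s ∧ (s ∩ coreArc α).Nonempty ∧
      ∀ q ∈ s, q.1.re ≠ 0 := by
  obtain ⟨⟨h1, h3⟩, h4⟩ := hp
  obtain ⟨e, he, he'⟩ := exists_eq_spt h1 (axis_ne_zero_of_re hre)
  -- The sign of `e` is fixed along the path, so that its start is `p` and not the point with
  -- opposite `E`.
  obtain ⟨σ, hσ, hσe⟩ : ∃ σ : ℝ, σ ^ 2 = 1 ∧ σ * |e| = e := by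
    rcases le_total 0 e with h | h
    · exact ⟨1, by norm_num, by rw [abs_of_nonneg h, one_mul]⟩
    · exact ⟨-1, by norm_num, by rw [abs_of_nonpos h]; ring⟩
  set n := Complex.normSq p.1 with hn
  have hn0 : 0 < n := Complex.normSq_pos.mpr fun h => hre (by rw [h]; rfl)
  have hn1 : n ≤ 1 := by nlinarith
  have hr1 : ∀ r : ℝ, ((r : ℂ) * p.1).re = r * p.1.re := fun r => Complex.re_ofReal_mul r p.1
  have hr2 : ∀ r : ℝ, ((r : ℂ) * p.1).im = r * p.1.im := fun r => Complex.im_ofReal_mul r p.1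
  have hr3 : ∀ r : ℝ, Complex.normSq ((r : ℂ) * p.1) = r ^ 2 * n := fun r => by
    rw [map_mul, Complex.normSq_ofReal, sq]
  have key : ∀ r ∈ Set.Icc 1 (Real.sqrt n)⁻¹, 0 ≤ 1 - r ^ 2 * n ∧ 1 ≤ r ∧ (r : ℂ) * p.1.re ≠ 0 := by
    intro r hr
    have hsq : 0 < Real.sqrt n := Real.sqrt_pos.mpr hn0
    refine ⟨?_, hr.1, ?_⟩
    · have h5 : r * Real.sqrt n ≤ 1 := by
        have := mul_le_mul_of_nonneg_right hr.2 hsq.le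
        rwa [inv_mul_cancel₀ hsq.ne'] at this
      have h6 : 0 ≤ r * Real.sqrt n := mul_nonneg (by linarith [hr.1]) hsq.le
      have h7 : (r * Real.sqrt n) ^ 2 ≤ 1 := by nlinarith
      rw [mul_pow, Real.sq_sqrt hn0.le] at h7
      linarith
    · have : r ≠ 0 := by linarith [hr.1]
      exact_mod_cast mul_ne_zero this hre
  have hfun : ∀ r ∈ Set.Icc 1 (Real.sqrt n)⁻¹,
      spt α (r * p.1) (σ * Real.sqrt (1 - r ^ 2 * n)) ∈ openUpperFace α := by
    intro r hr
    obtain ⟨k1, k2, k3⟩ := key r hr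
    refine ⟨⟨spt_mem_spinal (axis_ne_zero_of_re ?_) ?_, ?_⟩, ?_⟩
    · rw [hr1]
      exact_mod_cast k3
    · rw [hr3, mul_pow, hσ, Real.sq_sqrt k1]
      ring
    · simp only [spt]
      rw [hr1, hr3, abs_mul, abs_of_nonneg (by linarith)]
      have h5 := mul_le_mul_of_nonneg_left h3 (zero_le_one.trans k2)
      have h6 : 0 ≤ r * (Real.cos α * n) := (mul_nonneg (by linarith) (abs_nonneg _)).trans h5
      have h7 := mul_le_mul_of_nonneg_right k2 h6
      linarith
    · simp only [spt]
      rw [hr2]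
      positivity
  have hsq : 0 < Real.sqrt n := Real.sqrt_pos.mpr hn0
  have hle : 1 ≤ (Real.sqrt n)⁻¹ := by
    rw [one_le_inv₀ hsq]
    exact Real.sqrt_le_one.mpr hn1
  refine ⟨(fun r : ℝ => spt α (r * p.1) (σ * Real.sqrt (1 - r ^ 2 * n))) ''
    Set.Icc 1 (Real.sqrt n)⁻¹, ?_, ?_, ?_, ?_, ?_⟩
  · rintro _ ⟨r, hr, rfl⟩
    exact hfun r hr
  · refine isPreconnected_Icc.image _ (continuousOn_spt α ?_ ?_ ?_)
    · fun_prop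
    · fun_prop
    · intro r hr
      refine axis_ne_zero_of_re ?_
      rw [hr1]
      exact_mod_cast (key r hr).2.2
  · refine ⟨1, ⟨le_refl _, hle⟩, ?_⟩
    have h5 : Real.sqrt (1 - 1 ^ 2 * n) = |e| := by
      rw [← Real.sqrt_sq_eq_abs]
      congr 1
      linarith
    simp only [h5, hσe, Complex.ofReal_one, one_mul]
    exact he.symm
  · refine ⟨_, Set.mem_image_of_mem _ ⟨hle, le_refl _⟩, hfun _ ⟨hle, le_refl _⟩, ?_⟩
    have h5 : (1 : ℝ) - (Real.sqrt n)⁻¹ ^ 2 * n = 0 := by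
      rw [inv_pow, Real.sq_sqrt hn0.le, inv_mul_cancel₀ hn0.ne', sub_self]
    simp only [spt, h5, Real.sqrt_zero, mul_zero, Complex.ofReal_zero, zero_mul]
  · rintro _ ⟨r, hr, rfl⟩
    simp only [spt]
    rw [hr1]
    exact_mod_cast (key r hr).2.2

theorem isPreconnected_openUpperFace_re_ne_zero :
    IsPreconnected (coreArc α ∪ {p | p ∈ openUpperFace α ∧ p.1.re ≠ 0}) := by
  by_cases hne : (coreArc α).Nonempty
  · obtain ⟨x, hx⟩ := hne
    refine isPreconnected_of_forall x fun y hy => ?_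
    rcases hy with hy | ⟨hy, hy'⟩
    · exact ⟨coreArc α, Set.subset_union_left, hx, hy, isPreconnected_coreArc⟩
    · obtain ⟨s, h1, h2, h3, ⟨t, ht⟩, h5⟩ := isPreconnected_union_path hy hy'
      refine ⟨coreArc α ∪ s, ?_, Or.inl hx, Or.inr h3, ?_⟩
      · exact Set.union_subset_union_right _ fun q hq => ⟨h1 hq, h5 q hq⟩
      · exact isPreconnected_coreArc.union t ht.2 ht.1 h2
  · have h : {p | p ∈ openUpperFace α ∧ p.1.re ≠ 0} = ∅ := by
      ext p
      simp only [Set.mem_empty_iff_false, iff_false]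
      rintro ⟨hy, hy'⟩
      obtain ⟨s, h1, h2, h3, ⟨t, ht⟩, h5⟩ := isPreconnected_union_path hy hy'
      exact hne ⟨t, ht.2⟩
    rw [h, Set.union_empty]
    exact isPreconnected_coreArc

/-- The points of the face away from the Giraud circles. -/
def strictCone (α : ℝ) : Set (ℂ × ℂ) := {p | |p.1.re| < Real.cos α * Complex.normSq p.1}

theorem isOpen_strictCone : IsOpen (strictCone α) :=
  isOpen_lt (Complex.continuous_re.comp continuous_fst).abs
    (continuous_const.mul (Complex.continuous_normSq.comp continuous_fst))

/-- Inside the spinal sphere, the strict cone and the upper half plane are open conditions. A limit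
process on the sphere therefore ends inside the face. -/
theorem eventually_mem_openUpperFace {X : Type*} {l : Filter X} {q : X → ℂ × ℂ} {p : ℂ × ℂ}
    (hq : Filter.Tendsto q l (nhds p)) (hs : ∀ᶠ x in l, q x ∈ spinal α) (hp : p ∈ strictCone α)
    (him : 0 < p.1.im) : ∀ᶠ x in l, q x ∈ openUpperFace α := by
  have h1 := hq.eventually (isOpen_strictCone.mem_nhds hp)
  have h2 := hq.eventually
    ((isOpen_lt continuous_const (Complex.continuous_im.comp continuous_fst)).mem_nhds him)
  filter_upwards [hs, h1, h2] with x k1 k2 k3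
  exact ⟨⟨k1, le_of_lt k2⟩, k3⟩

theorem mem_strictCone_of_re_eq_zero (hc : 0 < Real.cos α) {p : ℂ × ℂ} (h : p.1.re = 0)
    (him : 0 < p.1.im) : p ∈ strictCone α := by
  have : 0 < Complex.normSq p.1 := Complex.normSq_pos.mpr fun h' => by
    rw [h'] at him
    exact lt_irrefl _ him
  change |p.1.re| < _
  rw [h, abs_zero]
  positivity

theorem sq_snd_eq {p : ℂ × ℂ} {e : ℝ} (he : p = spt α p.1 e) (h : e = 0) : p.2 = 0 := by
  rw [he, h]
  simp [spt]

/-- Points of the spinal sphere are limits of sections along any way to approach the first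
coordinate. -/
theorem tendsto_spt {p : ℂ × ℂ} (hp : p ∈ spinal α) (hax : axis α p.1 ≠ 0) (hp2 : p.2 ≠ 0)
    {X : Type*} {l : Filter X} {N : X → ℂ} (hN : Filter.Tendsto N l (nhds p.1)) :
    ∃ q : X → ℂ × ℂ, Filter.Tendsto q l (nhds p) ∧ (∀ x, (q x).1 = N x) ∧
      ∀ᶠ x in l, q x ∈ spinal α := by
  obtain ⟨e, he, he'⟩ := exists_eq_spt hp hax
  obtain ⟨σ, hσ, hσe⟩ : ∃ σ : ℝ, σ ^ 2 = 1 ∧ σ * |e| = e := by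
    rcases le_total 0 e with h | h
    · exact ⟨1, by norm_num, by rw [abs_of_nonneg h, one_mul]⟩
    · exact ⟨-1, by norm_num, by rw [abs_of_nonpos h]; ring⟩
  -- A nonzero second coordinate means `|N| < 1`, which leaves room to move `N` in every direction
  -- inside the unit disk.
  have he0 : 0 < e ^ 2 := by
    refine lt_of_le_of_ne (sq_nonneg e) fun h => hp2 (sq_snd_eq he ?_)
    exact pow_eq_zero_iff (two_ne_zero) |>.mp h.symm
  have hn : Filter.Tendsto (fun x => Complex.normSq (N x)) l (nhds (Complex.normSq p.1)) :=
    (Complex.continuous_normSq.tendsto _).comp hN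
  have hax' : Filter.Tendsto (fun x => axis α (N x)) l (nhds (axis α p.1)) :=
    ((continuous_axis α).tendsto _).comp hN
  refine ⟨fun x => spt α (N x) (σ * Real.sqrt (1 - Complex.normSq (N x))), ?_, fun x => rfl, ?_⟩
  · have h1 : Filter.Tendsto (fun x => σ * Real.sqrt (1 - Complex.normSq (N x))) l (nhds e) := by
      have h2 : e = σ * Real.sqrt (1 - Complex.normSq p.1) := by
        rw [show 1 - Complex.normSq p.1 = e ^ 2 by linarith, Real.sqrt_sq_eq_abs, hσe]
      rw [h2]
      exact (Filter.Tendsto.sqrt (hn.const_sub 1)).const_mul σ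
    rw [he]
    have h3 : ((‖axis α p.1‖ : ℝ) : ℂ) ≠ 0 := by exact_mod_cast norm_ne_zero_iff.mpr hax
    exact hN.prodMk_nhds (((Complex.continuous_ofReal.tendsto _).comp h1).mul
      ((hax'.const_mul _).div ((Complex.continuous_ofReal.tendsto _).comp hax'.norm) h3))
  · filter_upwards [hax'.eventually_ne hax, hn.eventually_lt_const (show Complex.normSq p.1 < 1 by linarith)]
      with x k1 k2
    refine spt_mem_spinal k1 ?_
    rw [mul_pow, hσ, Real.sq_sqrt (by linarith)]
    ring

/-- A point with `Re N = 0` and nonzero axis is approached by adding a small real number to `N`. It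
lies in the open cone, since `Re N = 0` and `Im N > 0`, so the nearby points stay in the face. -/
theorem openUpperFace_axis_subset_closure (hc : 0 < Real.cos α) :
    coreArc α ∪ {p | p ∈ openUpperFace α ∧ axis α p.1 ≠ 0} ⊆
      closure (coreArc α ∪ {p | p ∈ openUpperFace α ∧ p.1.re ≠ 0}) := by
  rintro p (hp | ⟨hp, hax⟩)
  · exact subset_closure (Or.inl hp)
  by_cases hre : p.1.re = 0
  swap
  · exact subset_closure (Or.inr ⟨hp, hre⟩)
  by_cases hp2 : p.2 = 0
  · exact subset_closure (Or.inl ⟨hp, hp2⟩)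
  have hN : Filter.Tendsto (fun h : ℝ => p.1 + h) (nhdsWithin 0 {0}ᶜ) (nhds p.1) := by
    have : Continuous fun h : ℝ => p.1 + h := by fun_prop
    have h2 := this.tendsto 0
    rw [Complex.ofReal_zero, add_zero] at h2
    exact h2.mono_left nhdsWithin_le_nhds
  obtain ⟨q, h1, h2, h3⟩ := tendsto_spt hp.1.1 hax hp2 hN
  have h4 := eventually_mem_openUpperFace h1 h3 (mem_strictCone_of_re_eq_zero hc hre hp.2) hp.2
  refine mem_closure_of_tendsto h1 ?_
  filter_upwards [h4, self_mem_nhdsWithin] with h k1 k2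
  refine Or.inr ⟨k1, ?_⟩
  rw [h2, Complex.add_re, hre, zero_add, Complex.ofReal_re]
  exact k2

/-- The exceptional first coordinate is `N = 2i sin α`: its axis vanishes and `E` is constrained
only in modulus. Each such `E` must be reached along its own direction. -/
theorem openUpperFace_subset_closure (hc : 0 < Real.cos α) :
    openUpperFace α ⊆
      closure (coreArc α ∪ {p | p ∈ openUpperFace α ∧ axis α p.1 ≠ 0}) := by
  intro p hp
  by_cases hax : axis α p.1 = 0
  swap
  · exact subset_closure (Or.inr ⟨hp, hax⟩)
  by_cases hp2 : p.2 = 0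
  · exact subset_closure (Or.inl ⟨hp, hp2⟩)
  have hre : p.1.re = 0 := by
    by_contra h
    exact axis_ne_zero_of_re h hax
  have hnE : 0 < Complex.normSq p.2 := Complex.normSq_pos.mpr hp2
  have hE : (‖p.2‖ : ℂ) ≠ 0 := by exact_mod_cast norm_ne_zero_iff.mpr hp2
  have hp1 : p.1 = 2 * (Real.sin α * Complex.I) := by
    have := hax
    rw [axis, sub_eq_zero] at this
    rw [this]
    ring
  -- The perturbation `2i h E` is chosen so that `i * axis` becomes the positive multiple `h E`.
  -- Sections over the perturbed `N` then have second coordinate in the direction of `E`.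
  have haxN : ∀ h : ℝ, axis α (p.1 + 2 * Complex.I * h * p.2) = h * (-Complex.I * p.2) := by
    intro h
    rw [axis, hp1]
    ring
  have hN : Continuous fun h : ℝ => p.1 + 2 * Complex.I * h * p.2 := by fun_prop
  have hn : Filter.Tendsto (fun h : ℝ => Complex.normSq (p.1 + 2 * Complex.I * h * p.2))
      (nhdsWithin 0 (Set.Ioi 0)) (nhds (Complex.normSq p.1)) := by
    have := (Complex.continuous_normSq.comp hN).tendsto 0
    simp only [Function.comp, Complex.ofReal_zero, mul_zero, zero_mul, add_zero] at this
    exact this.mono_left nhdsWithin_le_nhds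
  have hsum : Complex.normSq p.1 + Complex.normSq p.2 = 1 := hp.1.1.1
  have hEq : ∀ h : ℝ, 0 < h → ∀ e : ℝ, spt α (p.1 + 2 * Complex.I * h * p.2) e =
      (p.1 + 2 * Complex.I * h * p.2, e * (p.2 / ‖p.2‖)) := by
    intro h hh e
    have hh' : (h : ℂ) ≠ 0 := by exact_mod_cast hh.ne'
    rw [spt, haxN, norm_mul, norm_mul, norm_neg, Complex.norm_I, one_mul, Complex.norm_real,
      Real.norm_of_nonneg hh.le]
    ext1
    · rfl
    · simp only
      push_cast
      field_simp
      linear_combination (-(e : ℂ)) * Complex.I_sq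
  have hq : Filter.Tendsto (fun h : ℝ => spt α (p.1 + 2 * Complex.I * h * p.2)
      (Real.sqrt (1 - Complex.normSq (p.1 + 2 * Complex.I * h * p.2))))
      (nhdsWithin 0 (Set.Ioi 0)) (nhds p) := by
    have h1 : Filter.Tendsto (fun h : ℝ => p.1 + 2 * Complex.I * h * p.2)
        (nhdsWithin 0 (Set.Ioi 0)) (nhds p.1) := by
      have := hN.tendsto 0
      simp only [Complex.ofReal_zero, mul_zero, zero_mul, add_zero] at this
      exact this.mono_left nhdsWithin_le_nhds
    have h2 := (Filter.Tendsto.sqrt (hn.const_sub 1))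
    have h3 : Real.sqrt (1 - Complex.normSq p.1) = ‖p.2‖ := by
      rw [show 1 - Complex.normSq p.1 = ‖p.2‖ ^ 2 by
        rw [← Complex.normSq_eq_norm_sq]; linarith, Real.sqrt_sq (norm_nonneg _)]
    rw [h3] at h2
    have h4 := ((Complex.continuous_ofReal.tendsto _).comp h2).mul_const (p.2 / (‖p.2‖ : ℂ))
    rw [mul_div_cancel₀ _ hE] at h4
    refine (h1.prodMk_nhds h4).congr' ?_
    filter_upwards [self_mem_nhdsWithin] with h hh
    exact (hEq h hh _).symm
  have hne : ∀ᶠ h : ℝ in nhdsWithin 0 (Set.Ioi 0), axis α (p.1 + 2 * Complex.I * h * p.2) ≠ 0 := by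
    filter_upwards [self_mem_nhdsWithin] with h hh
    rw [haxN]
    have hh' : (h : ℂ) ≠ 0 := by exact_mod_cast (ne_of_gt hh)
    exact mul_ne_zero hh' (mul_ne_zero (neg_ne_zero.mpr Complex.I_ne_zero) hp2)
  have hsp : ∀ᶠ h : ℝ in nhdsWithin 0 (Set.Ioi 0), spt α (p.1 + 2 * Complex.I * h * p.2)
      (Real.sqrt (1 - Complex.normSq (p.1 + 2 * Complex.I * h * p.2))) ∈ spinal α := by
    filter_upwards [hne, hn.eventually_lt_const (show Complex.normSq p.1 < 1 by linarith)] with h k1 k2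
    refine spt_mem_spinal k1 ?_
    rw [Real.sq_sqrt (by linarith)]
    ring
  have h4 := eventually_mem_openUpperFace hq hsp (mem_strictCone_of_re_eq_zero hc hre hp.2) hp.2
  refine mem_closure_of_tendsto hq ?_
  filter_upwards [h4, hne] with h k1 k2
  exact Or.inr ⟨k1, k2⟩

/-- A set between a preconnected set and its closure is preconnected. This is used twice, first to
add points with `Re N = 0` and nonzero axis, then those with vanishing axis. -/
theorem isPreconnected_openUpperFace (hc : 0 < Real.cos α) : IsPreconnected (openUpperFace α) := by
  have h1 := (isPreconnected_openUpperFace_re_ne_zero (α := α)).subset_closure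
    (Set.union_subset_union_right _ fun p (hp : p ∈ openUpperFace α ∧ p.1.re ≠ 0) =>
      (⟨hp.1, axis_ne_zero_of_re hp.2⟩ : p ∈ openUpperFace α ∧ axis α p.1 ≠ 0))
    (openUpperFace_axis_subset_closure hc)
  exact h1.subset_closure (Set.union_subset (fun p hp => hp.1) fun p hp => hp.1)
    (openUpperFace_subset_closure hc)

/-! ### The boundary of the bigon and of the quadrilateral -/

variable {ε δ : ℝ}

/-- Shrink `N` by a factor `1 - h`: `|Re N|` decreases linearly and `|N|²` quadratically, so the
equality of the Giraud circle becomes a strict violation of the cone condition. The condition `E ≠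
0` lets `E` follow continuously. -/
theorem mem_closure_of_mem_giraud (hε : ε ^ 2 = 1) (hc : 0 < Real.cos α) {p : ℂ × ℂ}
    (hp : p ∈ giraud α ε) (hp1 : p.1 ≠ 0) (hp2 : p.2 ≠ 0) :
    p ∈ closure (spinal α \ face α) := by
  obtain ⟨h1, h2⟩ := hp
  have hn : 0 < Complex.normSq p.1 := Complex.normSq_pos.mpr hp1
  have hre : p.1.re ≠ 0 := by
    intro h
    rw [h, mul_zero] at h2
    exact (mul_pos hc hn).ne' h2
  have hN : Filter.Tendsto (fun h : ℝ => ((1 - h : ℝ) : ℂ) * p.1) (nhdsWithin 0 (Set.Ioi 0))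
      (nhds p.1) := by
    have : Continuous fun h : ℝ => ((1 - h : ℝ) : ℂ) * p.1 := by fun_prop
    have h2 := this.tendsto 0
    rw [sub_zero, Complex.ofReal_one, one_mul] at h2
    exact h2.mono_left nhdsWithin_le_nhds
  obtain ⟨q, h3, h4, h5⟩ := tendsto_spt h1 (axis_ne_zero_of_re hre) hp2 hN
  refine mem_closure_of_tendsto h3 ?_
  filter_upwards [h5, Ioo_mem_nhdsGT (zero_lt_one (α := ℝ))] with h k1 k2
  refine ⟨k1, fun hf => ?_⟩
  have hf2 := hf.2
  rw [h4, Complex.re_ofReal_mul, map_mul, Complex.normSq_ofReal] at hf2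
  have hε1 : |ε| = 1 := (sq_eq_sq₀ (abs_nonneg ε) zero_le_one).mp (by rw [sq_abs, hε, one_pow])
  have h6 : |p.1.re| = Real.cos α * Complex.normSq p.1 := by
    rw [← one_mul |p.1.re|, ← hε1, ← abs_mul, ← h2, abs_of_pos (mul_pos hc hn)]
  rw [abs_mul, abs_of_pos (by linarith [k2.2]), h6] at hf2
  have h7 : 0 < h * ((1 - h) * (Real.cos α * Complex.normSq p.1)) :=
    mul_pos k2.1 (mul_pos (by linarith [k2.2]) (mul_pos hc hn))
  linarith

/-- Shrinking `N` is not available where `N = 0` (`e = ±1`) or `E = 0` (`e = 0`). These parameters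
are kept out of the open interval and recovered as limits. -/
theorem arcPt_mem_closure (hs : 0 < Real.sin α) (hc : 0 < Real.cos α) (hε : ε ^ 2 = 1)
    (hδ : δ ^ 2 = 1) {x y : ℝ} (hxy : x < y) (hsub : Set.Ioo x y ⊆ Set.Ioo (-1) 1)
    (h0 : 0 ∉ Set.Ioo x y) : arcPt α ε δ '' Set.Icc x y ⊆ closure (spinal α \ face α) := by
  rw [← closure_Ioo hxy.ne]
  refine (continuousOn_arcPt hs hc hε _).image_closure.trans (closure_minimal ?_ isClosed_closure)
  rintro _ ⟨e, he, rfl⟩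
  have he1 := hsub he
  have hpos := one_sub_sq_pos he1
  refine mem_closure_of_mem_giraud hε hc
    (arcPt_mem_giraud hs hc hε hδ (Set.Ioo_subset_Icc_self he1)) ?_ ?_
  · rw [← Complex.normSq_pos]
    simp only [arcPt, spt]
    rwa [normSq_arcFst hε hδ (Set.Ioo_subset_Icc_self he1)]
  · rw [← Complex.normSq_pos, arcPt, normSq_spt (axis_arcFst_ne_zero hs hc hε)]
    refine lt_of_le_of_ne (sq_nonneg e) fun h => h0 ?_
    rwa [← pow_eq_zero_iff (two_ne_zero) |>.mp h.symm]

theorem giraud_subset_closure (hs : 0 < Real.sin α) (hc : 0 < Real.cos α) (hε : ε ^ 2 = 1) :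
    giraud α ε ⊆ closure (spinal α \ face α) := by
  have key : ∀ δ : ℝ, δ ^ 2 = 1 → halfArc α ε δ ⊆ closure (spinal α \ face α) := by
    intro δ hδ
    rw [halfArc, ← Set.Icc_union_Icc_eq_Icc (by norm_num : (-1 : ℝ) ≤ 0) zero_le_one,
      Set.image_union]
    refine Set.union_subset ?_ ?_
    · exact arcPt_mem_closure hs hc hε hδ (by norm_num)
        (Set.Ioo_subset_Ioo_right zero_le_one) (fun h => lt_irrefl _ h.2)
    · exact arcPt_mem_closure hs hc hε hδ (by norm_num)
        (Set.Ioo_subset_Ioo_left (by norm_num)) (fun h => lt_irrefl _ h.1)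
  rw [giraud_eq_union hs hc hε]
  exact Set.union_subset (key _ (by norm_num)) (key _ (by norm_num))

theorem face_eq_union : face α = lowerFace α ∪ upperFace α := by
  ext p
  rw [Set.mem_union]
  change _ ↔ p ∈ face α ∧ _ ∨ p ∈ face α ∧ _
  rw [← and_or_left]
  exact (and_iff_left (le_total _ _)).symm

theorem isClosed_lowerFace : IsClosed (lowerFace α) :=
  (isClosed_face α).inter
    (isClosed_le (Complex.continuous_im.comp continuous_fst) continuous_const)

theorem isClosed_upperFace : IsClosed (upperFace α) :=
  (isClosed_face α).inter
    (isClosed_le continuous_const (Complex.continuous_im.comp continuous_fst))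

theorem zero_mem_giraud {x : ℝ} (hx : x ^ 2 = 1) : ((0, (x : ℂ)) : ℂ × ℂ) ∈ giraud α ε := by
  refine ⟨⟨?_, ?_⟩, ?_⟩
  · simp [Complex.normSq_apply, ← sq, hx]
  · simp [bisEq]
  · simp

theorem neg_one_mem_giraud : ((0, -1) : ℂ × ℂ) ∈ giraud α ε := by
  have := zero_mem_giraud (α := α) (ε := ε) (x := -1) (by norm_num)
  rwa [Complex.ofReal_neg, Complex.ofReal_one] at this

theorem one_mem_giraud : ((0, 1) : ℂ × ℂ) ∈ giraud α ε := by
  have := zero_mem_giraud (α := α) (ε := ε) (x := 1) (by norm_num)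
  rwa [Complex.ofReal_one] at this

theorem lowerFace_inter_upperFace (hs : 0 < Real.sin α) (hc : 0 < Real.cos α) :
    lowerFace α ∩ upperFace α = {(0, -1), (0, 1)} := by
  have h1 : ((0, -1) : ℂ × ℂ) ∈ face α :=
    giraud_subset_face (ε := 1) (by norm_num) hc neg_one_mem_giraud
  have h2 : ((0, 1) : ℂ × ℂ) ∈ face α :=
    giraud_subset_face (ε := 1) (by norm_num) hc one_mem_giraud
  refine Set.Subset.antisymm ?_ (Set.pair_subset ⟨⟨h1, le_refl _⟩, ⟨h1, le_refl _⟩⟩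
    ⟨⟨h2, le_refl _⟩, ⟨h2, le_refl _⟩⟩)
  rintro p ⟨⟨h3, h4⟩, ⟨-, h5⟩⟩
  exact eq_of_mem_face_of_im_eq_zero hs hc h3 (le_antisymm h4 h5)

theorem upperFace_diff (hs : 0 < Real.sin α) (hc : 0 < Real.cos α) :
    upperFace α \ {(0, -1), (0, 1)} = openUpperFace α := by
  ext p
  constructor
  · rintro ⟨⟨h1, h2⟩, h3⟩
    refine ⟨h1, lt_of_le_of_ne h2 fun h => h3 ?_⟩
    exact eq_of_mem_face_of_im_eq_zero hs hc h1 h.symm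
  · rintro ⟨h1, h2⟩
    refine ⟨⟨h1, h2.le⟩, ?_⟩
    rintro (rfl | rfl) <;> exact lt_irrefl _ h2

theorem lowerFace_inter_giraud (hs : 0 < Real.sin α) (hc : 0 < Real.cos α) (hε : ε ^ 2 = 1) :
    lowerFace α ∩ giraud α ε = halfArc α ε (-1) := by
  ext p
  rw [mem_halfArc hs hc hε (by norm_num)]
  constructor
  · rintro ⟨⟨h1, h2⟩, h3⟩
    exact ⟨h3, by linarith⟩
  · rintro ⟨h1, h2⟩
    exact ⟨⟨giraud_subset_face hε hc h1, by linarith⟩, h1⟩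

theorem upperFace_inter_giraud (hs : 0 < Real.sin α) (hc : 0 < Real.cos α) (hε : ε ^ 2 = 1) :
    upperFace α ∩ giraud α ε = halfArc α ε 1 := by
  ext p
  rw [mem_halfArc hs hc hε (by norm_num)]
  constructor
  · rintro ⟨⟨h1, h2⟩, h3⟩
    exact ⟨h3, by linarith⟩
  · rintro ⟨h1, h2⟩
    exact ⟨⟨giraud_subset_face hε hc h1, by linarith⟩, h1⟩

theorem mem_strictCone_of_not_mem_giraud {p : ℂ × ℂ} (hp : p ∈ face α) (h1 : p ∉ giraud α 1)
    (h2 : p ∉ giraud α (-1)) : p ∈ strictCone α := by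
  refine lt_of_le_of_ne hp.2 fun h => ?_
  rcases le_total 0 p.1.re with h' | h'
  · rw [abs_of_nonneg h'] at h
    exact h1 ⟨hp.1, by linarith⟩
  · rw [abs_of_nonpos h'] at h
    exact h2 ⟨hp.1, by linarith⟩

/-- The boundary of a piece of the face which is cut out by an open condition near the points off
the Giraud circles. -/
theorem inter_closure_diff (hs : 0 < Real.sin α) (hc : 0 < Real.cos α) {A O : Set (ℂ × ℂ)}
    (hA : A ⊆ face α) (hO : IsOpen O) (hOA : face α ∩ O ⊆ A)
    (hAO : ∀ p ∈ A, p.1.im ≠ 0 → p ∈ O) :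
    A ∩ closure (spinal α \ A) = A ∩ giraud α 1 ∪ A ∩ giraud α (-1) := by
  rw [← Set.inter_union_distrib_left]
  refine Set.Subset.antisymm ?_ (Set.inter_subset_inter_right _ ?_)
  · rintro p ⟨h1, h2⟩
    refine ⟨h1, ?_⟩
    by_contra h3
    rw [Set.mem_union, not_or] at h3
    have h4 := mem_strictCone_of_not_mem_giraud (hA h1) h3.1 h3.2
    have him : p.1.im ≠ 0 := by
      intro him
      rcases eq_of_mem_face_of_im_eq_zero hs hc (hA h1) him with rfl | rfl
      · exact h3.1 neg_one_mem_giraud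
      · exact h3.1 one_mem_giraud
    -- Off the Giraud circles a point of the piece has a neighbourhood whose spinal points all lie
    -- in the piece, so the complement does not accumulate there.
    obtain ⟨q, ⟨k1, k2⟩, k3, k4⟩ := mem_closure_iff.mp h2 _ (isOpen_strictCone.inter hO)
      ⟨h4, hAO p h1 him⟩
    exact k4 (hOA ⟨⟨k3, le_of_lt k1⟩, k2⟩)
  · have h : closure (spinal α \ face α) ⊆ closure (spinal α \ A) :=
      closure_mono (Set.sdiff_subset_sdiff_right hA)
    exact Set.union_subset ((giraud_subset_closure hs hc (by norm_num)).trans h)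
      ((giraud_subset_closure hs hc (by norm_num)).trans h)

theorem lowerFace_boundary (hs : 0 < Real.sin α) (hc : 0 < Real.cos α) :
    lowerFace α ∩ closure (spinal α \ lowerFace α) =
      halfArc α 1 (-1) ∪ halfArc α (-1) (-1) := by
  rw [inter_closure_diff hs hc (A := lowerFace α) (O := {p | p.1.im < 0}) (fun p hp => hp.1)
    (isOpen_lt (Complex.continuous_im.comp continuous_fst) continuous_const)
    (fun p hp => ⟨hp.1, le_of_lt hp.2⟩) (fun p hp h => lt_of_le_of_ne hp.2 h),
    lowerFace_inter_giraud hs hc (by norm_num), lowerFace_inter_giraud hs hc (by norm_num)]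

theorem upperFace_boundary (hs : 0 < Real.sin α) (hc : 0 < Real.cos α) :
    upperFace α ∩ closure (spinal α \ upperFace α) = halfArc α 1 1 ∪ halfArc α (-1) 1 := by
  rw [inter_closure_diff hs hc (A := upperFace α) (O := {p | 0 < p.1.im}) (fun p hp => hp.1)
    (isOpen_lt continuous_const (Complex.continuous_im.comp continuous_fst))
    (fun p hp => ⟨hp.1, le_of_lt hp.2⟩) (fun p hp h => lt_of_le_of_ne hp.2 h.symm),
    upperFace_inter_giraud hs hc (by norm_num), upperFace_inter_giraud hs hc (by norm_num)]

end

/-! ### A convex planar region -/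

/-- The function whose superlevel sets are the Giraud disks, in angular coordinates. -/
def cosProd (θ : ℂ) : ℝ :=
  Real.cos (θ.re / 2) * Real.cos (θ.im / 2) * Real.cos ((θ.re - θ.im) / 2)

/-- An open hexagon in the plane of angular coordinates. -/
def hexagon : Set ℂ := {θ | |θ.re| < Real.pi ∧ |θ.im| < Real.pi ∧ |θ.re - θ.im| < Real.pi}

/-- The angular coordinates of a Giraud disk. -/
def angleDisk (k : ℝ) : Set ℂ := {θ | θ ∈ hexagon ∧ k ≤ cosProd θ}

/-- A concave increasing function of a concave positive function is concave. -/
theorem concaveOn_log_cos :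
    ConcaveOn ℝ (Set.Ioo (-(Real.pi / 2)) (Real.pi / 2)) fun t => Real.log (Real.cos t) := by
  refine ⟨convex_Ioo _ _, fun x hx y hy a b ha hb hab => ?_⟩
  have h1 := Real.cos_pos_of_mem_Ioo hx
  have h2 := Real.cos_pos_of_mem_Ioo hy
  have h3 := strictConcaveOn_log_Ioi.concaveOn.2 (x := Real.cos x) h1 (y := Real.cos y) h2 ha hb hab
  have h4 := strictConcaveOn_cos_Icc.concaveOn.2 (Set.Ioo_subset_Icc_self hx)
    (Set.Ioo_subset_Icc_self hy) ha hb hab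
  refine h3.trans (Real.log_le_log ?_ h4)
  exact (convex_Ioi (0 : ℝ)) h1 h2 ha hb hab

theorem half_mem_Ioo {x : ℝ} (h : |x| < Real.pi) :
    x / 2 ∈ Set.Ioo (-(Real.pi / 2)) (Real.pi / 2) := by
  rw [abs_lt] at h
  constructor <;> linarith [h.1, h.2]

theorem convex_hexagon : Convex ℝ hexagon := by
  intro x hx y hy a b ha hb hab
  have key : ∀ s t : ℝ, |s| < Real.pi → |t| < Real.pi → |a * s + b * t| < Real.pi := by
    intro s t h1 h2
    have := (convex_Ioo (-Real.pi) Real.pi) (abs_lt.mp h1) (abs_lt.mp h2) ha hb hab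
    exact abs_lt.mpr this
  refine ⟨?_, ?_, ?_⟩
  · simpa using key _ _ hx.1 hy.1
  · simpa using key _ _ hx.2.1 hy.2.1
  · have := key _ _ hx.2.2 hy.2.2
    rw [show a * (x.re - x.im) + b * (y.re - y.im) =
      (a • x + b • y).re - (a • x + b • y).im by simp; ring] at this
    exact this

theorem log_cosProd {θ : ℂ} (h : θ ∈ hexagon) : Real.log (cosProd θ) =
    Real.log (Real.cos (θ.re / 2)) + Real.log (Real.cos (θ.im / 2)) +
      Real.log (Real.cos ((θ.re - θ.im) / 2)) := by
  have h1 := Real.cos_pos_of_mem_Ioo (half_mem_Ioo h.1)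
  have h2 := Real.cos_pos_of_mem_Ioo (half_mem_Ioo h.2.1)
  have h3 := Real.cos_pos_of_mem_Ioo (half_mem_Ioo h.2.2)
  rw [cosProd, Real.log_mul (mul_pos h1 h2).ne' h3.ne', Real.log_mul h1.ne' h2.ne']

theorem cosProd_pos {θ : ℂ} (h : θ ∈ hexagon) : 0 < cosProd θ :=
  mul_pos (mul_pos (Real.cos_pos_of_mem_Ioo (half_mem_Ioo h.1))
    (Real.cos_pos_of_mem_Ioo (half_mem_Ioo h.2.1))) (Real.cos_pos_of_mem_Ioo (half_mem_Ioo h.2.2))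

theorem concaveOn_log_cosProd : ConcaveOn ℝ hexagon fun θ => Real.log (cosProd θ) := by
  refine ⟨convex_hexagon, fun x hx y hy a b ha hb hab => ?_⟩
  have h1 := concaveOn_log_cos.2 (half_mem_Ioo hx.1) (half_mem_Ioo hy.1) ha hb hab
  have h2 := concaveOn_log_cos.2 (half_mem_Ioo hx.2.1) (half_mem_Ioo hy.2.1) ha hb hab
  have h3 := concaveOn_log_cos.2 (half_mem_Ioo hx.2.2) (half_mem_Ioo hy.2.2) ha hb hab
  simp only [smul_eq_mul] at h1 h2 h3 ⊢
  rw [log_cosProd hx, log_cosProd hy, log_cosProd (convex_hexagon hx hy ha hb hab)]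
  have e1 : (a • x + b • y).re / 2 = a * (x.re / 2) + b * (y.re / 2) := by simp; ring
  have e2 : (a • x + b • y).im / 2 = a * (x.im / 2) + b * (y.im / 2) := by simp; ring
  have e3 : ((a • x + b • y).re - (a • x + b • y).im) / 2 =
      a * ((x.re - x.im) / 2) + b * ((y.re - y.im) / 2) := by simp; ring
  rw [e1, e2, e3]
  linarith

section

variable {k : ℝ}

theorem angleDisk_eq (hk0 : 0 < k) :
    angleDisk k = {θ | θ ∈ hexagon ∧ Real.log k ≤ Real.log (cosProd θ)} := by
  ext θ
  refine and_congr_right fun h => ?_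
  rw [Real.log_le_log_iff hk0 (cosProd_pos h)]

theorem convex_angleDisk (hk0 : 0 < k) : Convex ℝ (angleDisk k) := by
  rw [angleDisk_eq hk0]
  exact concaveOn_log_cosProd.convex_ge _

theorem continuous_cosProd : Continuous cosProd := by
  unfold cosProd
  fun_prop

theorem isOpen_hexagon : IsOpen hexagon := by
  refine (isOpen_lt Complex.continuous_re.abs continuous_const).inter
    ((isOpen_lt Complex.continuous_im.abs continuous_const).inter
      (isOpen_lt (Complex.continuous_re.sub Complex.continuous_im).abs continuous_const))

theorem cos_half_eq_zero {x : ℝ} (h : |x| = Real.pi) : Real.cos (x / 2) = 0 := by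
  rw [← Real.cos_abs, abs_div, h, abs_two, Real.cos_pi_div_two]

/-- The hexagon is open, but on its boundary one of the three cosines vanishes. Since `k > 0`,
replacing it by the closed hexagon adds no points. -/
theorem isClosed_angleDisk (hk0 : 0 < k) : IsClosed (angleDisk k) := by
  have h : angleDisk k = {θ : ℂ | |θ.re| ≤ Real.pi} ∩ ({θ : ℂ | |θ.im| ≤ Real.pi} ∩
      ({θ : ℂ | |θ.re - θ.im| ≤ Real.pi} ∩ {θ | k ≤ cosProd θ})) := by
    ext θ
    constructor
    · rintro ⟨⟨h1, h2, h3⟩, h4⟩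
      exact ⟨h1.le, h2.le, h3.le, h4⟩
    · rintro ⟨h1, h2, h3, h4⟩
      have h5 : cosProd θ ≠ 0 := (hk0.trans_le h4).ne'
      refine ⟨⟨lt_of_le_of_ne h1 fun h => h5 ?_, lt_of_le_of_ne h2 fun h => h5 ?_,
        lt_of_le_of_ne h3 fun h => h5 ?_⟩, h4⟩ <;> simp [cosProd, cos_half_eq_zero h]
  rw [h]
  exact (isClosed_le Complex.continuous_re.abs continuous_const).inter
    ((isClosed_le Complex.continuous_im.abs continuous_const).inter
      ((isClosed_le (Complex.continuous_re.sub Complex.continuous_im).abs continuous_const).inter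
        (isClosed_le continuous_const continuous_cosProd)))

theorem zero_mem_hexagon : (0 : ℂ) ∈ hexagon := by
  simp [hexagon, Real.pi_pos]

/-- A concave function that takes the value `log k < 0` at `θ` and `0` at the centre falls below
`log k` just beyond `θ` on the ray from the centre. The level set therefore contains no interior
point. -/
theorem interior_angleDisk (hk0 : 0 < k) (hk1 : k < 1) :
    interior (angleDisk k) = {θ | θ ∈ hexagon ∧ k < cosProd θ} := by
  refine Set.Subset.antisymm ?_ (interior_maximal (fun θ h => ⟨h.1, le_of_lt h.2⟩)
    (isOpen_hexagon.inter (isOpen_lt continuous_const continuous_cosProd)))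
  intro θ hθ
  have h1 := interior_subset hθ
  refine ⟨h1.1, lt_of_le_of_ne h1.2 fun he => ?_⟩
  have hcont : Continuous fun t : ℝ => t • θ := by fun_prop
  have h2 : ∀ᶠ t in nhds (1 : ℝ), t • θ ∈ angleDisk k := by
    refine (hcont.tendsto 1).eventually (mem_interior_iff_mem_nhds.mp ?_)
    rwa [one_smul]
  have h3 : ∃ᶠ t in nhds (1 : ℝ), 1 < t :=
    (frequently_gt_nhds (1 : ℝ))
  obtain ⟨t, h4, h5⟩ := (h3.and_eventually h2).exists
  have ht : 0 < t := by linarith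
  -- Here `θ` is the convex combination of `tθ` and `0` with weight `t⁻¹ < 1`. Concavity gives `t⁻¹
  -- log k ≤ log k`, which contradicts `log k < 0`.
  have h6 := concaveOn_log_cosProd.2 h5.1 zero_mem_hexagon (inv_nonneg.mpr ht.le)
    (sub_nonneg.mpr (inv_le_one_of_one_le₀ h4.le)) (add_sub_cancel _ _)
  beta_reduce at h6
  rw [smul_smul, inv_mul_cancel₀ ht.ne', one_smul, smul_zero, add_zero, ← he] at h6
  have h7 : cosProd 0 = 1 := by simp [cosProd]
  have h8 := Real.log_le_log hk0 h5.2
  have h9 := Real.log_neg hk0 hk1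
  rw [h7, Real.log_one, smul_zero, add_zero, smul_eq_mul] at h6
  have h10 : t⁻¹ < 1 := inv_lt_one_of_one_lt₀ h4
  have h11 : 0 < t⁻¹ := inv_pos.mpr ht
  nlinarith [mul_le_mul_of_nonneg_left h8 h11.le]

theorem isBounded_angleDisk : Bornology.IsBounded (angleDisk k) := by
  refine (Metric.isBounded_closedBall (x := (0 : ℂ)) (r := Real.pi + Real.pi)).subset ?_
  rintro θ ⟨⟨h1, h2, -⟩, -⟩
  rw [mem_closedBall_zero_iff]
  exact (Complex.norm_le_abs_re_add_abs_im θ).trans (add_le_add h1.le h2.le)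

/-- A convex disk of angular coordinates is parametrized by the closed unit disk. -/
theorem exists_homeomorph_angleDisk (hk0 : 0 < k) (hk1 : k < 1) : ∃ h : ℂ ≃ₜ ℂ,
    h '' Metric.closedBall 0 1 = angleDisk k ∧
    h '' Metric.ball 0 1 = {θ | θ ∈ hexagon ∧ k < cosProd θ} ∧
    h '' Metric.sphere 0 1 = {θ | θ ∈ hexagon ∧ cosProd θ = k} := by
  have hint := interior_angleDisk hk0 hk1
  obtain ⟨h, h1, h2, h3⟩ := exists_homeomorph_image_interior_closure_frontier_eq_unitBall
    (convex_angleDisk hk0) (by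
      rw [hint]
      exact ⟨0, zero_mem_hexagon, by simpa [cosProd] using hk1⟩) (isBounded_angleDisk (k := k))
  have hsymm : ∀ s t : Set ℂ, h '' s = t → h.symm '' t = s := by
    rintro s _ rfl
    exact h.toEquiv.symm_image_image s
  refine ⟨h.symm, ?_, ?_, ?_⟩
  · rw [hsymm _ _ h2, (isClosed_angleDisk hk0).closure_eq]
  · rw [hsymm _ _ h1, hint]
  · rw [hsymm _ _ h3, (isClosed_angleDisk hk0).frontier_eq, hint]
    ext θ
    constructor
    · rintro ⟨⟨k1, k2⟩, k3⟩
      exact ⟨k1, le_antisymm (not_lt.mp fun h => k3 ⟨k1, h⟩) k2⟩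
    · rintro ⟨k1, k2⟩
      exact ⟨⟨k1, k2.ge⟩, fun h => h.2.ne' k2⟩

end

/-! ### Giraud disks of triples with a symmetric Gram matrix -/

theorem herm_swap (z w : V3) : star (herm z w) = herm w z := by
  simp only [herm, star_add, star_mul', star_star]
  ring

theorem norm_herm_swap (z w : V3) : ‖herm z w‖ = ‖herm w z‖ := by
  rw [← herm_swap, norm_star]

theorem herm_sum_smul (z : V3) (P : Fin 3 → V3) (c : Fin 3 → ℂ) :
    herm z (∑ i, c i • P i) = ∑ i, c i * herm z (P i) := by
  simp only [Fin.sum_univ_three, herm, Pi.add_apply, Pi.smul_apply, smul_eq_mul]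
  ring

/-- The Gram matrix of the triple `P` has diagonal entries `4x - 3/2` and all other entries
`-3/2`. -/
def HasGram (P : Fin 3 → V3) (x : ℝ) : Prop :=
  ∀ i j, herm (P i) (P j) = 4 * x * (if i = j then 1 else 0) - 3 / 2

section

variable {P : Fin 3 → V3} {x : ℝ}

theorem HasGram.herm_sum (hP : HasGram P x) (c : Fin 3 → ℂ) (j : Fin 3) :
    herm (P j) (∑ i, c i • P i) = 4 * x * c j - 3 / 2 * (c 0 + c 1 + c 2) := by
  rw [herm_sum_smul]
  simp only [hP j, Fin.sum_univ_three]
  fin_cases j <;> simp <;> ring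

/-- The Gram matrix is `4x I - (3/2) J`, with `J` the all-ones matrix; its eigenvalues `4x` and `4x
- 9/2` are nonzero for `0 < x < 1`. -/
theorem HasGram.linearIndependent (hP : HasGram P x) (h0 : 0 < x) (h1 : x < 1) :
    LinearIndependent ℂ P := by
  have hx : (x : ℂ) ≠ 0 := by exact_mod_cast h0.ne'
  have hx' : (8 * x - 9 : ℂ) ≠ 0 := by
    have : (8 * x - 9 : ℝ) ≠ 0 := by linarith
    exact_mod_cast this
  rw [Fintype.linearIndependent_iff]
  intro c hc
  have h : ∀ j, 4 * x * c j - 3 / 2 * (c 0 + c 1 + c 2) = 0 := by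
    intro j
    rw [← hP.herm_sum, hc]
    simp [herm]
  have hs : c 0 + c 1 + c 2 = 0 := by
    have : (8 * x - 9 : ℂ) * (c 0 + c 1 + c 2) = 0 := by
      linear_combination 2 * h 0 + 2 * h 1 + 2 * h 2
    exact (mul_eq_zero_iff_left hx').mp this
  intro j
  have h2 := h j
  rw [hs, mul_zero, sub_zero] at h2
  exact (mul_eq_zero_iff_left (by simpa using hx)).mp h2

/-- The coefficients of the vector with prescribed products with the triple. -/
def dualCoef (x : ℝ) (a : Fin 3 → ℂ) (i : Fin 3) : ℂ :=
  (a i + 3 / (8 * x - 9) * (a 0 + a 1 + a 2)) / (4 * x)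

/-- The vector with prescribed products with the triple. -/
def dualVec (P : Fin 3 → V3) (x : ℝ) (a : Fin 3 → ℂ) : V3 := ∑ i, dualCoef x a i • P i

/-- The coefficients come from the inverse matrix: `(4x I - (3/2) J)⁻¹ = (I + 3/(8x - 9) J) / (4x)`.
-/
theorem HasGram.herm_dualVec (hP : HasGram P x) (h0 : 0 < x) (h1 : x < 1) (a : Fin 3 → ℂ)
    (j : Fin 3) : herm (P j) (dualVec P x a) = a j := by
  have hx : (x : ℂ) ≠ 0 := by exact_mod_cast h0.ne'
  have hx' : (8 * x - 9 : ℂ) ≠ 0 := by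
    have : (8 * x - 9 : ℝ) ≠ 0 := by linarith
    exact_mod_cast this
  rw [dualVec, hP.herm_sum]
  simp only [dualCoef]
  -- Naming the quotient keeps `field_simp` from clearing the denominator `8x - 9`; only the
  -- relation `σ (8x - 9) = 3` is used.
  obtain ⟨σ, hσ⟩ : ∃ σ : ℂ, σ = 3 / (8 * x - 9) := ⟨_, rfl⟩
  have hσ' : σ * (8 * x - 9) = 3 := by rw [hσ, div_mul_cancel₀ _ hx']
  rw [← hσ]
  field_simp
  linear_combination (a 0 + a 1 + a 2) * hσ'

theorem HasGram.eq_dualVec (hP : HasGram P x) (h0 : 0 < x) (h1 : x < 1) (z : V3) :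
    z = dualVec P x fun j => herm (P j) z := by
  have hx : (x : ℂ) ≠ 0 := by exact_mod_cast h0.ne'
  have hx' : (8 * x - 9 : ℂ) ≠ 0 := by
    have : (8 * x - 9 : ℝ) ≠ 0 := by linarith
    exact_mod_cast this
  have hspan := (hP.linearIndependent h0 h1).span_eq_top_of_card_eq_finrank (by simp)
  have hz : z ∈ Submodule.span ℂ (Set.range P) := hspan ▸ Submodule.mem_top
  obtain ⟨c, rfl⟩ := (Submodule.mem_span_range_iff_exists_fun ℂ).mp hz
  rw [dualVec]
  refine Finset.sum_congr rfl fun i _ => ?_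
  congr 1
  simp only [dualCoef, hP.herm_sum]
  obtain ⟨σ, hσ⟩ : ∃ σ : ℂ, σ = 3 / (8 * x - 9) := ⟨_, rfl⟩
  have hσ' : σ * (8 * x - 9) = 3 := by rw [hσ, div_mul_cancel₀ _ hx']
  rw [← hσ]
  field_simp
  linear_combination -(c 0 + c 1 + c 2) * hσ'

theorem HasGram.herm_dualVec_self (hP : HasGram P x) (h0 : 0 < x) (h1 : x < 1)
    (a : Fin 3 → ℂ) : (herm (dualVec P x a) (dualVec P x a)).re =
      (Complex.normSq (a 0) + Complex.normSq (a 1) + Complex.normSq (a 2) +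
        3 / (8 * x - 9) * Complex.normSq (a 0 + a 1 + a 2)) / (4 * x) := by
  have h : herm (dualVec P x a) (dualVec P x a) =
      ((Complex.normSq (a 0) + Complex.normSq (a 1) + Complex.normSq (a 2) +
        3 / (8 * x - 9) * Complex.normSq (a 0 + a 1 + a 2)) / (4 * x) : ℝ) := by
    refine (herm_sum_smul (dualVec P x a) P (dualCoef x a)).trans ?_
    simp only [← herm_swap (P _), hP.herm_dualVec h0 h1, Fin.sum_univ_three, dualCoef]
    push_cast
    simp only [← Complex.mul_conj, map_add, starRingEnd_apply]
    ring
  rw [h, Complex.ofReal_re]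

theorem HasGram.dualVec_ne_zero (hP : HasGram P x) (h0 : 0 < x) (h1 : x < 1) {a : Fin 3 → ℂ}
    (ha : a 2 ≠ 0) : dualVec P x a ≠ 0 := by
  intro h
  have := hP.herm_dualVec h0 h1 a 2
  rw [h] at this
  exact ha (this.symm.trans (by simp [herm]))

/-- The coordinates of a point of a Giraud torus. -/
def torusCoord (θ : ℂ) : Fin 3 → ℂ :=
  ![Complex.exp (θ.re * Complex.I), Complex.exp (θ.im * Complex.I), 1]

theorem normSq_exp_mul_I (t : ℝ) : Complex.normSq (Complex.exp (t * Complex.I)) = 1 := by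
  rw [Complex.normSq_eq_norm_sq, Complex.norm_exp_ofReal_mul_I, one_pow]

/-- In half angles, `|1 + e^{is} + e^{it}|² = 1 + 8 cos(s/2) cos(t/2) cos((s-t)/2)`. This brings in
the product of cosines whose logarithm is concave. -/
theorem normSq_sum_torusCoord (θ : ℂ) : Complex.normSq (torusCoord θ 0 + torusCoord θ 1 +
    torusCoord θ 2) = 1 + 8 * cosProd θ := by
  have h1 : θ.re = 2 * (θ.re / 2) := by ring
  have h2 : θ.im = 2 * (θ.im / 2) := by ring
  have h3 : (θ.re - θ.im) / 2 = θ.re / 2 - θ.im / 2 := by ring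
  simp only [torusCoord, Matrix.cons_val_zero, Matrix.cons_val_one, Matrix.cons_val, cosProd]
  rw [Complex.normSq_apply]
  simp only [Complex.add_re, Complex.add_im, Complex.exp_ofReal_mul_I_re,
    Complex.exp_ofReal_mul_I_im, Complex.one_re, Complex.one_im]
  rw [h3, Real.cos_sub]
  generalize θ.re / 2 = A at *
  generalize θ.im / 2 = B at *
  rw [h1, h2, Real.cos_two_mul, Real.cos_two_mul, Real.sin_two_mul, Real.sin_two_mul]
  have hA := Real.sin_sq_add_cos_sq A
  have hB := Real.sin_sq_add_cos_sq B
  generalize Real.cos A = a at *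
  generalize Real.cos B = b at *
  generalize Real.sin A = s at *
  generalize Real.sin B = t at *
  linear_combination 4 * a ^ 2 * hA + 4 * b ^ 2 * hB

theorem continuous_torusCoord : Continuous torusCoord := by
  refine continuous_pi fun i => ?_
  fin_cases i
  · change Continuous fun θ : ℂ => Complex.exp (θ.re * Complex.I)
    fun_prop
  · change Continuous fun θ : ℂ => Complex.exp (θ.im * Complex.I)
    fun_prop
  · exact continuous_const

/-- The point of a Giraud torus with given angular coordinates. -/
def torusPt (hP : HasGram P x) (h0 : 0 < x) (h1 : x < 1) (θ : ℂ) : CP2 :=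
  Projectivization.mk ℂ (dualVec P x (torusCoord θ))
    (hP.dualVec_ne_zero h0 h1 one_ne_zero)

theorem continuous_torusPt (hP : HasGram P x) (h0 : 0 < x) (h1 : x < 1) :
    Continuous (torusPt hP h0 h1) := by
  have hc : ∀ i, Continuous fun θ => torusCoord θ i := fun i =>
    (continuous_apply i).comp continuous_torusCoord
  have h : Continuous fun θ : ℂ => dualVec P x (torusCoord θ) := by
    simp only [dualVec, dualCoef, Fin.sum_univ_three]
    have h' : ∀ i : Fin 3, Continuous fun θ : ℂ =>
        ((torusCoord θ i + 3 / (8 * (x : ℂ) - 9) *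
          (torusCoord θ 0 + torusCoord θ 1 + torusCoord θ 2)) / (4 * x)) • P i := fun i =>
      (((hc i).add (continuous_const.mul (((hc 0).add (hc 1)).add (hc 2)))).div_const _).smul
        continuous_const
    exact ((h' 0).add (h' 1)).add (h' 2)
  exact continuous_mk.comp (h.subtype_mk fun θ => hP.dualVec_ne_zero h0 h1 one_ne_zero)

/-- The leading factor is positive for `0 < x < 1`. So the hyperbolic plane is `cosProd > 1 - x` on
the torus, and its boundary is the level set. -/
theorem re_herm_torus (hP : HasGram P x) (h0 : 0 < x) (h1 : x < 1) (θ : ℂ) :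
    (herm (dualVec P x (torusCoord θ)) (dualVec P x (torusCoord θ))).re =
      6 / (x * (9 - 8 * x)) * ((1 - x) - cosProd θ) := by
  rw [hP.herm_dualVec_self h0 h1, normSq_sum_torusCoord]
  have e0 : Complex.normSq (torusCoord θ 0) = 1 := normSq_exp_mul_I _
  have e1 : Complex.normSq (torusCoord θ 1) = 1 := normSq_exp_mul_I _
  have e2 : Complex.normSq (torusCoord θ 2) = 1 := Complex.normSq_one
  have h2 : 8 * x - 9 ≠ 0 := by linarith
  have h3 : 9 - 8 * x ≠ 0 := by linarith
  rw [e0, e1, e2]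
  field_simp
  ring

theorem torusPt_mem (hP : HasGram P x) (h0 : 0 < x) (h1 : x < 1) (θ : ℂ) :
    torusPt hP h0 h1 θ ∈ extor (P 0) (P 1) ∩ extor (P 0) (P 2) := by
  have e0 : ‖torusCoord θ 0‖ = 1 := Complex.norm_exp_ofReal_mul_I _
  have e1 : ‖torusCoord θ 1‖ = 1 := Complex.norm_exp_ofReal_mul_I _
  have e2 : ‖torusCoord θ 2‖ = 1 := norm_one
  constructor
  · rw [extor, Set.mem_ofPred_eq, torusPt, norm_herm_rep_eq_iff, norm_herm_swap,
      norm_herm_swap _ (P 1), hP.herm_dualVec h0 h1, hP.herm_dualVec h0 h1, e0, e1]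
  · rw [extor, Set.mem_ofPred_eq, torusPt, norm_herm_rep_eq_iff, norm_herm_swap,
      norm_herm_swap _ (P 2), hP.herm_dualVec h0 h1, hP.herm_dualVec h0 h1, e0, e2]

/-- The third coordinate is normalized to `1`, so proportional vectors are equal, and angles in
`(-π, π)` are determined by their exponentials. -/
theorem torusPt_injOn (hP : HasGram P x) (h0 : 0 < x) (h1 : x < 1) :
    Set.InjOn (torusPt hP h0 h1) hexagon := by
  intro θ hθ η hη h
  rw [torusPt, torusPt, Projectivization.mk_eq_mk_iff'] at h
  obtain ⟨a, ha⟩ := h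
  have key : ∀ j, torusCoord θ j = a * torusCoord η j := by
    intro j
    rw [← hP.herm_dualVec h0 h1 (torusCoord θ) j, ← ha, ← hP.herm_dualVec h0 h1 (torusCoord η) j]
    simp only [herm, Pi.smul_apply, smul_eq_mul]
    ring
  have ha1 : a = 1 := by
    have := key 2
    simpa [torusCoord] using this.symm
  subst ha1
  have inj : ∀ s t : ℝ, |s| < Real.pi → |t| < Real.pi →
      Complex.exp (s * Complex.I) = Complex.exp (t * Complex.I) → s = t := by
    intro s t hs ht h
    rw [abs_lt] at hs ht
    have := Complex.exp_inj_of_neg_pi_lt_of_le_pi (by simpa using hs.1) (by simpa using hs.2.le)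
      (by simpa using ht.1) (by simpa using ht.2.le) h
    have h2 := mul_right_cancel₀ Complex.I_ne_zero this
    exact_mod_cast h2
  apply Complex.ext
  · exact inj _ _ hθ.1 hη.1 ((key 0).trans (one_mul _))
  · exact inj _ _ hθ.2.1 hη.2.1 ((key 1).trans (one_mul _))

theorem cos_half_nonneg {t : ℝ} (h1 : -Real.pi < t) (h2 : t ≤ Real.pi) : 0 ≤ Real.cos (t / 2) :=
  Real.cos_nonneg_of_mem_Icc ⟨by linarith, by linarith⟩

/-- The three products of an equidistant vector with the triple have a common modulus, nonzero
because the triple is a basis. Dividing by the third leaves two unit complex numbers, whose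
arguments are the angles. -/
theorem exists_torusPt (hP : HasGram P x) (h0 : 0 < x) (h1 : x < 1) {Q : CP2}
    (hQ : Q ∈ bisector (P 0) (P 1) ∩ bisector (P 0) (P 2)) :
    ∃ θ ∈ angleDisk (1 - x), torusPt hP h0 h1 θ = Q := by
  induction Q using Projectivization.ind with
  | h z hz =>
  obtain ⟨⟨k1, k3⟩, k2, -⟩ := hQ
  rw [extor, Set.mem_ofPred_eq, norm_herm_rep_eq_iff, norm_herm_swap, norm_herm_swap _ (P 1)] at k1
  rw [extor, Set.mem_ofPred_eq, norm_herm_rep_eq_iff, norm_herm_swap, norm_herm_swap _ (P 2)] at k2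
  rw [mk_mem_clH2] at k3
  set a : Fin 3 → ℂ := fun j => herm (P j) z with ha
  have hza : z = dualVec P x a := hP.eq_dualVec h0 h1 z
  change ‖a 0‖ = ‖a 1‖ at k1
  change ‖a 0‖ = ‖a 2‖ at k2
  have ha2 : a 2 ≠ 0 := by
    intro h
    rw [h, norm_zero, norm_eq_zero] at k2
    rw [k2, norm_zero, eq_comm, norm_eq_zero] at k1
    refine hz (hza.trans ?_)
    simp [dualVec, dualCoef, Fin.sum_univ_three, h, k1, k2]
  have hn2 : ‖a 2‖ ≠ 0 := norm_ne_zero_iff.mpr ha2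
  have key : ∀ j, ‖a j‖ = ‖a 2‖ →
      Complex.exp ((a j / a 2).arg * Complex.I) = a j / a 2 := by
    intro j hj
    have := Complex.norm_mul_exp_arg_mul_I (a j / a 2)
    rwa [norm_div, hj, div_self hn2, Complex.ofReal_one, one_mul] at this
  set θ : ℂ := ⟨(a 0 / a 2).arg, (a 1 / a 2).arg⟩ with hθ
  have hcoord : torusCoord θ = fun j => (a 2)⁻¹ * a j := by
    ext j
    fin_cases j
    · exact (key 0 k2).trans (by simp; ring)
    · exact (key 1 (k1.symm.trans k2)).trans (by simp; ring)
    · simp [torusCoord, ha2]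
  have hz2 : dualVec P x (torusCoord θ) = (a 2)⁻¹ • z := by
    rw [hcoord]
    conv_rhs => rw [hza]
    simp only [dualVec, Finset.smul_sum, smul_smul]
    refine Finset.sum_congr rfl fun i _ => ?_
    congr 1
    simp only [dualCoef]
    ring
  have hpt : torusPt hP h0 h1 θ = Projectivization.mk ℂ z hz := by
    rw [torusPt, Projectivization.mk_eq_mk_iff']
    exact ⟨_, hz2.symm⟩
  refine ⟨θ, ?_, hpt⟩
  have hle : (1 - x) ≤ cosProd θ := by
    have h2 : torusPt hP h0 h1 θ ∈ clH2 := by rw [hpt, mk_mem_clH2]; exact k3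
    rw [torusPt, mk_mem_clH2, re_herm_torus hP h0 h1] at h2
    have h3 : 0 < 6 / (x * (9 - 8 * x)) := by
      have : 0 < 9 - 8 * x := by linarith
      positivity
    linarith [nonpos_of_mul_nonpos_right h2 h3]
  have hpos : 0 < cosProd θ := by linarith
  have c1 : 0 ≤ Real.cos (θ.re / 2) := cos_half_nonneg (Complex.neg_pi_lt_arg _) (Complex.arg_le_pi _)
  have c2 : 0 ≤ Real.cos (θ.im / 2) := cos_half_nonneg (Complex.neg_pi_lt_arg _) (Complex.arg_le_pi _)
  -- Arguments in `(-π, π]` make the first two cosines nonnegative. The product exceeds `0` because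
  -- `1 - x > 0`, which forces the third factor to be positive and keeps the angles inside the
  -- hexagon.
  have c3 : 0 < Real.cos ((θ.re - θ.im) / 2) := by
    by_contra h
    exact hpos.not_ge (mul_nonpos_of_nonneg_of_nonpos (mul_nonneg c1 c2) (not_lt.mp h))
  have b1 := Complex.neg_pi_lt_arg (a 0 / a 2)
  have b2 := Complex.arg_le_pi (a 0 / a 2)
  have b3 := Complex.neg_pi_lt_arg (a 1 / a 2)
  have b4 := Complex.arg_le_pi (a 1 / a 2)
  have eq_pi : ∀ t : ℝ, -Real.pi < t → t ≤ Real.pi → Real.cos (t / 2) ≠ 0 → |t| < Real.pi := by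
    intro t h1 h2 h3
    refine abs_lt.mpr ⟨h1, lt_of_le_of_ne h2 ?_⟩
    rintro rfl
    exact h3 Real.cos_pi_div_two
  refine ⟨⟨eq_pi _ b1 b2 fun h => hpos.ne' ?_, eq_pi _ b3 b4 fun h => hpos.ne' ?_, ?_⟩, hle⟩
  · change Real.cos (θ.re / 2) = 0 at h
    rw [cosProd, h, zero_mul, zero_mul]
  · change Real.cos (θ.im / 2) = 0 at h
    rw [cosProd, h, mul_zero, zero_mul]
  · by_contra h
    rw [not_lt] at h
    refine c3.not_ge ?_
    rw [← Real.cos_abs, abs_div, abs_two]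
    refine Real.cos_nonpos_of_pi_div_two_le_of_le (by linarith) ?_
    have : |θ.re - θ.im| ≤ 2 * Real.pi := by
      rw [abs_le]
      constructor
      · change _ ≤ (a 0 / a 2).arg - (a 1 / a 2).arg
        linarith
      · change (a 0 / a 2).arg - (a 1 / a 2).arg ≤ _
        linarith
    linarith

theorem HasGram.isGiraudDisk (hP : HasGram P x) (h0 : 0 < x) (h1 : x < 1) :
    IsGiraudDisk (bisector (P 0) (P 1) ∩ bisector (P 0) (P 2)) := by
  refine ⟨⟨P 0, P 1, P 2, ?_, ?_, ?_, rfl⟩, ?_⟩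
  · convert hP.linearIndependent h0 h1 using 1
    ext i
    fin_cases i <;> rfl
  · simp [hP 0 0, hP 1 1]
  · simp [hP 0 0, hP 2 2]
  obtain ⟨h, k1, k2, k3⟩ := exists_homeomorph_angleDisk (k := 1 - x) (by linarith) (by linarith)
  have hsub : ∀ {θ}, θ ∈ Metric.closedBall 0 1 → h θ ∈ angleDisk (1 - x) := fun hθ =>
    k1 ▸ Set.mem_image_of_mem h hθ
  have hcoef : 0 < 6 / (x * (9 - 8 * x)) := by
    have : 0 < 9 - 8 * x := by linarith
    positivity
  have hH2 : ∀ θ, torusPt hP h0 h1 θ ∈ H2 ↔ 1 - x < cosProd θ := by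
    intro θ
    rw [torusPt, mk_mem_H2, re_herm_torus hP h0 h1, ← not_le, mul_nonneg_iff_of_pos_left hcoef,
      sub_nonneg, not_le]
  have hbd : ∀ θ, torusPt hP h0 h1 θ ∈ bdH2 ↔ cosProd θ = 1 - x := by
    intro θ
    rw [torusPt, mk_mem_bdH2, re_herm_torus hP h0 h1, mul_eq_zero_iff_left hcoef.ne', sub_eq_zero,
      eq_comm]
  have hD : ∀ θ, 1 - x ≤ cosProd θ →
      torusPt hP h0 h1 θ ∈ bisector (P 0) (P 1) ∩ bisector (P 0) (P 2) := by
    intro θ hθ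
    have e := torusPt_mem hP h0 h1 θ
    have hcl : torusPt hP h0 h1 θ ∈ clH2 := by
      rw [torusPt, mk_mem_clH2, re_herm_torus hP h0 h1]
      exact mul_nonpos_of_nonneg_of_nonpos hcoef.le (by linarith)
    exact ⟨⟨e.1, hcl⟩, ⟨e.2, hcl⟩⟩
  refine ⟨torusPt hP h0 h1 ∘ h, ((continuous_torusPt hP h0 h1).comp h.continuous).continuousOn,
    ?_, ?_, ?_⟩
  · intro θ hθ η hη heq
    exact h.injective (torusPt_injOn hP h0 h1 (hsub hθ).1 (hsub hη).1 heq)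
  · rw [Set.image_comp, k2]
    ext Q
    constructor
    · rintro ⟨θ, hθ, rfl⟩
      exact ⟨hD θ (le_of_lt hθ.2), (hH2 θ).mpr hθ.2⟩
    · rintro ⟨hQ, hQ'⟩
      obtain ⟨θ, hθ, rfl⟩ := exists_torusPt hP h0 h1 hQ
      exact ⟨θ, ⟨hθ.1, (hH2 θ).mp hQ'⟩, rfl⟩
  · rw [Set.image_comp, k3]
    ext Q
    constructor
    · rintro ⟨θ, hθ, rfl⟩
      exact ⟨hD θ hθ.2.ge, (hbd θ).mpr hθ.2⟩
    · rintro ⟨hQ, hQ'⟩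
      obtain ⟨θ, hθ, rfl⟩ := exists_torusPt hP h0 h1 hQ
      exact ⟨θ, ⟨hθ.1, (hbd θ).mp hQ'⟩, rfl⟩

end

/-! ### The Giraud disks -/

section

variable {α : ℝ}

theorem herm_pU_pU : herm (pU α) (pU α) = 4 * ((Real.cos α ^ 2 : ℝ) : ℂ) - 3 / 2 := by
  have h := ex_mul_ex_neg α
  have e1 := star_ex α
  have h2 := r2_mul_r2
  rw [Complex.ofReal_pow, cos_eq_ex]
  simp [herm, pU, e1, star_r2, -Complex.star_def]
  linear_combination (r2 * r2 / 4 - 2) * h + h2 / 4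

theorem herm_pU_pV : herm (pU α) (pV α) = -(3 / 2) := by
  have h := ex_mul_ex_neg α
  have e1 := star_ex α
  have h2 := r2_mul_r2
  rw [← S_pU, smul_S]
  simp [herm, pU, e1, star_r2, -Complex.star_def]
  linear_combination (r2 * r2 / 4 - r2 * r2 / 2 * ex (-α) ^ 2 - ex α * ex (-α) - 1) * h +
    (1 / 4 - ex (-α) ^ 2 / 2) * h2

/-- An isometry of order three acts transitively on the diagonal entries and on the cyclically
ordered off-diagonal ones. The two orders agree because the given product is real. -/
theorem hasGram_of_cycle {g : Matrix.SpecialLinearGroup (Fin 3) ℂ} (hg : IsIsom g) {p : V3}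
    {x : ℝ} (h3 : g • g • g • p = p) (h0 : herm p p = 4 * x - 3 / 2)
    (h1 : herm p (g • p) = -(3 / 2)) : HasGram ![p, g • p, g • g • p] x := by
  have k1 : herm (g • p) p = -(3 / 2) := by
    rw [← herm_swap, h1]
    simp
  have k2 : herm p (g • g • p) = -(3 / 2) := by
    rw [← hg, h3, k1]
  have k3 : herm (g • g • p) p = -(3 / 2) := by
    rw [← hg, h3, h1]
  intro i j
  fin_cases i <;> fin_cases j <;> simp [hg _ _, h0, h1, k1, k2, k3]

theorem HasGram.comp {P : Fin 3 → V3} {x : ℝ} (hP : HasGram P x)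
    {g : Matrix.SpecialLinearGroup (Fin 3) ℂ} (hg : IsIsom g) (σ : Equiv.Perm (Fin 3)) :
    HasGram (fun i => g • P (σ i)) x := by
  intro i j
  rw [hg, hP]
  simp

theorem hasGram_pU_pV_pW : HasGram ![pU α, pV α, pW α] (Real.cos α ^ 2) := by
  have h := hasGram_of_cycle (isIsom_S α) (S_S_S α (pU α)) herm_pU_pU (by rw [S_pU, herm_pU_pV])
  rwa [S_pU, S_pV] at h

theorem hasGram_pU_pV_vW : HasGram ![pU α, pV α, vW α (-1)] (Real.cos α ^ 2) := by
  have h := hasGram_of_cycle (isIsom_T α) (T_T_T α (pU α)) herm_pU_pU (by rw [T_pU, herm_pU_pV])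
  rwa [T_pU, ← vW_neg_one] at h

theorem isGiraudDisk_Jp_inter_Jm (hs : 0 < Real.sin α) (hc : 0 < Real.cos α) :
    IsGiraudDisk (Jp α 0 ∩ Jm α 0) := by
  have h1 : Real.cos α ^ 2 < 1 := by nlinarith [Real.sin_sq_add_cos_sq α]
  have h := (hasGram_pU_pV_pW (α := α)).isGiraudDisk (by positivity) h1
  rw [Jp, Jm, vV_zero, vW_zero]
  exact h

theorem isGiraudDisk_Jp_inter_Jm' (hs : 0 < Real.sin α) (hc : 0 < Real.cos α) :
    IsGiraudDisk (Jp α 0 ∩ Jm α (-1)) := by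
  have h1 : Real.cos α ^ 2 < 1 := by nlinarith [Real.sin_sq_add_cos_sq α]
  have h := (hasGram_pU_pV_vW (α := α)).isGiraudDisk (by positivity) h1
  rw [Jp, Jm, vV_zero]
  exact h

theorem isGiraudDisk_Jm_inter_Jp (hs : 0 < Real.sin α) (hc : 0 < Real.cos α) :
    IsGiraudDisk (Jm α 0 ∩ Jp α 1) := by
  have h1 : Real.cos α ^ 2 < 1 := by nlinarith [Real.sin_sq_add_cos_sq α]
  -- `S⁻¹` sends `p_U`, `p_V`, `U⁻¹ p_W` to `p_W`, `p_U`, `U p_V`. The transposition puts `p_U`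
  -- first, where the bisectors need it.
  have h := ((hasGram_pU_pV_vW (α := α)).comp (isIsom_S α).inv (Equiv.swap 0 1)).isGiraudDisk
    (by positivity) h1
  have e : Equiv.swap (0 : Fin 3) 1 2 = 2 := by decide
  simp only [Equiv.swap_apply_left, Equiv.swap_apply_right, e, Matrix.cons_val_zero,
    Matrix.cons_val_one, Matrix.cons_val, Sinv_pU, Sinv_pV, Sinv_vW] at h
  rw [Jp, Jm, vW_zero]
  exact h

/-! ### The pieces in the chart -/

theorem image_chart_eq {A : Set (ℂ × ℂ)} {X : Set CP2} (hX : X ⊆ clH2)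
    (h : ∀ p, chart p ∈ X ↔ p ∈ A) : X = chart '' A := by
  ext P
  constructor
  · intro hP
    obtain ⟨p, rfl⟩ := exists_chart_eq (hX hP)
    exact ⟨p, (h p).mp hP, rfl⟩
  · rintro ⟨p, hp, rfl⟩
    exact (h p).mpr hp

theorem Jp_inter_bdH2_eq (hc : 0 < Real.cos α) : Jp α 0 ∩ bdH2 = chart '' spinal α := by
  refine image_chart_eq (fun P hP => hP.1.2) fun p => ?_
  rw [Set.mem_inter_iff, chart_mem_Jp hc, chart_mem_bdH2]
  constructor
  · rintro ⟨⟨h1, -⟩, h2⟩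
    exact ⟨h2, h1⟩
  · rintro ⟨h1, h2⟩
    exact ⟨⟨h2, h1.le⟩, h1⟩

/-- At infinity and on `𝒥_0^+` the last two terms of `norm_sq_pW_sub_pU` vanish, leaving the
equation of `giraud` with sign `1`. The other circle has sign `-1` by `norm_sq_vW_sub_pU`. -/
theorem circ_eq (hc : 0 < Real.cos α) : circ α 0 = chart '' giraud α 1 := by
  refine image_chart_eq (fun P hP => hP.1.1.2) fun p => ?_
  rw [circ, Set.inter_right_comm, Jp_inter_bdH2_eq hc, Set.mem_inter_iff,
    chart_injective.mem_set_image, chart_mem_Jm]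
  refine and_congr_right fun ⟨h1, h2⟩ => ?_
  rw [h2, sub_sub, h1, and_iff_left le_rfl, sub_self, mul_zero, mul_zero, add_zero, sub_zero,
    mul_eq_zero_iff_left (by positivity), sub_eq_zero, one_mul]

theorem circ'_eq (hc : 0 < Real.cos α) : circ' α (-1) = chart '' giraud α (-1) := by
  refine image_chart_eq (fun P hP => hP.1.1.2) fun p => ?_
  rw [circ', Set.inter_assoc, neg_add_cancel, Jp_inter_bdH2_eq hc, Set.inter_comm,
    Set.mem_inter_iff, chart_injective.mem_set_image, chart_mem_Jm']
  refine and_congr_right fun ⟨h1, h2⟩ => ?_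
  rw [h2, sub_sub, h1, and_iff_left le_rfl, sub_self, mul_zero, mul_zero, add_zero, sub_zero,
    mul_eq_zero_iff_left (by positivity), neg_one_mul, eq_neg_iff_add_eq_zero]

theorem Fp_inter_bdH2_eq (hc : 0 < Real.cos α) : Fp α 0 ∩ bdH2 = chart '' face α := by
  refine image_chart_eq (fun P hP => hP.1.1.2) fun p => ?_
  have h := chart_mem_Fp (α := α) p
  rw [Set.mem_inter_iff, h, and_right_comm, ← Set.mem_inter_iff, Jp_inter_bdH2_eq hc,
    chart_injective.mem_set_image]
  refine and_congr_right fun ⟨h1, h2⟩ => ?_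
  rw [h2, sub_sub, h1, sub_self, mul_zero, mul_zero, add_zero, sub_zero, add_zero, sub_zero,
    mul_nonneg_iff_of_pos_left (by positivity), mul_nonneg_iff_of_pos_left (by positivity), abs_le]
  constructor
  · rintro ⟨h3, h4⟩
    constructor <;> linarith
  · rintro ⟨h3, h4⟩
    constructor <;> linarith

theorem ptA_one_eq_arcPt (hs : 0 < Real.sin α) : ptA α 1 = chart (arcPt α 1 1 0) := by
  rw [ptA_one_eq_chart, arcPt_zero hs, one_mul, ex_eq, ← Complex.mk_eq_add_mul_I]

theorem ptB_neg_one_eq_arcPt (hs : 0 < Real.sin α) : ptB α (-1) = chart (arcPt α (-1) 1 0) := by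
  rw [ptB_neg_one_eq_chart, arcPt_zero hs, ex_neg_eq]
  congr 2
  apply Complex.ext <;> simp [-Complex.ofReal_cos, -Complex.ofReal_sin]

/-! ### The three arcs of a Giraud circle -/

section

variable {ε : ℝ}

/-- The arc of a Giraud circle from its point on the real circle to the common point `(0, -1)`. -/
def upperArcNeg (α ε : ℝ) : Set (ℂ × ℂ) := arcPt α ε 1 '' Set.Icc 0 1

/-- The arc of a Giraud circle from its point on the real circle to the common point `(0, 1)`. -/
def upperArcPos (α ε : ℝ) : Set (ℂ × ℂ) := arcPt α ε 1 '' Set.Icc (-1) 0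

theorem upperArcPos_union_upperArcNeg :
    upperArcPos α ε ∪ upperArcNeg α ε = halfArc α ε 1 := by
  rw [upperArcPos, upperArcNeg, halfArc, ← Set.image_union,
    Set.Icc_union_Icc_eq_Icc (by norm_num) (by norm_num)]

theorem pair_eq_arcPt (hs : 0 < Real.sin α) (ε δ : ℝ) :
    ({(0, -1), (0, 1)} : Set (ℂ × ℂ)) = arcPt α ε δ '' {1, -1} := by
  rw [Set.image_pair, arcPt_one hs, arcPt_neg_one hs]

theorem halfArc_inter_halfArc (hs : 0 < Real.sin α) (hc : 0 < Real.cos α) (hε : ε ^ 2 = 1) :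
    halfArc α ε (-1) ∩ halfArc α ε 1 = {(0, -1), (0, 1)} := by
  refine Set.Subset.antisymm ?_ ?_
  · rw [← lowerFace_inter_upperFace hs hc, ← lowerFace_inter_giraud hs hc hε,
      ← upperFace_inter_giraud hs hc hε]
    exact Set.inter_subset_inter Set.inter_subset_left Set.inter_subset_left
  · refine Set.subset_inter ?_ ?_ <;>
    · rw [pair_eq_arcPt hs ε]
      exact Set.image_mono (Set.pair_subset (by norm_num) (by norm_num))

theorem arcPt_image_inter_halfArc (hs : 0 < Real.sin α) (hc : 0 < Real.cos α) (hε : ε ^ 2 = 1)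
    {s : Set ℝ} (h : s ⊆ Set.Icc (-1) 1) :
    arcPt α ε 1 '' s ∩ halfArc α ε (-1) = arcPt α ε 1 '' (s ∩ {1, -1}) := by
  have h1 : arcPt α ε 1 '' s ⊆ halfArc α ε 1 := Set.image_mono h
  rw [← Set.inter_eq_left.mpr h1, Set.inter_assoc, Set.inter_comm (halfArc α ε 1),
    halfArc_inter_halfArc hs hc hε, pair_eq_arcPt hs ε 1,
    Set.image_inter (arcPt_injective hs hc hε)]

theorem upperArcNeg_inter_halfArc (hs : 0 < Real.sin α) (hc : 0 < Real.cos α) (hε : ε ^ 2 = 1) :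
    upperArcNeg α ε ∩ halfArc α ε (-1) = {(0, -1)} := by
  have h : Set.Icc (0 : ℝ) 1 ∩ {1, -1} = {1} := by
    ext x
    simp only [Set.mem_inter_iff, Set.mem_Icc, Set.mem_insert_iff, Set.mem_singleton_iff]
    constructor
    · rintro ⟨⟨h1, -⟩, rfl | rfl⟩
      · rfl
      · norm_num at h1
    · rintro rfl
      norm_num
  rw [upperArcNeg, arcPt_image_inter_halfArc hs hc hε (Set.Icc_subset_Icc (by norm_num) le_rfl), h,
    Set.image_singleton, arcPt_one hs]

theorem upperArcPos_inter_halfArc (hs : 0 < Real.sin α) (hc : 0 < Real.cos α) (hε : ε ^ 2 = 1) :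
    upperArcPos α ε ∩ halfArc α ε (-1) = {(0, 1)} := by
  have h : Set.Icc (-1 : ℝ) 0 ∩ {1, -1} = {-1} := by
    ext x
    simp only [Set.mem_inter_iff, Set.mem_Icc, Set.mem_insert_iff, Set.mem_singleton_iff]
    constructor
    · rintro ⟨⟨-, h1⟩, rfl | rfl⟩
      · norm_num at h1
      · rfl
    · rintro rfl
      norm_num
  rw [upperArcPos, arcPt_image_inter_halfArc hs hc hε (Set.Icc_subset_Icc le_rfl (by norm_num)), h,
    Set.image_singleton, arcPt_neg_one hs]

theorem upperArcPos_inter_upperArcNeg (hs : 0 < Real.sin α) (hc : 0 < Real.cos α)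
    (hε : ε ^ 2 = 1) : upperArcPos α ε ∩ upperArcNeg α ε = {arcPt α ε 1 0} := by
  rw [upperArcPos, upperArcNeg, ← Set.image_inter (arcPt_injective hs hc hε),
    Set.Icc_inter_Icc_eq_singleton (by norm_num) (by norm_num), Set.image_singleton]

theorem isClosed_halfArc (hs : 0 < Real.sin α) (hc : 0 < Real.cos α) (hε : ε ^ 2 = 1) (δ : ℝ) :
    IsClosed (halfArc α ε δ) := isClosed_arcPt_image hs hc hε _ _

theorem isClosed_upperArcNeg (hs : 0 < Real.sin α) (hc : 0 < Real.cos α) (hε : ε ^ 2 = 1) :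
    IsClosed (upperArcNeg α ε) := isClosed_arcPt_image hs hc hε _ _

theorem isClosed_upperArcPos (hs : 0 < Real.sin α) (hc : 0 < Real.cos α) (hε : ε ^ 2 = 1) :
    IsClosed (upperArcPos α ε) := isClosed_arcPt_image hs hc hε _ _

theorem isPreconnected_arcPt_image (hs : 0 < Real.sin α) (hc : 0 < Real.cos α) (hε : ε ^ 2 = 1)
    (δ : ℝ) {s : Set ℝ} (h : s.OrdConnected) : IsPreconnected (arcPt α ε δ '' s) :=
  h.isPreconnected.image _ (continuousOn_arcPt hs hc hε s)

theorem halfArc_diff (hs : 0 < Real.sin α) (hc : 0 < Real.cos α) (hε : ε ^ 2 = 1) (δ : ℝ) :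
    halfArc α ε δ \ {(0, -1), (0, 1)} = arcPt α ε δ '' Set.Ioo (-1) 1 := by
  rw [pair_eq_arcPt hs ε δ, halfArc, ← Set.image_sdiff (arcPt_injective hs hc hε), Set.pair_comm,
    Set.Icc_sdiff_both]

theorem arcPt_zero_notMem (hs : 0 < Real.sin α) (hc : 0 < Real.cos α) (hε : ε ^ 2 = 1) :
    arcPt α ε 1 0 ∉ ({(0, -1), (0, 1)} : Set (ℂ × ℂ)) := by
  rw [pair_eq_arcPt hs ε 1, (arcPt_injective hs hc hε).mem_set_image]
  norm_num

theorem arcPt_zero_notMem_halfArc (hs : 0 < Real.sin α) (hc : 0 < Real.cos α) (hε : ε ^ 2 = 1) :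
    arcPt α ε 1 0 ∉ halfArc α ε (-1) := fun h =>
  arcPt_zero_notMem hs hc hε (halfArc_inter_halfArc hs hc hε ▸ ⟨h, 0, by norm_num, rfl⟩)

theorem pieceAvoiding_giraud_lower (hs : 0 < Real.sin α) (hc : 0 < Real.cos α) (hε : ε ^ 2 = 1) :
    pieceAvoiding (chart '' giraud α ε) (chart (0, -1)) (chart (0, 1)) (chart (arcPt α ε 1 0)) =
      chart '' halfArc α ε (-1) := by
  rw [giraud_eq_union hs hc hε]
  refine pieceAvoiding_chart (isClosed_halfArc hs hc hε _) (isClosed_halfArc hs hc hε _)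
    (halfArc_inter_halfArc hs hc hε) ⟨⟨0, by norm_num, rfl⟩, arcPt_zero_notMem hs hc hε⟩ ?_
  rw [halfArc_diff hs hc hε]
  exact isPreconnected_arcPt_image hs hc hε _ Set.ordConnected_Ioo

/-- The rest of the circle is not a single parametrized arc: it consists of an upper arc and the
whole lower half arc, joined at `(0, 1)`. This common point shows it connected once its ends are
removed. -/
theorem pieceAvoiding_giraud_neg (hs : 0 < Real.sin α) (hc : 0 < Real.cos α) (hε : ε ^ 2 = 1) :
    pieceAvoiding (chart '' giraud α ε) (chart (0, -1)) (chart (arcPt α ε 1 0)) (chart (0, 1)) =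
      chart '' upperArcNeg α ε := by
  have inj := arcPt_injective (α := α) (ε := ε) (δ := 1) hs hc hε
  have inj' := arcPt_injective (α := α) (ε := ε) (δ := -1) hs hc hε
  have hu : giraud α ε = upperArcNeg α ε ∪ (upperArcPos α ε ∪ halfArc α ε (-1)) := by
    rw [giraud_eq_union hs hc hε, ← upperArcPos_union_upperArcNeg, Set.union_comm,
      Set.union_comm (upperArcPos α ε), Set.union_assoc]
  have hd : (upperArcPos α ε ∪ halfArc α ε (-1)) \ {(0, -1), arcPt α ε 1 0} =
      arcPt α ε 1 '' Set.Ico (-1) 0 ∪ arcPt α ε (-1) '' Set.Ico (-1) 1 := by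
    rw [Set.union_sdiff_distrib]
    congr 1
    · rw [← arcPt_one (ε := ε) (δ := 1) hs, ← Set.image_pair, upperArcPos, ← Set.image_sdiff inj]
      congr 1
      ext x
      simp only [Set.mem_sdiff, Set.mem_Icc, Set.mem_insert_iff, Set.mem_singleton_iff, not_or,
        Set.mem_Ico]
      constructor
      · rintro ⟨⟨h1, h2⟩, h3, h4⟩
        exact ⟨h1, lt_of_le_of_ne h2 h4⟩
      · rintro ⟨h1, h2⟩
        exact ⟨⟨h1, h2.le⟩, by linarith, h2.ne⟩
    · rw [Set.pair_comm, Set.insert_eq, ← Set.sdiff_sdiff,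
        Set.sdiff_singleton_eq_self (arcPt_zero_notMem_halfArc hs hc hε),
        ← arcPt_one (ε := ε) (δ := -1) hs, ← Set.image_singleton, halfArc, ← Set.image_sdiff inj',
        Set.Icc_sdiff_right]
  have h01 : ((0, 1) : ℂ × ℂ) ∈ arcPt α ε 1 '' Set.Ico (-1) 0 :=
    ⟨-1, by norm_num, arcPt_neg_one hs⟩
  rw [hu]
  refine pieceAvoiding_chart (isClosed_upperArcNeg hs hc hε)
    ((isClosed_upperArcPos hs hc hε).union (isClosed_halfArc hs hc hε _)) ?_ ?_ ?_
  · rw [Set.inter_union_distrib_left, upperArcNeg_inter_halfArc hs hc hε,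
      Set.inter_comm, upperArcPos_inter_upperArcNeg hs hc hε, Set.union_comm, Set.insert_eq]
  · rw [hd]
    exact Or.inl h01
  · rw [hd]
    exact IsPreconnected.union _ h01 ⟨-1, by norm_num, arcPt_neg_one hs⟩
      (isPreconnected_arcPt_image hs hc hε _ Set.ordConnected_Ico)
      (isPreconnected_arcPt_image hs hc hε _ Set.ordConnected_Ico)

theorem pieceAvoiding_giraud_pos (hs : 0 < Real.sin α) (hc : 0 < Real.cos α) (hε : ε ^ 2 = 1) :
    pieceAvoiding (chart '' giraud α ε) (chart (arcPt α ε 1 0)) (chart (0, 1)) (chart (0, -1)) =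
      chart '' upperArcPos α ε := by
  have inj := arcPt_injective (α := α) (ε := ε) (δ := 1) hs hc hε
  have inj' := arcPt_injective (α := α) (ε := ε) (δ := -1) hs hc hε
  have hu : giraud α ε = upperArcPos α ε ∪ (upperArcNeg α ε ∪ halfArc α ε (-1)) := by
    rw [giraud_eq_union hs hc hε, ← upperArcPos_union_upperArcNeg, Set.union_comm, Set.union_assoc]
  have hd : (upperArcNeg α ε ∪ halfArc α ε (-1)) \ {arcPt α ε 1 0, (0, 1)} =
      arcPt α ε 1 '' Set.Ioc 0 1 ∪ arcPt α ε (-1) '' Set.Ioc (-1) 1 := by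
    rw [Set.union_sdiff_distrib]
    congr 1
    · rw [← arcPt_neg_one (ε := ε) (δ := 1) hs, ← Set.image_pair, upperArcNeg,
        ← Set.image_sdiff inj]
      congr 1
      ext x
      simp only [Set.mem_sdiff, Set.mem_Icc, Set.mem_insert_iff, Set.mem_singleton_iff, not_or,
        Set.mem_Ioc]
      constructor
      · rintro ⟨⟨h1, h2⟩, h3, h4⟩
        exact ⟨lt_of_le_of_ne h1 (Ne.symm h3), h2⟩
      · rintro ⟨h1, h2⟩
        exact ⟨⟨h1.le, h2⟩, h1.ne', by linarith⟩
    · rw [Set.insert_eq, ← Set.sdiff_sdiff,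
        Set.sdiff_singleton_eq_self (arcPt_zero_notMem_halfArc hs hc hε),
        ← arcPt_neg_one (ε := ε) (δ := -1) hs, ← Set.image_singleton, halfArc,
        ← Set.image_sdiff inj', Set.Icc_sdiff_left]
  have h01 : ((0, -1) : ℂ × ℂ) ∈ arcPt α ε 1 '' Set.Ioc 0 1 := ⟨1, by norm_num, arcPt_one hs⟩
  rw [hu]
  refine pieceAvoiding_chart (isClosed_upperArcPos hs hc hε)
    ((isClosed_upperArcNeg hs hc hε).union (isClosed_halfArc hs hc hε _)) ?_ ?_ ?_
  · rw [Set.inter_union_distrib_left, upperArcPos_inter_halfArc hs hc hε,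
      upperArcPos_inter_upperArcNeg hs hc hε, Set.insert_eq]
  · rw [hd]
    exact Or.inl h01
  · rw [hd]
    exact IsPreconnected.union _ h01 ⟨1, by norm_num, arcPt_one hs⟩
      (isPreconnected_arcPt_image hs hc hε _ Set.ordConnected_Ioc)
      (isPreconnected_arcPt_image hs hc hε _ Set.ordConnected_Ioc)

theorem isArc_chart_image (hs : 0 < Real.sin α) (hc : 0 < Real.cos α) (hε : ε ^ 2 = 1) (δ : ℝ)
    {x y : ℝ} (hxy : x < y) : IsArc (chart '' (arcPt α ε δ '' Set.Icc x y))
      (chart (arcPt α ε δ y)) (chart (arcPt α ε δ x)) := by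
  -- The parameter is reversed because `e = 1` corresponds to `p_A` and `e = -1` to `p_B`.
  have h : (fun t : ℝ => y - (y - x) * t) '' Set.Icc 0 1 = Set.Icc x y := by
    rw [← Set.image_image (fun t : ℝ => y - t) (fun t : ℝ => (y - x) * t),
      Set.image_mul_left_Icc (sub_nonneg.mpr hxy.le) zero_le_one, Set.image_const_sub_Icc]
    simp
  have h2 : Continuous fun t : ℝ => y - (y - x) * t := by fun_prop
  refine ⟨fun t => chart (arcPt α ε δ (y - (y - x) * t)), ?_, ?_, ?_, by simp, by simp⟩
  · exact continuous_chart.comp_continuousOn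
      ((continuousOn_arcPt hs hc hε Set.univ).comp h2.continuousOn fun _ _ => trivial)
  · refine Function.Injective.injOn fun s t hst => ?_
    have := arcPt_injective hs hc hε (chart_injective hst)
    exact mul_left_cancel₀ (sub_ne_zero.mpr hxy.ne') (by linarith)
  · rw [← h, Set.image_image, Set.image_image]

end

end

/-! ### The pieces and the arcs bordering them -/

section

variable {α : ℝ}

/-- `U p_A` has `Im N = sin α > 0`, so it marks the upper part. Only that part has to be connected:
the bigon is by definition what remains. -/
theorem face_pieces (hs : 0 < Real.sin α) (hc : 0 < Real.cos α) :
    Bp α 0 = chart '' lowerFace α ∧ Qp α 0 = chart '' upperFace α := by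
  have hd : arcPt α 1 1 0 ∈ upperFace α \ {(0, -1), (0, 1)} := by
    refine ⟨?_, arcPt_zero_notMem hs hc (by norm_num)⟩
    have h : arcPt α 1 1 0 ∈ halfArc α 1 1 := ⟨0, by norm_num, rfl⟩
    rw [← upperFace_inter_giraud hs hc (by norm_num)] at h
    exact h.1
  have hp : IsPreconnected (upperFace α \ {(0, -1), (0, 1)}) := by
    rw [upperFace_diff hs hc]
    exact isPreconnected_openUpperFace hc
  have hi := lowerFace_inter_upperFace hs hc
  constructor
  · rw [Bp, Fp_inter_bdH2_eq hc, face_eq_union, zero_add, ptA_zero_eq, ptB_zero_eq,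
      ptA_one_eq_arcPt hs]
    exact pieceAvoiding_chart isClosed_lowerFace isClosed_upperFace hi hd hp
  · rw [Qp, Fp_inter_bdH2_eq hc, face_eq_union, zero_add, ptA_zero_eq, ptB_zero_eq,
      ptA_one_eq_arcPt hs]
    exact pieceThrough_chart isClosed_lowerFace isClosed_upperFace hi hd hp

theorem arcAB_eq (hs : 0 < Real.sin α) (hc : 0 < Real.cos α) :
    arcAB α 0 = chart '' halfArc α 1 (-1) := by
  rw [arcAB, zero_add, circ_eq hc, ptA_zero_eq, ptB_zero_eq, ptA_one_eq_arcPt hs]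
  exact pieceAvoiding_giraud_lower hs hc (by norm_num)

theorem arcAA_eq (hs : 0 < Real.sin α) (hc : 0 < Real.cos α) :
    arcAA α 0 = chart '' upperArcNeg α 1 := by
  rw [arcAA, zero_add, circ_eq hc, ptA_zero_eq, ptB_zero_eq, ptA_one_eq_arcPt hs]
  exact pieceAvoiding_giraud_neg hs hc (by norm_num)

theorem arcUAB_eq (hs : 0 < Real.sin α) (hc : 0 < Real.cos α) :
    arcUAB α 0 = chart '' upperArcPos α 1 := by
  rw [arcUAB, zero_add, circ_eq hc, ptA_zero_eq, ptB_zero_eq, ptA_one_eq_arcPt hs]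
  exact pieceAvoiding_giraud_pos hs hc (by norm_num)

theorem arcUAUB'_eq (hs : 0 < Real.sin α) (hc : 0 < Real.cos α) :
    arcUAUB' α (-1) = chart '' halfArc α (-1) (-1) := by
  rw [arcUAUB', neg_add_cancel, circ'_eq hc, ptA_zero_eq, ptB_zero_eq, ptB_neg_one_eq_arcPt hs]
  exact pieceAvoiding_giraud_lower hs hc (by norm_num)

theorem arcUAB'_eq (hs : 0 < Real.sin α) (hc : 0 < Real.cos α) :
    arcUAB' α (-1) = chart '' upperArcNeg α (-1) := by
  rw [arcUAB', neg_add_cancel, circ'_eq hc, ptA_zero_eq, ptB_zero_eq, ptB_neg_one_eq_arcPt hs]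
  exact pieceAvoiding_giraud_neg hs hc (by norm_num)

theorem arcBB'_eq (hs : 0 < Real.sin α) (hc : 0 < Real.cos α) :
    arcBB' α (-1) = chart '' upperArcPos α (-1) := by
  rw [arcBB', neg_add_cancel, circ'_eq hc, ptA_zero_eq, ptB_zero_eq, ptB_neg_one_eq_arcPt hs]
  exact pieceAvoiding_giraud_pos hs hc (by norm_num)

/-! ### The arcs of the basic circles -/

theorem isArc_arcAB (hs : 0 < Real.sin α) (hc : 0 < Real.cos α) :
    IsArc (arcAB α 0) (ptA α 0) (ptB α 0) := by
  have h := isArc_chart_image (ε := 1) hs hc (by norm_num) (-1) (show (-1 : ℝ) < 1 by norm_num)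
  rwa [arcPt_one hs, arcPt_neg_one hs, ← ptA_zero_eq, ← ptB_zero_eq, ← halfArc,
    ← arcAB_eq hs hc] at h

theorem isArc_arcAA (hs : 0 < Real.sin α) (hc : 0 < Real.cos α) :
    IsArc (arcAA α 0) (ptA α 0) (ptA α 1) := by
  have h := isArc_chart_image (ε := 1) hs hc (by norm_num) 1 (show (0 : ℝ) < 1 by norm_num)
  rwa [arcPt_one hs, ← ptA_zero_eq, ← ptA_one_eq_arcPt hs, ← upperArcNeg, ← arcAA_eq hs hc] at h

theorem isArc_arcUAB (hs : 0 < Real.sin α) (hc : 0 < Real.cos α) :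
    IsArc (arcUAB α 0) (ptA α 1) (ptB α 0) := by
  have h := isArc_chart_image (ε := 1) hs hc (by norm_num) 1 (show (-1 : ℝ) < 0 by norm_num)
  rwa [arcPt_neg_one hs, ← ptB_zero_eq, ← ptA_one_eq_arcPt hs, ← upperArcPos,
    ← arcUAB_eq hs hc] at h

theorem isArc_arcUAUB' (hs : 0 < Real.sin α) (hc : 0 < Real.cos α) :
    IsArc (arcUAUB' α (-1)) (ptA α 0) (ptB α 0) := by
  have h := isArc_chart_image (ε := -1) hs hc (by norm_num) (-1) (show (-1 : ℝ) < 1 by norm_num)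
  rwa [arcPt_one hs, arcPt_neg_one hs, ← ptA_zero_eq, ← ptB_zero_eq, ← halfArc,
    ← arcUAUB'_eq hs hc] at h

theorem isArc_arcUAB' (hs : 0 < Real.sin α) (hc : 0 < Real.cos α) :
    IsArc (arcUAB' α (-1)) (ptA α 0) (ptB α (-1)) := by
  have h := isArc_chart_image (ε := -1) hs hc (by norm_num) 1 (show (0 : ℝ) < 1 by norm_num)
  rwa [arcPt_one hs, ← ptA_zero_eq, ← ptB_neg_one_eq_arcPt hs, ← upperArcNeg,
    ← arcUAB'_eq hs hc] at h

theorem isArc_arcBB' (hs : 0 < Real.sin α) (hc : 0 < Real.cos α) :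
    IsArc (arcBB' α (-1)) (ptB α (-1)) (ptB α 0) := by
  have h := isArc_chart_image (ε := -1) hs hc (by norm_num) 1 (show (-1 : ℝ) < 0 by norm_num)
  rwa [arcPt_neg_one hs, ← ptB_zero_eq, ← ptB_neg_one_eq_arcPt hs, ← upperArcPos,
    ← arcBB'_eq hs hc] at h

theorem arcUAB_inter_arcAB (hs : 0 < Real.sin α) (hc : 0 < Real.cos α) :
    arcUAB α 0 ∩ arcAB α 0 = {ptB α 0} := by
  rw [arcUAB_eq hs hc, arcAB_eq hs hc, ← Set.image_inter chart_injective,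
    upperArcPos_inter_halfArc hs hc (by norm_num), Set.image_singleton, ptB_zero_eq]

theorem arcUAB'_inter_arcUAUB' (hs : 0 < Real.sin α) (hc : 0 < Real.cos α) :
    arcUAB' α (-1) ∩ arcUAUB' α (-1) = {ptA α 0} := by
  rw [arcUAB'_eq hs hc, arcUAUB'_eq hs hc, ← Set.image_inter chart_injective,
    upperArcNeg_inter_halfArc hs hc (by norm_num), Set.image_singleton, ptA_zero_eq]

/-! ### The pieces of the first 3-face -/

theorem Bp_union_Qp (hs : 0 < Real.sin α) (hc : 0 < Real.cos α) :
    Bp α 0 ∪ Qp α 0 = Fp α 0 ∩ bdH2 := by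
  rw [(face_pieces hs hc).1, (face_pieces hs hc).2, ← Set.image_union, ← face_eq_union,
    Fp_inter_bdH2_eq hc]

theorem Bp_inter_circ (hs : 0 < Real.sin α) (hc : 0 < Real.cos α) :
    Bp α 0 ∩ circ α 0 = arcAB α 0 := by
  rw [(face_pieces hs hc).1, circ_eq hc, ← Set.image_inter chart_injective,
    lowerFace_inter_giraud hs hc (by norm_num), arcAB_eq hs hc]

theorem Bp_inter_circ' (hs : 0 < Real.sin α) (hc : 0 < Real.cos α) :
    Bp α 0 ∩ circ' α (-1) = arcUAUB' α (-1) := by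
  rw [(face_pieces hs hc).1, circ'_eq hc, ← Set.image_inter chart_injective,
    lowerFace_inter_giraud hs hc (by norm_num), arcUAUB'_eq hs hc]

theorem Qp_inter_circ (hs : 0 < Real.sin α) (hc : 0 < Real.cos α) :
    Qp α 0 ∩ circ α 0 = arcAA α 0 ∪ arcUAB α 0 := by
  rw [(face_pieces hs hc).2, circ_eq hc, ← Set.image_inter chart_injective,
    upperFace_inter_giraud hs hc (by norm_num), arcAA_eq hs hc, arcUAB_eq hs hc, Set.union_comm,
    ← Set.image_union, upperArcPos_union_upperArcNeg]

theorem Qp_inter_circ' (hs : 0 < Real.sin α) (hc : 0 < Real.cos α) :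
    Qp α 0 ∩ circ' α (-1) = arcBB' α (-1) ∪ arcUAB' α (-1) := by
  rw [(face_pieces hs hc).2, circ'_eq hc, ← Set.image_inter chart_injective,
    upperFace_inter_giraud hs hc (by norm_num), arcBB'_eq hs hc, arcUAB'_eq hs hc,
    ← Set.image_union, upperArcPos_union_upperArcNeg]

/-- Both closures can be taken in the chart, as both sets lie in the closed ball. -/
theorem boundaryIn_chart_image (hc : 0 < Real.cos α) {A : Set (ℂ × ℂ)} (hA : IsClosed A)
    (h : A ⊆ face α) : boundaryIn (Jp α 0 ∩ bdH2) (chart '' A) =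
      chart '' (A ∩ closure (spinal α \ A)) := by
  have h1 : chart '' spinal α ⊆ clH2 := by
    rw [← Jp_inter_bdH2_eq hc]
    exact fun P hP => hP.1.2
  rw [boundaryIn, Jp_inter_bdH2_eq hc, ← Set.image_sdiff chart_injective,
    closure_chart_image ((Set.image_mono fun p hp => (h hp).1).trans h1),
    closure_chart_image ((Set.image_mono Set.sdiff_subset).trans h1), hA.closure_eq,
    Set.image_inter chart_injective]

theorem boundaryIn_Bp (hs : 0 < Real.sin α) (hc : 0 < Real.cos α) :
    boundaryIn (Jp α 0 ∩ bdH2) (Bp α 0) = arcAB α 0 ∪ arcUAUB' α (-1) := by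
  rw [(face_pieces hs hc).1, boundaryIn_chart_image hc isClosed_lowerFace fun p hp => hp.1,
    lowerFace_boundary hs hc, Set.image_union, arcAB_eq hs hc, arcUAUB'_eq hs hc]

theorem boundaryIn_Qp (hs : 0 < Real.sin α) (hc : 0 < Real.cos α) :
    boundaryIn (Jp α 0 ∩ bdH2) (Qp α 0) =
      arcAA α 0 ∪ arcUAB α 0 ∪ arcBB' α (-1) ∪ arcUAB' α (-1) := by
  rw [(face_pieces hs hc).2, boundaryIn_chart_image hc isClosed_upperFace fun p hp => hp.1,
    upperFace_boundary hs hc, Set.image_union, ← upperArcPos_union_upperArcNeg,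
    ← upperArcPos_union_upperArcNeg, Set.image_union, Set.image_union, arcAA_eq hs hc,
    arcUAB_eq hs hc, arcBB'_eq hs hc, arcUAB'_eq hs hc, Set.union_comm (chart '' upperArcPos α 1),
    Set.union_assoc (_ ∪ _)]

/-! ### Distinctness of the vertices -/

/-- Each pair lies on a common half arc with distinct parameters among `1`, `0`, `-1`, and `arcPt`
is injective. -/
theorem vertices_ne (hs : 0 < Real.sin α) (hc : 0 < Real.cos α) :
    ptA α 0 ≠ ptB α 0 ∧ ptA α 0 ≠ ptA α 1 ∧ ptB α 0 ≠ ptA α 1 ∧ ptA α 0 ≠ ptB α (-1) ∧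
      ptB α 0 ≠ ptB α (-1) := by
  have key : ∀ {e e' ε : ℝ}, ε ^ 2 = 1 → e ≠ e' →
      chart (arcPt α ε 1 e) ≠ chart (arcPt α ε 1 e') := fun hε h h' =>
    h (arcPt_injective hs hc hε (chart_injective h'))
  have p1 : (1 : ℝ) ^ 2 = 1 := by norm_num
  have p2 : (-1 : ℝ) ^ 2 = 1 := by norm_num
  rw [ptA_zero_eq, ptB_zero_eq, ptA_one_eq_arcPt hs, ptB_neg_one_eq_arcPt hs]
  refine ⟨?_, ?_, ?_, ?_, ?_⟩
  · rw [← arcPt_one (ε := 1) (δ := 1) hs, ← arcPt_neg_one (ε := 1) (δ := 1) hs]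
    exact key p1 (by norm_num)
  · rw [← arcPt_one (ε := 1) (δ := 1) hs]
    exact key p1 (by norm_num)
  · rw [← arcPt_neg_one (ε := 1) (δ := 1) hs]
    exact key p1 (by norm_num)
  · rw [← arcPt_one (ε := -1) (δ := 1) hs]
    exact key p2 (by norm_num)
  · rw [← arcPt_neg_one (ε := -1) (δ := 1) hs]
    exact key p2 (by norm_num)

theorem mem_diff_pair {X : Set CP2} {a b c : CP2} (h : c ∈ X) (h1 : c ≠ a) (h2 : c ≠ b) :
    c ∈ X \ {a, b} := ⟨h, by simp [h1, h2]⟩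

theorem ptA_zero_mem_circ (hc : 0 < Real.cos α) : ptA α 0 ∈ circ α 0 :=
  have h := ptA_zero_mem (α := α) hc
  ⟨h.1.1, h.2⟩

theorem ptB_zero_mem_circ (hc : 0 < Real.cos α) : ptB α 0 ∈ circ α 0 :=
  have h := ptB_zero_mem (α := α) hc
  ⟨h.1.1, h.2⟩

theorem ptA_one_mem_circ (hs : 0 < Real.sin α) (hc : 0 < Real.cos α) : ptA α 1 ∈ circ α 0 := by
  rw [circ_eq hc, ptA_one_eq_arcPt hs]
  exact ⟨_, arcPt_mem_giraud hs hc (by norm_num) (by norm_num) (by norm_num), rfl⟩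

theorem ptA_zero_mem_circ' (hc : 0 < Real.cos α) : ptA α 0 ∈ circ' α (-1) := by
  rw [circ'_eq hc, ptA_zero_eq]
  exact ⟨_, neg_one_mem_giraud, rfl⟩

theorem ptB_zero_mem_circ' (hc : 0 < Real.cos α) : ptB α 0 ∈ circ' α (-1) := by
  rw [circ'_eq hc, ptB_zero_eq]
  exact ⟨_, one_mem_giraud, rfl⟩

theorem ptB_neg_one_mem_circ' (hs : 0 < Real.sin α) (hc : 0 < Real.cos α) :
    ptB α (-1) ∈ circ' α (-1) := by
  rw [circ'_eq hc, ptB_neg_one_eq_arcPt hs]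
  exact ⟨_, arcPt_mem_giraud hs hc (by norm_num) (by norm_num) (by norm_num), rfl⟩

theorem ptA_one_mem_Fp_diff (hs : 0 < Real.sin α) (hc : 0 < Real.cos α) :
    ptA α 1 ∈ (Fp α 0 ∩ bdH2) \ {ptA α 0, ptB α 0} :=
  have h := vertices_ne hs hc
  mem_diff_pair ⟨(ptA_one_mem_Fp hc).1, (ptA_one_mem_circ hs hc).2⟩ h.2.1.symm h.2.2.1.symm

theorem circ_eq_inter (hc : 0 < Real.cos α) : circ α 0 = Fp α 0 ∩ Fm α 0 ∩ bdH2 := by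
  rw [Fp_inter_Fm hc, circ]

/-! ### The pieces of the second 3-face -/

/-- `S⁻¹` sends the cut points `p_A`, `p_B` to `p_B`, `U p_A` and the marked point `U p_A` to `p_A`,
which are the data defining the bigon of the minus face up to the order of the cut points. -/
theorem Sinv_image_Bp (hs : 0 < Real.sin α) (hc : 0 < Real.cos α) :
    smulHomeo (S α)⁻¹ '' Bp α 0 = Bm α 0 := by
  rw [Bp, Bm, zero_add, image_pieceAvoiding _ (ptA_one_mem_Fp_diff hs hc),
    Sinv_image_bdH2 α (Sinv_image_Fp α), pieceAvoiding_comm]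
  simp only [smulHomeo_apply, Sinv_ptA_zero, Sinv_ptB_zero, Sinv_ptA_one]

theorem Sinv_image_Qp (hs : 0 < Real.sin α) (hc : 0 < Real.cos α) :
    smulHomeo (S α)⁻¹ '' Qp α 0 = Qm α 0 := by
  rw [Qp, Qm, zero_add, image_pieceThrough _ (ptA_one_mem_Fp_diff hs hc),
    Sinv_image_bdH2 α (Sinv_image_Fp α), pieceThrough_comm]
  simp only [smulHomeo_apply, Sinv_ptA_zero, Sinv_ptB_zero, Sinv_ptA_one]

theorem Sinv_image_arcAB (hs : 0 < Real.sin α) (hc : 0 < Real.cos α) :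
    smulHomeo (S α)⁻¹ '' arcAB α 0 = arcUAB α 0 := by
  have h := vertices_ne hs hc
  rw [arcAB, arcUAB, zero_add, image_pieceAvoiding _
    (mem_diff_pair (ptA_one_mem_circ hs hc) h.2.1.symm h.2.2.1.symm), Sinv_image_circ,
    pieceAvoiding_comm]
  simp only [smulHomeo_apply, Sinv_ptA_zero, Sinv_ptB_zero, Sinv_ptA_one]

theorem Sinv_image_arcAA (hs : 0 < Real.sin α) (hc : 0 < Real.cos α) :
    smulHomeo (S α)⁻¹ '' arcAA α 0 = arcAB α 0 := by
  have h := vertices_ne hs hc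
  rw [arcAB, arcAA, zero_add, image_pieceAvoiding _
    (mem_diff_pair (ptB_zero_mem_circ hc) h.1.symm h.2.2.1), Sinv_image_circ,
    pieceAvoiding_comm]
  simp only [smulHomeo_apply, Sinv_ptA_zero, Sinv_ptB_zero, Sinv_ptA_one]

theorem Sinv_image_arcUAB (hs : 0 < Real.sin α) (hc : 0 < Real.cos α) :
    smulHomeo (S α)⁻¹ '' arcUAB α 0 = arcAA α 0 := by
  have h := vertices_ne hs hc
  rw [arcUAB, arcAA, zero_add, image_pieceAvoiding _
    (mem_diff_pair (ptA_zero_mem_circ hc) h.2.1 h.1), Sinv_image_circ]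
  simp only [smulHomeo_apply, Sinv_ptA_zero, Sinv_ptB_zero, Sinv_ptA_one]

/-- `S⁻¹` sends the vertices `p_A`, `p_B`, `U⁻¹ p_B` of `c'_{-1}` to `p_B`, `U p_A`, `U p_B`,
whereas `U` sends them to `U p_A`, `U p_B`, `p_B`. The two maps match the arcs of `c'_{-1}` and
`c'_0` differently. -/
theorem Sinv_image_arcUAUB' (hs : 0 < Real.sin α) (hc : 0 < Real.cos α) :
    smulHomeo (S α)⁻¹ '' arcUAUB' α (-1) = arcUAB' α 0 := by
  have h := vertices_ne hs hc
  rw [arcUAUB', arcUAB', zero_add, neg_add_cancel, image_pieceAvoiding _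
    (mem_diff_pair (ptB_neg_one_mem_circ' hs hc) h.2.2.2.1.symm h.2.2.2.2.symm), Sinv_image_circ',
    pieceAvoiding_comm]
  simp only [smulHomeo_apply, Sinv_ptA_zero, Sinv_ptB_zero, Sinv_ptB_neg_one]

theorem Sinv_image_arcBB' (hs : 0 < Real.sin α) (hc : 0 < Real.cos α) :
    smulHomeo (S α)⁻¹ '' arcBB' α (-1) = arcUAUB' α 0 := by
  have h := vertices_ne hs hc
  rw [arcUAUB', arcBB', zero_add, neg_add_cancel, image_pieceAvoiding _
    (mem_diff_pair (ptA_zero_mem_circ' hc) h.2.2.2.1 h.1), Sinv_image_circ',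
    pieceAvoiding_comm]
  simp only [smulHomeo_apply, Sinv_ptA_zero, Sinv_ptB_zero, Sinv_ptB_neg_one]

theorem Sinv_image_arcUAB' (hs : 0 < Real.sin α) (hc : 0 < Real.cos α) :
    smulHomeo (S α)⁻¹ '' arcUAB' α (-1) = arcBB' α 0 := by
  have h := vertices_ne hs hc
  rw [arcUAB', arcBB', zero_add, neg_add_cancel, image_pieceAvoiding _
    (mem_diff_pair (ptB_zero_mem_circ' hc) h.1.symm h.2.2.2.2), Sinv_image_circ']
  simp only [smulHomeo_apply, Sinv_ptA_zero, Sinv_ptB_zero, Sinv_ptB_neg_one]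

theorem Bm_union_Qm (hs : 0 < Real.sin α) (hc : 0 < Real.cos α) :
    Bm α 0 ∪ Qm α 0 = Fm α 0 ∩ bdH2 := by
  rw [← Sinv_image_Bp hs hc, ← Sinv_image_Qp hs hc, ← Set.image_union, Bp_union_Qp hs hc,
    Sinv_image_bdH2 α (Sinv_image_Fp α)]

theorem Bm_inter_circ (hs : 0 < Real.sin α) (hc : 0 < Real.cos α) :
    Bm α 0 ∩ circ α 0 = arcUAB α 0 := by
  rw [← Sinv_image_Bp hs hc, ← Sinv_image_circ, ← Set.image_inter (smulHomeo _).injective,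
    Bp_inter_circ hs hc, Sinv_image_arcAB hs hc]

theorem Qm_inter_circ (hs : 0 < Real.sin α) (hc : 0 < Real.cos α) :
    Qm α 0 ∩ circ α 0 = arcAB α 0 ∪ arcAA α 0 := by
  rw [← Sinv_image_Qp hs hc, ← Sinv_image_circ, ← Set.image_inter (smulHomeo _).injective,
    Qp_inter_circ hs hc, Set.image_union, Sinv_image_arcAA hs hc, Sinv_image_arcUAB hs hc]

theorem Bm_inter_circ' (hs : 0 < Real.sin α) (hc : 0 < Real.cos α) :
    Bm α 0 ∩ circ' α 0 = arcUAB' α 0 := by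
  rw [← Sinv_image_Bp hs hc, ← Sinv_image_circ', ← Set.image_inter (smulHomeo _).injective,
    Bp_inter_circ' hs hc, Sinv_image_arcUAUB' hs hc]

theorem Qm_inter_circ' (hs : 0 < Real.sin α) (hc : 0 < Real.cos α) :
    Qm α 0 ∩ circ' α 0 = arcUAUB' α 0 ∪ arcBB' α 0 := by
  rw [← Sinv_image_Qp hs hc, ← Sinv_image_circ', ← Set.image_inter (smulHomeo _).injective,
    Qp_inter_circ' hs hc, Set.image_union, Sinv_image_arcBB' hs hc, Sinv_image_arcUAB' hs hc]

theorem boundaryIn_Bm (hs : 0 < Real.sin α) (hc : 0 < Real.cos α) :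
    boundaryIn (Jm α 0 ∩ bdH2) (Bm α 0) = arcUAB α 0 ∪ arcUAB' α 0 := by
  rw [← Sinv_image_Bp hs hc, ← Sinv_image_bdH2 α (Sinv_image_Jp α), ← image_boundaryIn,
    boundaryIn_Bp hs hc, Set.image_union, Sinv_image_arcAB hs hc, Sinv_image_arcUAUB' hs hc]

theorem boundaryIn_Qm (hs : 0 < Real.sin α) (hc : 0 < Real.cos α) :
    boundaryIn (Jm α 0 ∩ bdH2) (Qm α 0) =
      arcAA α 0 ∪ arcAB α 0 ∪ arcBB' α 0 ∪ arcUAUB' α 0 := by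
  rw [← Sinv_image_Qp hs hc, ← Sinv_image_bdH2 α (Sinv_image_Jp α), ← image_boundaryIn,
    boundaryIn_Qp hs hc, Set.image_union, Set.image_union, Set.image_union,
    Sinv_image_arcAA hs hc, Sinv_image_arcUAB hs hc, Sinv_image_arcBB' hs hc,
    Sinv_image_arcUAB' hs hc, Set.union_right_comm, Set.union_comm (arcAB α 0)]

/-! ### Translates by powers of `U` -/

theorem U_image_Bp (hs : 0 < Real.sin α) (hc : 0 < Real.cos α) (j : ℤ) :
    smulHomeo (U α ^ j) '' Bp α 0 = Bp α j := by
  rw [Bp, Bp, zero_add, image_pieceAvoiding _ (ptA_one_mem_Fp_diff hs hc),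
    U_image_bdH2 α j (U_image_Fp α j 0)]
  simp only [smulHomeo_apply, U_zpow_ptA, U_zpow_ptB, add_zero, add_comm]

theorem U_image_Qp (hs : 0 < Real.sin α) (hc : 0 < Real.cos α) (j : ℤ) :
    smulHomeo (U α ^ j) '' Qp α 0 = Qp α j := by
  rw [Qp, Qp, zero_add, image_pieceThrough _ (ptA_one_mem_Fp_diff hs hc),
    U_image_bdH2 α j (U_image_Fp α j 0)]
  simp only [smulHomeo_apply, U_zpow_ptA, U_zpow_ptB, add_zero, add_comm]

theorem ptA_zero_mem_Fm_diff (hs : 0 < Real.sin α) (hc : 0 < Real.cos α) :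
    ptA α 0 ∈ (Fm α 0 ∩ bdH2) \ {ptA α 1, ptB α 0} :=
  have h := vertices_ne hs hc
  mem_diff_pair ⟨(ptA_zero_mem_Fm hc).1, (ptA_zero_mem_circ hc).2⟩ h.2.1 h.1

theorem U_image_Bm (hs : 0 < Real.sin α) (hc : 0 < Real.cos α) (j : ℤ) :
    smulHomeo (U α ^ j) '' Bm α 0 = Bm α j := by
  rw [Bm, Bm, zero_add, image_pieceAvoiding _ (ptA_zero_mem_Fm_diff hs hc),
    U_image_bdH2 α j (U_image_Fm α j 0)]
  simp only [smulHomeo_apply, U_zpow_ptA, U_zpow_ptB, add_zero, add_comm]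

theorem U_image_Qm (hs : 0 < Real.sin α) (hc : 0 < Real.cos α) (j : ℤ) :
    smulHomeo (U α ^ j) '' Qm α 0 = Qm α j := by
  rw [Qm, Qm, zero_add, image_pieceThrough _ (ptA_zero_mem_Fm_diff hs hc),
    U_image_bdH2 α j (U_image_Fm α j 0)]
  simp only [smulHomeo_apply, U_zpow_ptA, U_zpow_ptB, add_zero, add_comm]

theorem U_image_arcUAUB' (hs : 0 < Real.sin α) (hc : 0 < Real.cos α) :
    smulHomeo (U α ^ (1 : ℤ)) '' arcUAUB' α (-1) = arcUAUB' α 0 := by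
  have h := vertices_ne hs hc
  rw [arcUAUB', arcUAUB', zero_add, neg_add_cancel, image_pieceAvoiding _
    (mem_diff_pair (ptB_neg_one_mem_circ' hs hc) h.2.2.2.1.symm h.2.2.2.2.symm), U_image_circ']
  simp only [smulHomeo_apply, U_zpow_ptA, U_zpow_ptB, zero_add, neg_add_cancel]

theorem U_image_arcBB' (hs : 0 < Real.sin α) (hc : 0 < Real.cos α) :
    smulHomeo (U α ^ (1 : ℤ)) '' arcBB' α (-1) = arcBB' α 0 := by
  have h := vertices_ne hs hc
  rw [arcBB', arcBB', zero_add, neg_add_cancel, image_pieceAvoiding _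
    (mem_diff_pair (ptA_zero_mem_circ' hc) h.2.2.2.1 h.1), U_image_circ']
  simp only [smulHomeo_apply, U_zpow_ptA, U_zpow_ptB, zero_add, neg_add_cancel]

theorem U_image_arcUAB' (hs : 0 < Real.sin α) (hc : 0 < Real.cos α) :
    smulHomeo (U α ^ (1 : ℤ)) '' arcUAB' α (-1) = arcUAB' α 0 := by
  have h := vertices_ne hs hc
  rw [arcUAB', arcUAB', zero_add, neg_add_cancel, image_pieceAvoiding _
    (mem_diff_pair (ptB_zero_mem_circ' hc) h.1.symm h.2.2.2.2), U_image_circ']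
  simp only [smulHomeo_apply, U_zpow_ptA, U_zpow_ptB, zero_add, neg_add_cancel]

theorem U_image_inv {A B : Set CP2} {j : ℤ} (h : smulHomeo (U α ^ j) '' A = B) :
    smulHomeo (U α ^ (-j)) '' B = A := by
  rw [← h, Set.image_image]
  simp [smulHomeo_apply, smul_smul]

theorem Bp_one_inter_circ' (hs : 0 < Real.sin α) (hc : 0 < Real.cos α) :
    Bp α 1 ∩ circ' α 0 = arcUAUB' α 0 := by
  have h := U_image_circ' α 1 (-1)
  rw [neg_add_cancel] at h
  rw [← U_image_Bp hs hc, ← h, ← Set.image_inter (smulHomeo _).injective,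
    Bp_inter_circ' hs hc, U_image_arcUAUB' hs hc]

theorem Qp_one_inter_circ' (hs : 0 < Real.sin α) (hc : 0 < Real.cos α) :
    Qp α 1 ∩ circ' α 0 = arcBB' α 0 ∪ arcUAB' α 0 := by
  have h := U_image_circ' α 1 (-1)
  rw [neg_add_cancel] at h
  rw [← U_image_Qp hs hc, ← h, ← Set.image_inter (smulHomeo _).injective,
    Qp_inter_circ' hs hc, Set.image_union, U_image_arcBB' hs hc, U_image_arcUAB' hs hc]

/-- Obtained by going from `c'_{-1}` to `c'_0` with `S⁻¹` and back with `U⁻¹`. -/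
theorem Bm_neg_one_inter_circ' (hs : 0 < Real.sin α) (hc : 0 < Real.cos α) :
    Bm α (-1) ∩ circ' α (-1) = arcUAB' α (-1) := by
  have h := U_image_circ' α (-1) 0
  rw [zero_add] at h
  rw [← U_image_Bm hs hc, ← h, ← Set.image_inter (smulHomeo _).injective,
    Bm_inter_circ' hs hc, U_image_inv (U_image_arcUAB' hs hc)]

theorem Qm_neg_one_inter_circ' (hs : 0 < Real.sin α) (hc : 0 < Real.cos α) :
    Qm α (-1) ∩ circ' α (-1) = arcUAUB' α (-1) ∪ arcBB' α (-1) := by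
  have h := U_image_circ' α (-1) 0
  rw [zero_add] at h
  rw [← U_image_Qm hs hc, ← h, ← Set.image_inter (smulHomeo _).injective,
    Qm_inter_circ' hs hc, Set.image_union, U_image_inv (U_image_arcUAUB' hs hc),
    U_image_inv (U_image_arcBB' hs hc)]

theorem Bp_union_Qp_eq (hs : 0 < Real.sin α) (hc : 0 < Real.cos α) (j : ℤ) :
    Bp α j ∪ Qp α j = Fp α j ∩ bdH2 := by
  rw [← U_image_Bp hs hc, ← U_image_Qp hs hc, ← Set.image_union, Bp_union_Qp hs hc,
    U_image_bdH2 α j (U_image_Fp α j 0), zero_add]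

theorem Bm_union_Qm_eq (hs : 0 < Real.sin α) (hc : 0 < Real.cos α) (j : ℤ) :
    Bm α j ∪ Qm α j = Fm α j ∩ bdH2 := by
  rw [← U_image_Bm hs hc, ← U_image_Qm hs hc, ← Set.image_union, Bm_union_Qm hs hc,
    U_image_bdH2 α j (U_image_Fm α j 0), zero_add]

theorem arcUAB'_inter_arcUAUB'_zero (hs : 0 < Real.sin α) (hc : 0 < Real.cos α) :
    arcUAB' α 0 ∩ arcUAUB' α 0 = {ptA α 1} := by
  rw [← U_image_arcUAB' hs hc, ← U_image_arcUAUB' hs hc, ← Set.image_inter (smulHomeo _).injective,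
    arcUAB'_inter_arcUAUB' hs hc, Set.image_singleton, smulHomeo_apply, U_zpow_ptA, zero_add]

/-- Pieces of different faces meet only on the circle common to the faces, so it suffices to know
the trace of each piece on that circle. -/
theorem inter_eq_of_subset {X Y C X' Y' : Set CP2} (h : X ∩ Y ⊆ C) (hX : X ∩ C = X')
    (hY : Y ∩ C = Y') : X ∩ Y = X' ∩ Y' := by
  rw [← hX, ← hY, ← Set.inter_inter_distrib_right, Set.inter_eq_left.mpr h]

theorem Fp_inter_Fm_inter_bdH2 (hs : 0 < Real.sin α) (hc : 0 < Real.cos α) :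
    (Bp α 0 ∪ Qp α 0) ∩ (Bm α 0 ∪ Qm α 0) ⊆ circ α 0 := by
  rw [Bp_union_Qp_eq hs hc, Bm_union_Qm_eq hs hc, ← Set.inter_inter_distrib_right,
    ← circ_eq_inter hc]

theorem Fp_inter_Fm_neg_one_inter_bdH2 (hs : 0 < Real.sin α) (hc : 0 < Real.cos α) :
    (Bp α 0 ∪ Qp α 0) ∩ (Bm α (-1) ∪ Qm α (-1)) ⊆ circ' α (-1) := by
  rw [Bp_union_Qp_eq hs hc, Bm_union_Qm_eq hs hc, ← Set.inter_inter_distrib_right,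
    Fp_inter_Fm' hc, circ', neg_add_cancel, Set.inter_comm (Jp α 0)]

theorem Fm_inter_Fp_one_inter_bdH2 (hs : 0 < Real.sin α) (hc : 0 < Real.cos α) :
    (Bm α 0 ∪ Qm α 0) ∩ (Bp α 1 ∪ Qp α 1) ⊆ circ' α 0 := by
  rw [Bp_union_Qp_eq hs hc, Bm_union_Qm_eq hs hc, ← Set.inter_inter_distrib_right,
    Fm_inter_Fp hc, circ', zero_add]

theorem mem_bdH2_pair {a b : CP2} (ha : a ∈ bdH2) (hb : b ∈ bdH2) :
    ({a, b} : Set CP2) ∩ bdH2 = {a, b} :=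
  Set.inter_eq_left.mpr (Set.pair_subset ha hb)

theorem Fp_inter_Fp_inter_bdH2 (hs : 0 < Real.sin α) (hc : 0 < Real.cos α) :
    (Fp α 0 ∩ bdH2) ∩ (Fp α 1 ∩ bdH2) = {ptB α 0, ptA α 1} := by
  rw [← Set.inter_inter_distrib_right, Fp_inter_Fp hs hc,
    mem_bdH2_pair (ptB_zero_mem_circ hc).2 (ptA_one_mem_circ hs hc).2]

theorem Fm_inter_Fm_inter_bdH2 (hs : 0 < Real.sin α) (hc : 0 < Real.cos α) :
    (Fm α 0 ∩ bdH2) ∩ (Fm α (-1) ∩ bdH2) = {ptB α 0, ptA α 0} := by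
  rw [← Set.inter_inter_distrib_right, Fm_inter_Fm hs hc,
    mem_bdH2_pair (ptB_zero_mem_circ hc).2 (ptA_zero_mem_circ hc).2]

theorem Fp_neg_one_inter (hs : 0 < Real.sin α) (hc : 0 < Real.cos α) :
    (Fp α 0 ∩ bdH2) ∩ (Fp α (-1) ∩ bdH2) = {ptB α (-1), ptA α 0} := by
  have h : smulHomeo (U α ^ (-1 : ℤ)) '' _ = _ :=
    congrArg (smulHomeo (U α ^ (-1 : ℤ)) '' ·) (Fp_inter_Fp_inter_bdH2 hs hc)
  rw [Set.image_inter (smulHomeo _).injective, U_image_bdH2 α _ (U_image_Fp α _ _),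
    U_image_bdH2 α _ (U_image_Fp α _ _), zero_add, add_neg_cancel, Set.inter_comm] at h
  rw [h, Set.image_pair, smulHomeo_apply, smulHomeo_apply, U_zpow_ptA, U_zpow_ptB, zero_add,
    add_neg_cancel]

theorem Fm_one_inter (hs : 0 < Real.sin α) (hc : 0 < Real.cos α) :
    (Fm α 0 ∩ bdH2) ∩ (Fm α 1 ∩ bdH2) = {ptA α 1, ptB α 1} := by
  have h : smulHomeo (U α ^ (1 : ℤ)) '' _ = _ :=
    congrArg (smulHomeo (U α ^ (1 : ℤ)) '' ·) (Fm_inter_Fm_inter_bdH2 hs hc)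
  rw [Set.image_inter (smulHomeo _).injective, U_image_bdH2 α _ (U_image_Fm α _ _),
    U_image_bdH2 α _ (U_image_Fm α _ _), zero_add, neg_add_cancel, Set.inter_comm] at h
  rw [h, Set.image_pair, smulHomeo_apply, smulHomeo_apply, U_zpow_ptA, U_zpow_ptB, zero_add,
    Set.pair_comm]

/-! ### Intersections of the pieces -/

theorem Bp_inter_Qm (hs : 0 < Real.sin α) (hc : 0 < Real.cos α) :
    Bp α 0 ∩ Qm α 0 = arcAB α 0 := by
  rw [inter_eq_of_subset ((Set.inter_subset_inter Set.subset_union_left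
    Set.subset_union_right).trans (Fp_inter_Fm_inter_bdH2 hs hc)) (Bp_inter_circ hs hc)
    (Qm_inter_circ hs hc), Set.inter_eq_left]
  exact Set.subset_union_left

theorem Bp_inter_Bm (hs : 0 < Real.sin α) (hc : 0 < Real.cos α) :
    Bp α 0 ∩ Bm α 0 = {ptB α 0} := by
  rw [inter_eq_of_subset ((Set.inter_subset_inter Set.subset_union_left
    Set.subset_union_left).trans (Fp_inter_Fm_inter_bdH2 hs hc)) (Bp_inter_circ hs hc)
    (Bm_inter_circ hs hc), Set.inter_comm, arcUAB_inter_arcAB hs hc]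

theorem union_inter_union_of_inter {A B C : Set CP2} {a : CP2} (h : B ∩ C = {a}) :
    (A ∪ B) ∩ (C ∪ A) = A ∪ {a} := by
  rw [Set.union_comm C, ← Set.union_inter_distrib_left, h]

/-- The traces on `c_0` are two arcs each, with one arc in common. The remaining two arcs share only
the vertex `p_B`, which is the isolated extra point. -/
theorem Qp_inter_Qm (hs : 0 < Real.sin α) (hc : 0 < Real.cos α) :
    Qp α 0 ∩ Qm α 0 = arcAA α 0 ∪ {ptB α 0} := by
  rw [inter_eq_of_subset ((Set.inter_subset_inter Set.subset_union_right
    Set.subset_union_right).trans (Fp_inter_Fm_inter_bdH2 hs hc)) (Qp_inter_circ hs hc)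
    (Qm_inter_circ hs hc), union_inter_union_of_inter (arcUAB_inter_arcAB hs hc)]

theorem Qp_inter_Bm (hs : 0 < Real.sin α) (hc : 0 < Real.cos α) :
    Qp α 0 ∩ Bm α 0 = arcUAB α 0 := by
  rw [inter_eq_of_subset ((Set.inter_subset_inter Set.subset_union_right
    Set.subset_union_left).trans (Fp_inter_Fm_inter_bdH2 hs hc)) (Qp_inter_circ hs hc)
    (Bm_inter_circ hs hc), Set.inter_eq_right]
  exact Set.subset_union_right

theorem Bp_inter_Qm_neg_one (hs : 0 < Real.sin α) (hc : 0 < Real.cos α) :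
    Bp α 0 ∩ Qm α (-1) = arcUAUB' α (-1) := by
  rw [inter_eq_of_subset ((Set.inter_subset_inter Set.subset_union_left
    Set.subset_union_right).trans (Fp_inter_Fm_neg_one_inter_bdH2 hs hc)) (Bp_inter_circ' hs hc)
    (Qm_neg_one_inter_circ' hs hc), Set.inter_eq_left]
  exact Set.subset_union_left

theorem Bp_inter_Bm_neg_one (hs : 0 < Real.sin α) (hc : 0 < Real.cos α) :
    Bp α 0 ∩ Bm α (-1) = {ptA α 0} := by
  rw [inter_eq_of_subset ((Set.inter_subset_inter Set.subset_union_left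
    Set.subset_union_left).trans (Fp_inter_Fm_neg_one_inter_bdH2 hs hc)) (Bp_inter_circ' hs hc)
    (Bm_neg_one_inter_circ' hs hc), Set.inter_comm, arcUAB'_inter_arcUAUB' hs hc]

theorem Qp_inter_Qm_neg_one (hs : 0 < Real.sin α) (hc : 0 < Real.cos α) :
    Qp α 0 ∩ Qm α (-1) = arcBB' α (-1) ∪ {ptA α 0} := by
  rw [inter_eq_of_subset ((Set.inter_subset_inter Set.subset_union_right
    Set.subset_union_right).trans (Fp_inter_Fm_neg_one_inter_bdH2 hs hc)) (Qp_inter_circ' hs hc)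
    (Qm_neg_one_inter_circ' hs hc), union_inter_union_of_inter (arcUAB'_inter_arcUAUB' hs hc)]

theorem Qp_inter_Bm_neg_one (hs : 0 < Real.sin α) (hc : 0 < Real.cos α) :
    Qp α 0 ∩ Bm α (-1) = arcUAB' α (-1) := by
  rw [inter_eq_of_subset ((Set.inter_subset_inter Set.subset_union_right
    Set.subset_union_left).trans (Fp_inter_Fm_neg_one_inter_bdH2 hs hc)) (Qp_inter_circ' hs hc)
    (Bm_neg_one_inter_circ' hs hc), Set.inter_eq_right]
  exact Set.subset_union_right

theorem Bm_inter_Qp_one (hs : 0 < Real.sin α) (hc : 0 < Real.cos α) :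
    Bm α 0 ∩ Qp α 1 = arcUAB' α 0 := by
  rw [inter_eq_of_subset ((Set.inter_subset_inter Set.subset_union_left
    Set.subset_union_right).trans (Fm_inter_Fp_one_inter_bdH2 hs hc)) (Bm_inter_circ' hs hc)
    (Qp_one_inter_circ' hs hc), Set.inter_eq_left]
  exact Set.subset_union_right

theorem Bm_inter_Bp_one (hs : 0 < Real.sin α) (hc : 0 < Real.cos α) :
    Bm α 0 ∩ Bp α 1 = {ptA α 1} := by
  rw [inter_eq_of_subset ((Set.inter_subset_inter Set.subset_union_left
    Set.subset_union_left).trans (Fm_inter_Fp_one_inter_bdH2 hs hc)) (Bm_inter_circ' hs hc)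
    (Bp_one_inter_circ' hs hc), arcUAB'_inter_arcUAUB'_zero hs hc]

theorem Qm_inter_Qp_one (hs : 0 < Real.sin α) (hc : 0 < Real.cos α) :
    Qm α 0 ∩ Qp α 1 = arcBB' α 0 ∪ {ptA α 1} := by
  rw [inter_eq_of_subset ((Set.inter_subset_inter Set.subset_union_right
    Set.subset_union_right).trans (Fm_inter_Fp_one_inter_bdH2 hs hc)) (Qm_inter_circ' hs hc)
    (Qp_one_inter_circ' hs hc), Set.inter_comm,
    union_inter_union_of_inter (arcUAB'_inter_arcUAUB'_zero hs hc)]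

theorem Qm_inter_Bp_one (hs : 0 < Real.sin α) (hc : 0 < Real.cos α) :
    Qm α 0 ∩ Bp α 1 = arcUAUB' α 0 := by
  rw [inter_eq_of_subset ((Set.inter_subset_inter Set.subset_union_right
    Set.subset_union_left).trans (Fm_inter_Fp_one_inter_bdH2 hs hc)) (Qm_inter_circ' hs hc)
    (Bp_one_inter_circ' hs hc), Set.inter_eq_right]
  exact Set.subset_union_left

theorem isArc_arcs'_zero (hs : 0 < Real.sin α) (hc : 0 < Real.cos α) :
    IsArc (arcBB' α 0) (ptB α 0) (ptB α 1) ∧ IsArc (arcUAB' α 0) (ptA α 1) (ptB α 0) ∧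
      IsArc (arcUAUB' α 0) (ptA α 1) (ptB α 1) := by
  have h1 := (isArc_arcBB' hs hc).image (smulHomeo (U α ^ (1 : ℤ)))
  have h2 := (isArc_arcUAB' hs hc).image (smulHomeo (U α ^ (1 : ℤ)))
  have h3 := (isArc_arcUAUB' hs hc).image (smulHomeo (U α ^ (1 : ℤ)))
  rw [U_image_arcBB' hs hc] at h1
  rw [U_image_arcUAB' hs hc] at h2
  rw [U_image_arcUAUB' hs hc] at h3
  simp only [smulHomeo_apply, U_zpow_ptA, U_zpow_ptB, zero_add, neg_add_cancel] at h1 h2 h3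
  exact ⟨h1, h2, h3⟩

end

end Ford

end

/-! ### Assembly of the incidences -/

theorem mainTheorem5 (α : ℝ) (hα₀ : 0 < α) (hα₁ : α < Real.pi / 2) :
    -- the 3-faces
    ((Ford.Fp α 0 ∩ Ford.Fm α 0 = Ford.Jp α 0 ∩ Ford.Jm α 0 ∧
        Ford.IsGiraudDisk (Ford.Fp α 0 ∩ Ford.Fm α 0)) ∧
      (Ford.Fp α 0 ∩ Ford.Fm α (-1) = Ford.Jp α 0 ∩ Ford.Jm α (-1) ∧
        Ford.IsGiraudDisk (Ford.Fp α 0 ∩ Ford.Fm α (-1))) ∧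
      (Ford.Fm α 0 ∩ Ford.Fp α 1 = Ford.Jm α 0 ∩ Ford.Jp α 1 ∧
        Ford.IsGiraudDisk (Ford.Fm α 0 ∩ Ford.Fp α 1)) ∧
      Ford.Fp α 0 ∩ Ford.Fp α 1 = {Ford.ptB α 0, Ford.ptA α 1} ∧
      Ford.Fm α 0 ∩ Ford.Fm α (-1) = {Ford.ptB α 0, Ford.ptA α 0}) ∧
    -- the two Giraud circles on each of the two spinal surfaces are cut into arcs
    (Ford.IsArc (Ford.arcAB α 0) (Ford.ptA α 0) (Ford.ptB α 0) ∧
      Ford.IsArc (Ford.arcAA α 0) (Ford.ptA α 0) (Ford.ptA α 1) ∧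
      Ford.IsArc (Ford.arcUAB α 0) (Ford.ptA α 1) (Ford.ptB α 0) ∧
      Ford.IsArc (Ford.arcBB' α 0) (Ford.ptB α 0) (Ford.ptB α 1) ∧
      Ford.IsArc (Ford.arcUAB' α 0) (Ford.ptA α 1) (Ford.ptB α 0) ∧
      Ford.IsArc (Ford.arcUAUB' α 0) (Ford.ptA α 1) (Ford.ptB α 1) ∧
      Ford.IsArc (Ford.arcBB' α (-1)) (Ford.ptB α (-1)) (Ford.ptB α 0) ∧
      Ford.IsArc (Ford.arcUAB' α (-1)) (Ford.ptA α 0) (Ford.ptB α (-1)) ∧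
      Ford.IsArc (Ford.arcUAUB' α (-1)) (Ford.ptA α 0) (Ford.ptB α 0)) ∧
    -- the bigon and the quadrilateral at infinity of the first 3-face
    ((Ford.boundaryIn (Ford.Jp α 0 ∩ Ford.bdH2) (Ford.Bp α 0) =
          Ford.arcAB α 0 ∪ Ford.arcUAUB' α (-1) ∧
        Ford.Bp α 0 ∩ Ford.Qm α 0 = Ford.arcAB α 0 ∧
        Ford.Bp α 0 ∩ Ford.Qm α (-1) = Ford.arcUAUB' α (-1) ∧
        Ford.Bp α 0 ∩ Ford.Bm α 0 = {Ford.ptB α 0} ∧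
        Ford.Bp α 0 ∩ Ford.Bm α (-1) = {Ford.ptA α 0}) ∧
      (Ford.boundaryIn (Ford.Jp α 0 ∩ Ford.bdH2) (Ford.Qp α 0) =
          Ford.arcAA α 0 ∪ Ford.arcUAB α 0 ∪ Ford.arcBB' α (-1) ∪ Ford.arcUAB' α (-1) ∧
        Ford.Qp α 0 ∩ Ford.Qm α 0 = Ford.arcAA α 0 ∪ {Ford.ptB α 0} ∧
        Ford.Qp α 0 ∩ Ford.Bm α 0 = Ford.arcUAB α 0 ∧
        Ford.Qp α 0 ∩ Ford.Qm α (-1) = Ford.arcBB' α (-1) ∪ {Ford.ptA α 0} ∧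
        Ford.Qp α 0 ∩ Ford.Bm α (-1) = Ford.arcUAB' α (-1)) ∧
      (Ford.Bp α 0 ∪ Ford.Qp α 0) ∩ (Ford.Bp α (-1) ∪ Ford.Qp α (-1)) =
        {Ford.ptB α (-1), Ford.ptA α 0} ∧
      (Ford.Bp α 0 ∪ Ford.Qp α 0) ∩ (Ford.Bp α 1 ∪ Ford.Qp α 1) =
        {Ford.ptB α 0, Ford.ptA α 1}) ∧
    -- the bigon and the quadrilateral at infinity of the second 3-face
    ((Ford.boundaryIn (Ford.Jm α 0 ∩ Ford.bdH2) (Ford.Bm α 0) =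
          Ford.arcUAB α 0 ∪ Ford.arcUAB' α 0 ∧
        Ford.Bm α 0 ∩ Ford.Qp α 0 = Ford.arcUAB α 0 ∧
        Ford.Bm α 0 ∩ Ford.Qp α 1 = Ford.arcUAB' α 0 ∧
        Ford.Bm α 0 ∩ Ford.Bp α 0 = {Ford.ptB α 0} ∧
        Ford.Bm α 0 ∩ Ford.Bp α 1 = {Ford.ptA α 1}) ∧
      (Ford.boundaryIn (Ford.Jm α 0 ∩ Ford.bdH2) (Ford.Qm α 0) =
          Ford.arcAA α 0 ∪ Ford.arcAB α 0 ∪ Ford.arcBB' α 0 ∪ Ford.arcUAUB' α 0 ∧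
        Ford.Qm α 0 ∩ Ford.Qp α 0 = Ford.arcAA α 0 ∪ {Ford.ptB α 0} ∧
        Ford.Qm α 0 ∩ Ford.Bp α 0 = Ford.arcAB α 0 ∧
        Ford.Qm α 0 ∩ Ford.Qp α 1 = Ford.arcBB' α 0 ∪ {Ford.ptA α 1} ∧
        Ford.Qm α 0 ∩ Ford.Bp α 1 = Ford.arcUAUB' α 0) ∧
      (Ford.Bm α 0 ∪ Ford.Qm α 0) ∩ (Ford.Bm α (-1) ∪ Ford.Qm α (-1)) =
        {Ford.ptA α 0, Ford.ptB α 0} ∧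
      (Ford.Bm α 0 ∪ Ford.Qm α 0) ∩ (Ford.Bm α 1 ∪ Ford.Qm α 1) =
        {Ford.ptA α 1, Ford.ptB α 1}) := by
  have hs : 0 < Real.sin α :=
    Real.sin_pos_of_pos_of_lt_pi hα₀ (by linarith [Real.pi_pos])
  have hc : 0 < Real.cos α := Real.cos_pos_of_mem_Ioo ⟨by linarith, hα₁⟩
  open Ford in
  obtain ⟨k1, k2, k3⟩ := isArc_arcs'_zero hs hc
  open Ford in
  refine ⟨⟨⟨Fp_inter_Fm hc, ?_⟩, ⟨Fp_inter_Fm' hc, ?_⟩, ⟨Fm_inter_Fp hc, ?_⟩, Fp_inter_Fp hs hc,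
      Fm_inter_Fm hs hc⟩,
    ⟨isArc_arcAB hs hc, isArc_arcAA hs hc, isArc_arcUAB hs hc, k1, k2, k3, isArc_arcBB' hs hc,
      isArc_arcUAB' hs hc, isArc_arcUAUB' hs hc⟩,
    ⟨⟨boundaryIn_Bp hs hc, Bp_inter_Qm hs hc, Bp_inter_Qm_neg_one hs hc, Bp_inter_Bm hs hc,
        Bp_inter_Bm_neg_one hs hc⟩,
      ⟨boundaryIn_Qp hs hc, Qp_inter_Qm hs hc, Qp_inter_Bm hs hc, Qp_inter_Qm_neg_one hs hc,
        Qp_inter_Bm_neg_one hs hc⟩, ?_, ?_⟩,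
    ⟨⟨boundaryIn_Bm hs hc, ?_, Bm_inter_Qp_one hs hc, ?_, Bm_inter_Bp_one hs hc⟩,
      ⟨boundaryIn_Qm hs hc, ?_, ?_, Qm_inter_Qp_one hs hc, Qm_inter_Bp_one hs hc⟩, ?_, ?_⟩⟩
  · rw [Ford.Fp_inter_Fm hc]
    exact Ford.isGiraudDisk_Jp_inter_Jm hs hc
  · rw [Ford.Fp_inter_Fm' hc]
    exact Ford.isGiraudDisk_Jp_inter_Jm' hs hc
  · rw [Ford.Fm_inter_Fp hc]
    exact Ford.isGiraudDisk_Jm_inter_Jp hs hc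
  · rw [Ford.Bp_union_Qp_eq hs hc, Ford.Bp_union_Qp_eq hs hc, Ford.Fp_neg_one_inter hs hc]
  · rw [Ford.Bp_union_Qp_eq hs hc, Ford.Bp_union_Qp_eq hs hc, Ford.Fp_inter_Fp_inter_bdH2 hs hc]
  · rw [Set.inter_comm, Ford.Qp_inter_Bm hs hc]
  · rw [Set.inter_comm, Ford.Bp_inter_Bm hs hc]
  · rw [Set.inter_comm, Ford.Qp_inter_Qm hs hc]
  · rw [Set.inter_comm, Ford.Bp_inter_Qm hs hc]
  · rw [Ford.Bm_union_Qm_eq hs hc, Ford.Bm_union_Qm_eq hs hc, Ford.Fm_inter_Fm_inter_bdH2 hs hc,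
      Set.pair_comm]
  · rw [Ford.Bm_union_Qm_eq hs hc, Ford.Bm_union_Qm_eq hs hc, Ford.Fm_one_inter hs hc]
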